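/- **Setting.** All topological spaces are Hausdorff and second countable. Let $G$ be a locally compact group with left Haar measure $\mu$ and modular function $\Delta$ (so $\mu(Eg)=\Delta(g)\mu(E)$), and let $P\subseteq G$ be a closed subsemigroup containing the identity such that $G=PP^{-1}$ and the interior $\mathrm{Int}(P)$ is dense in $P$. For $g\in G$ let $(U_g\eta)(x)=\Delta(g)^{1/2}\eta(xg)$ on $L^2(G)$, let $E$ be the orthogonal projection of $L^2(G)$ onto $L^2(P)$, and for $f\in L^1(G)$ let $W_f=\int_G f(g)\,EU_gE\,d\mu(g)\in B(L^2(P))$. The Wiener–Hopf algebra $\mathcal W(P)$ is the $C^*$-subalgebra of $B(L^2(P))$ generated by $\{W_f: f\in L^1(G)\}$. Let $X$ be a compact space with a continuous right action of $P$ that is injective, i.e. $x\mapsto xa$ is injective for every $a\in P$. Let $X\rtimes P$ be the set of all $(x,g)\in X\times G$ for which there are $a,b\in P$ and $y\in X$ with $g=ab^{-1}$ and $xa=yb$, with the subspace topology of $X\times G$. Here $y=:s(x,g)$ is determined by $(x,g)$, and $X\rtimes P$ is a locally compact groupoid with unit space $X$, range map $r(x,g)=x$, source map $s$, product $(x,g)(y,h)=(x,gh)$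 if $y=s(x,g)$, and inverse $(x,g)^{-1}=(s(x,g),g^{-1})$. For $x\in X$ put $Q_x=\{g\in G:(x,g)\in X\rtimes P\}$, and let $\lambda^x$ be the measure on $r^{-1}(x)=\{x\}\times Q_x$ given by $\int f\,d\lambda^x=\int_{Q_x} f(x,g)\,d\mu(g)$. If the action map $X\times\mathrm{Int}(P)\to X$ is open, then $(\lambda^x)_{x\in X}$ is a left Haar system, and $C^*_{red}(X\rtimes P)$ denotes the reduced $C^*$-algebra with respect to it, that is, the completion of the $*$-algebra $C_c(X\rtimes P)$ in the norm $\sup_{x\in X}\|\mathrm{Ind}\,\delta_x(f)\|$, where $\mathrm{Ind}\,\delta_x(f)$ acts on $L^2(r^{-1}(x),\lambda^x)$ by $(\mathrm{Ind}\,\delta_x(f)\xi)(\gamma)=\int f(\gamma^{-1}\eta)\xi(\eta)\,d\lambda^x(\eta)$. **Theorem.** Assume that the map $X\times \mathrm{Int}(P)\to X$, $(x,a)\mapsto xa$, is open and that - (A1) there is $x_0\in X$ with $Q_{x_0}=P$, - (A2) $\{x_0a: a\in P\}$ is dense in $X$, and - (A3) for $x,y\in X$, if $Q_x=Q_y$ then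 $x=y$. Then $\mathcal W(P)$ and $C^*_{red}(X\rtimes P)$ are isomorphic as $C^*$-algebras. -/

import Mathlib

open MeasureTheory Measure CategoryTheory
open scoped ENNReal NNReal RightActions CompactlySupported

/-! ## The semigroup -/

/-- A closed submonoid `P` of a topological group `G` such that `G = P P⁻¹` and the interior of `P`
is dense in `P`. -/
class IsContinuousOre {G : Type*} [Group G] [TopologicalSpace G] (P : Submonoid G) : Prop where
  isClosed : IsClosed (P : Set G)
  exists_eq_mul_inv : ∀ g : G, ∃ a b : P, g = (a : G) * (b : G)⁻¹
  subset_closure_interior : (P : Set G) ⊆ closure (interior (P : Set G))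

/-! ## The Wiener-Hopf algebra -/

noncomputable section SubspaceL2

variable {G : Type*} [Group G] [MeasurableSpace G] (μ : Measure G)

/-- The Hilbert space `L²(P)`. -/
abbrev L2Sub (P : Submonoid G) : Type _ := Lp ℂ 2 (μ.restrict (P : Set G))

/-- The restriction map `L²(G) → L²(P)`. Under the identification of `L²(P)` with a closed subspace
of `L²(G)`, this is the orthogonal projection `E`. -/
def restrictL2 (P : Submonoid G) : Lp ℂ 2 μ →L[ℂ] L2Sub μ P :=
  LpToLpRestrictCLM G ℂ ℂ μ 2 (P : Set G)

/-- The inclusion `L²(P) → L²(G)`, extending functions by zero outside `P`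
(see `extendL2_coeFn`); it is the adjoint of the restriction. -/
def extendL2 (P : Submonoid G) : L2Sub μ P →L[ℂ] Lp ℂ 2 μ :=
  ContinuousLinearMap.adjoint (restrictL2 μ P)

theorem extendL2_coeFn (P : Submonoid G) (hP : MeasurableSet (P : Set G)) (ξ : L2Sub μ P) :
    extendL2 μ P ξ =ᵐ[μ] (P : Set G).indicator ξ := by
  have h0 : MemLp ((P : Set G).indicator ξ) 2 μ := (memLp_indicator_iff_restrict hP).2 (Lp.memLp ξ)
  have h1 : extendL2 μ P ξ = h0.toLp _ := by
    refine ext_inner_right ℂ fun η => ?_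
    rw [extendL2, ContinuousLinearMap.adjoint_inner_left, L2.inner_def, L2.inner_def,
      ← integral_indicator hP]
    refine integral_congr_ae ?_
    have h2 := (ae_restrict_iff' hP).1 (LpToLpRestrictCLM_coeFn ℂ (P : Set G) η)
    filter_upwards [h2, h0.coeFn_toLp] with x hx hx'
    rw [hx']
    by_cases hxP : x ∈ (P : Set G)
    · rw [Set.indicator_of_mem hxP, Set.indicator_of_mem hxP, restrictL2, hx hxP]
    · rw [Set.indicator_of_notMem hxP, Set.indicator_of_notMem hxP, inner_zero_left]
  rw [h1]
  exact h0.coeFn_toLp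

theorem norm_extendL2_le (P : Submonoid G) (ξ : L2Sub μ P) : ‖extendL2 μ P ξ‖ ≤ ‖ξ‖ := by
  have h1 : ‖extendL2 μ P‖ ≤ 1 := by
    rw [extendL2, LinearIsometryEquiv.norm_map]
    exact ContinuousLinearMap.opNorm_le_bound _ zero_le_one fun η => by
      rw [one_mul]
      exact norm_Lp_toLp_restrict_le _ η
  simpa using (extendL2 μ P).le_of_opNorm_le h1 ξ

end SubspaceL2

noncomputable section WienerHopf

variable {G : Type*} [Group G] [TopologicalSpace G] [IsTopologicalGroup G] [LocallyCompactSpace G]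

/-- The modular function of `G`, in the convention `μ (E g) = Δ(g) μ(E)` for a left Haar measure
`μ`. (Mathlib's modular character is `g ↦ Δ(g⁻¹)`.) -/
def modularFun (g : G) : ℝ≥0 := modularCharacter g⁻¹

theorem modularFun_pos (g : G) : 0 < modularFun g := modularCharacterFun_pos _

variable [SecondCountableTopology G] [MeasurableSpace G] [BorelSpace G]
  (μ : Measure G) [μ.IsHaarMeasure]

theorem map_mul_right_haar (g : G) : μ.map (· * g) = (modularFun g)⁻¹ • μ := by
  have h1 : μ.map (· * g) = haarScalarFactor (μ.map (· * g)) μ • μ :=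
    isMulLeftInvariant_eq_smul _ _
  have h2 : (modularFun g)⁻¹ = haarScalarFactor (μ.map (· * g)) μ := by
    rw [← modularCharacterFun_eq_haarScalarFactor μ g]
    have h3 : modularFun g * modularCharacter g = 1 := by
      rw [modularFun, ← map_mul, inv_mul_cancel, map_one]
    exact (eq_inv_of_mul_eq_one_right h3).symm
  rw [h2]; exact h1

theorem measurable_modularFun : Measurable (modularFun : G → ℝ≥0) := by
  obtain ⟨K, hK, hK1⟩ := exists_compact_mem_nhds (1 : G)
  have hU : MeasurableSet (interior K) := isOpen_interior.measurableSet
  have h1 : haar (interior K) ≠ 0 := (isOpen_interior.measure_pos haar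
    ⟨1, mem_interior_iff_mem_nhds.2 hK1⟩).ne'
  have h2 : haar (interior K) ≠ ∞ := measure_ne_top_of_subset interior_subset hK.measure_ne_top
  have h3 : Measurable fun g : G => ∫⁻ x, (interior K).indicator 1 (x * g) ∂(haar : Measure G) := by
    refine Measurable.lintegral_prod_right' (f := fun p : G × G =>
      (interior K).indicator (1 : G → ℝ≥0∞) (p.2 * p.1)) ?_
    exact (measurable_one.indicator hU).comp (measurable_snd.mul measurable_fst)
  have h4 : ∀ g : G, modularFun g
      = (((∫⁻ x, (interior K).indicator 1 (x * g) ∂(haar : Measure G))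
          / haar (interior K)).toNNReal)⁻¹ := by
    intro g
    have h5 : ∫⁻ x, (interior K).indicator 1 (x * g) ∂(haar : Measure G)
        = ((modularFun g)⁻¹ : ℝ≥0) * haar (interior K) := by
      rw [← lintegral_map (f := (interior K).indicator 1) (g := (· * g))
        (measurable_one.indicator hU) (measurable_mul_const g), lintegral_indicator_one hU,
        map_mul_right_haar haar g]
      rfl
    rw [h5, mul_div_assoc, ENNReal.div_self h1 h2, mul_one, ENNReal.toNNReal_coe, inv_inv]
  rw [show (modularFun : G → ℝ≥0) = _ from funext h4]
  exact (h3.div_const _).ennreal_toNNReal.inv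

theorem quasiMeasurePreserving_mul_right_haar (g : G) :
    QuasiMeasurePreserving (· * g) μ μ := by
  refine ⟨measurable_mul_const g, ?_⟩
  rw [map_mul_right_haar μ g]
  exact smul_absolutelyContinuous

theorem eLpNorm_mul_right_haar (g : G) {ξ : G → ℂ} (hξ : AEStronglyMeasurable ξ μ) :
    eLpNorm (fun x => (((modularFun g : ℝ) ^ (1 / 2 : ℝ) : ℝ) : ℂ) * ξ (x * g)) 2 μ
      = eLpNorm ξ 2 μ := by
  have h0 : 0 < modularFun g := modularFun_pos g
  have h1 : eLpNorm (fun x => ξ (x * g)) 2 μ = eLpNorm ξ 2 (μ.map (· * g)) := by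
    rw [eLpNorm_map_measure _ (measurable_mul_const g).aemeasurable]
    · rfl
    · rw [map_mul_right_haar μ g]
      exact hξ.mono_ac smul_absolutelyContinuous
  have h2 : (fun x => (((modularFun g : ℝ) ^ (1 / 2 : ℝ) : ℝ) : ℂ) * ξ (x * g))
      = (((modularFun g : ℝ) ^ (1 / 2 : ℝ) : ℝ) : ℂ) • fun x => ξ (x * g) := rfl
  have h4 : ‖(((modularFun g : ℝ) ^ (1 / 2 : ℝ) : ℝ) : ℂ)‖ₑ
      = ((modularFun g ^ (1 / 2 : ℝ) : ℝ≥0) : ℝ≥0∞) := by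
    rw [enorm_eq_nnnorm]
    congr 1
    ext
    simp only [coe_nnnorm, Complex.norm_real, Real.norm_eq_abs, NNReal.coe_rpow]
    exact abs_of_nonneg (Real.rpow_nonneg (modularFun g).2 _)
  rw [h2, eLpNorm_const_smul, h1, map_mul_right_haar μ g]
  rw [show ((modularFun g)⁻¹ • μ) = (((modularFun g)⁻¹ : ℝ≥0) : ℝ≥0∞) • μ from rfl,
    eLpNorm_smul_measure_of_ne_top (by simp), h4, smul_eq_mul, ← mul_assoc]
  have h3 : ((modularFun g ^ (1 / 2 : ℝ) : ℝ≥0) : ℝ≥0∞)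
      * (((modularFun g)⁻¹ : ℝ≥0) : ℝ≥0∞) ^ (1 / (2 : ℝ≥0∞)).toReal = 1 := by
    rw [← ENNReal.coe_rpow_of_nonneg _ (by simp), ← ENNReal.coe_mul]
    rw [show (1 / (2 : ℝ≥0∞)).toReal = 1 / 2 by simp, ← NNReal.mul_rpow, mul_inv_cancel₀ h0.ne']
    simp
  rw [h3, one_mul]

theorem memLp_mul_right_haar (g : G) (ξ : Lp ℂ 2 μ) :
    MemLp (fun x => (((modularFun g : ℝ) ^ (1 / 2 : ℝ) : ℝ) : ℂ) * ξ (x * g)) 2 μ := by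
  refine ⟨?_, ?_⟩
  · exact ((Lp.aestronglyMeasurable ξ).comp_quasiMeasurePreserving
      (quasiMeasurePreserving_mul_right_haar μ g)).const_mul _
  · rw [eLpNorm_mul_right_haar μ g (Lp.aestronglyMeasurable ξ)]
    exact Lp.eLpNorm_lt_top ξ

/-- The right translation operator `(U_g ξ)(x) = Δ(g)^{1/2} ξ(x g)` on `L²(G)`. -/
def rightTranslation (g : G) : Lp ℂ 2 μ →ₗᵢ[ℂ] Lp ℂ 2 μ where
  toFun ξ := (memLp_mul_right_haar μ g ξ).toLp _
  map_add' ξ η := by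
    ext1
    filter_upwards [MemLp.coeFn_toLp (memLp_mul_right_haar μ g (ξ + η)),
      MemLp.coeFn_toLp (memLp_mul_right_haar μ g ξ), MemLp.coeFn_toLp (memLp_mul_right_haar μ g η),
      Lp.coeFn_add ((memLp_mul_right_haar μ g ξ).toLp _) ((memLp_mul_right_haar μ g η).toLp _),
      (quasiMeasurePreserving_mul_right_haar μ g).ae (Lp.coeFn_add ξ η)] with x h1 h2 h3 h4 h5
    rw [h1, h4, Pi.add_apply, h2, h3, h5, Pi.add_apply, mul_add]
  map_smul' c ξ := by
    ext1
    filter_upwards [MemLp.coeFn_toLp (memLp_mul_right_haar μ g (c • ξ)),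
      MemLp.coeFn_toLp (memLp_mul_right_haar μ g ξ),
      Lp.coeFn_smul c ((memLp_mul_right_haar μ g ξ).toLp _),
      (quasiMeasurePreserving_mul_right_haar μ g).ae (Lp.coeFn_smul c ξ)] with x h1 h2 h4 h5
    rw [h1, RingHom.id_apply, h4, Pi.smul_apply, h2, h5, Pi.smul_apply, smul_eq_mul, smul_eq_mul]
    ring
  norm_map' ξ := by
    change ‖(memLp_mul_right_haar μ g ξ).toLp _‖ = _
    rw [Lp.norm_toLp, eLpNorm_mul_right_haar μ g (Lp.aestronglyMeasurable ξ), Lp.norm_def]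

theorem rightTranslation_coeFn (g : G) (ξ : Lp ℂ 2 μ) :
    rightTranslation μ g ξ
      =ᵐ[μ] fun x => (((modularFun g : ℝ) ^ (1 / 2 : ℝ) : ℝ) : ℂ) * ξ (x * g) :=
  MemLp.coeFn_toLp (memLp_mul_right_haar μ g ξ)

/-- The compression `E U_g E` as an operator on `L²(P)`, where `E` is the orthogonal projection of
`L²(G)` onto `L²(P)`. -/
def compression (P : Submonoid G) (g : G) : L2Sub μ P →L[ℂ] L2Sub μ P :=
  restrictL2 μ P ∘L (rightTranslation μ g).toContinuousLinearMap ∘L extendL2 μ P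

theorem inner_compression (P : Submonoid G) (g : G) (η ξ : L2Sub μ P) :
    inner ℂ η (compression μ P g ξ)
      = inner ℂ (extendL2 μ P η) (rightTranslation μ g (extendL2 μ P ξ)) := by
  rw [extendL2, ContinuousLinearMap.adjoint_inner_left]
  rfl

theorem aestronglyMeasurable_inner_compression (P : Submonoid G) (η ξ : L2Sub μ P) :
    AEStronglyMeasurable (fun g => inner ℂ η (compression μ P g ξ)) μ := by
  have hm : Measurable fun g : G => ((((modularFun g : ℝ) ^ (1 / 2 : ℝ) : ℝ)) : ℂ) :=
    Complex.measurable_ofReal.comp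
      ((measurable_coe_nnreal_real.comp measurable_modularFun).pow_const _)
  have h1 : StronglyMeasurable fun p : G × G =>
      ((((modularFun p.1 : ℝ) ^ (1 / 2 : ℝ) : ℝ)) : ℂ) * (extendL2 μ P ξ) (p.2 * p.1) *
        starRingEnd ℂ ((extendL2 μ P η) p.2) := by
    apply Measurable.stronglyMeasurable
    have h2 : Measurable (extendL2 μ P ξ : G → ℂ) := (Lp.stronglyMeasurable _).measurable
    have h3 : Measurable (extendL2 μ P η : G → ℂ) := (Lp.stronglyMeasurable _).measurable
    exact ((hm.comp measurable_fst).mul (h2.comp (measurable_snd.mul measurable_fst))).mul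
      (Complex.continuous_conj.measurable.comp (h3.comp measurable_snd))
  have h4 := (h1.integral_prod_right' (ν := μ)).aestronglyMeasurable (μ := μ)
  refine h4.congr (.of_forall fun g => ?_)
  beta_reduce
  rw [inner_compression, L2.inner_def]
  refine integral_congr_ae ?_
  filter_upwards [rightTranslation_coeFn μ g (extendL2 μ P ξ)] with x hx
  rw [hx]
  simp

theorem norm_inner_compression_le (P : Submonoid G) (g : G) (η ξ : L2Sub μ P) :
    ‖inner ℂ η (compression μ P g ξ)‖ ≤ ‖η‖ * ‖ξ‖ := by
  rw [inner_compression]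
  refine (norm_inner_le_norm _ _).trans ?_
  rw [LinearIsometry.norm_map]
  exact mul_le_mul (norm_extendL2_le μ P η) (norm_extendL2_le μ P ξ) (norm_nonneg _)
    (norm_nonneg _)

theorem integrable_mul_inner_compression (P : Submonoid G) {f : G → ℂ} (hf : Integrable f μ)
    (η ξ : L2Sub μ P) : Integrable (fun g => f g * inner ℂ η (compression μ P g ξ)) μ :=
  hf.mul_bdd (aestronglyMeasurable_inner_compression μ P η ξ)
    (.of_forall fun g => norm_inner_compression_le μ P g η ξ)

/-- The bounded sesquilinear form `(η, ξ) ↦ ∫ f(g) ⟪η, E U_g E ξ⟫ dg` on `L²(P)`, for `f ∈ L¹(G)`. -/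
def wienerHopfForm (P : Submonoid G) (f : G → ℂ) (hf : Integrable f μ) :
    L2Sub μ P →L⋆[ℂ] L2Sub μ P →L[ℂ] ℂ :=
  LinearMap.mkContinuous₂
    (LinearMap.mk₂'ₛₗ (starRingEnd ℂ) (RingHom.id ℂ)
      (fun η ξ => ∫ g, f g * inner ℂ η (compression μ P g ξ) ∂μ)
      (fun η₁ η₂ ξ => by
        rw [← integral_add (integrable_mul_inner_compression μ P hf _ _)
          (integrable_mul_inner_compression μ P hf _ _)]
        simp only [inner_add_left, mul_add])
      (fun c η ξ => by
        rw [smul_eq_mul, ← integral_const_mul]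
        refine integral_congr_ae (.of_forall fun g => ?_)
        simp only [inner_smul_left]
        ring)
      (fun η ξ₁ ξ₂ => by
        rw [← integral_add (integrable_mul_inner_compression μ P hf _ _)
          (integrable_mul_inner_compression μ P hf _ _)]
        simp only [map_add, inner_add_right, mul_add])
      (fun c η ξ => by
        rw [RingHom.id_apply, smul_eq_mul, ← integral_const_mul]
        refine integral_congr_ae (.of_forall fun g => ?_)
        simp only [map_smul]
        rw [inner_smul_right]
        ring))
    (∫ g, ‖f g‖ ∂μ)
    (fun η ξ => by
      simp only [LinearMap.mk₂'ₛₗ_apply]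
      rw [mul_assoc, ← integral_mul_const]
      refine norm_integral_le_of_norm_le (hf.norm.mul_const _) (.of_forall fun g => ?_)
      rw [norm_mul]
      gcongr
      exact norm_inner_compression_le μ P g η ξ)

/-- The Wiener-Hopf operator `W_f = ∫ f(g) E U_g E dg` on `L²(P)` with symbol `f ∈ L¹(G)`. The
integral is taken in the weak sense, see `inner_wienerHopf`. -/
def wienerHopf (P : Submonoid G) (f : G → ℂ) (hf : Integrable f μ) :
    L2Sub μ P →L[ℂ] L2Sub μ P :=
  ContinuousLinearMap.adjoint
    (InnerProductSpace.continuousLinearMapOfBilin (wienerHopfForm μ P f hf))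

theorem inner_wienerHopf (P : Submonoid G) (f : G → ℂ) (hf : Integrable f μ) (η ξ : L2Sub μ P) :
    inner ℂ η (wienerHopf μ P f hf ξ) = ∫ g, f g * inner ℂ η (compression μ P g ξ) ∂μ := by
  rw [wienerHopf, ContinuousLinearMap.adjoint_inner_right,
    InnerProductSpace.continuousLinearMapOfBilin_apply]
  rfl

/-- The Wiener-Hopf algebra `𝓦(P)`: the C*-algebra of operators on `L²(P)` generated by the
Wiener-Hopf operators `W_f`, `f ∈ L¹(G)`. -/
def wienerHopfAlgebra (P : Submonoid G) :
    NonUnitalStarSubalgebra ℂ (L2Sub μ P →L[ℂ] L2Sub μ P) :=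
  (NonUnitalStarAlgebra.adjoin ℂ
    {T | ∃ (f : G → ℂ) (hf : Integrable f μ), T = wienerHopf μ P f hf}).topologicalClosure

end WienerHopf

/-! ## Groupoids and their reduced C*-algebras -/

noncomputable section Groupoids

universe v u

variable (C : Type u) [Groupoid.{v} C]

/-- The set of all arrows of a groupoid with unit space `C`. Arrows are read as in the
groupoid C*-algebra literature: an arrow `γ : x ⟶ y` has range `x` and source `y`, and the product
of `γ : x ⟶ y` and `η : y ⟶ z` is `γ ≫ η`. -/
structure Arrows where
  {rng : C}
  {src : C}
  hom : rng ⟶ src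

variable {C}

/-- The range fibre `𝒢ˣ = r⁻¹(x)`. -/
structure RangeFibre (x : C) where
  {src : C}
  hom : x ⟶ src

/-- The inclusion of `𝒢ˣ` into the groupoid. -/
def RangeFibre.toArrows {x : C} (γ : RangeFibre x) : Arrows C := ⟨γ.hom⟩

/-- The arrow `γ⁻¹ η`, for `γ` and `η` with the same range. -/
def RangeFibre.invMul {x : C} (γ η : RangeFibre x) : Arrows C := ⟨Groupoid.inv γ.hom ≫ η.hom⟩

/-- The C*-algebra `∏ᵢ B(Hᵢ)` of bounded families of operators on Hilbert spaces `Hᵢ`, with the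
supremum norm. (This is Mathlib's `lp _ ∞`, sealed to keep instance search fast.) -/
def OperatorFamilies {ι : Type*} (H : ι → Type*) [∀ i, NormedAddCommGroup (H i)]
    [∀ i, InnerProductSpace ℂ (H i)] [∀ i, CompleteSpace (H i)] : Type _ :=
  lp (fun i => H i →L[ℂ] H i) ∞

instance {ι : Type*} (H : ι → Type*) [∀ i, NormedAddCommGroup (H i)]
    [∀ i, InnerProductSpace ℂ (H i)] [∀ i, CompleteSpace (H i)] :
    NonUnitalCStarAlgebra (OperatorFamilies H) :=
  inferInstanceAs (NonUnitalCStarAlgebra (lp (fun i => H i →L[ℂ] H i) ∞))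

/-- The `i`-th member of a bounded family of operators. -/
def OperatorFamilies.coord {ι : Type*} {H : ι → Type*} [∀ i, NormedAddCommGroup (H i)]
    [∀ i, InnerProductSpace ℂ (H i)] [∀ i, CompleteSpace (H i)] (T : OperatorFamilies H) (i : ι) :
    H i →L[ℂ] H i :=
  (show lp (fun i => H i →L[ℂ] H i) ∞ from T) i

variable [TopologicalSpace (Arrows C)]

instance (x : C) : TopologicalSpace (RangeFibre x) :=
  TopologicalSpace.induced RangeFibre.toArrows inferInstance

instance (x : C) : MeasurableSpace (RangeFibre x) := borel _

instance (x : C) : BorelSpace (RangeFibre x) := ⟨rfl⟩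

variable (haarSys : ∀ x : C, Measure (RangeFibre x))

/-- The Hilbert space `L²(𝒢ˣ, λˣ)`. (This is Mathlib's `L²` space with its Hilbert space structure;
the name only seals it, since instance search is too slow on products of such spaces.) -/
def FibreL2 (x : C) : Type _ := Lp ℂ 2 (haarSys x)

instance (x : C) : NormedAddCommGroup (FibreL2 haarSys x) :=
  inferInstanceAs (NormedAddCommGroup (Lp ℂ 2 (haarSys x)))

instance (x : C) : InnerProductSpace ℂ (FibreL2 haarSys x) :=
  inferInstanceAs (InnerProductSpace ℂ (Lp ℂ 2 (haarSys x)))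

instance (x : C) : CompleteSpace (FibreL2 haarSys x) :=
  inferInstanceAs (CompleteSpace (Lp ℂ 2 (haarSys x)))

variable {haarSys} in
/-- The function (defined almost everywhere) underlying an element of `L²(𝒢ˣ, λˣ)`. -/
def FibreL2.fn {x : C} (ξ : FibreL2 haarSys x) : RangeFibre x → ℂ :=
  ((show Lp ℂ 2 (haarSys x) from ξ : Lp ℂ 2 (haarSys x)) : RangeFibre x → ℂ)

/-- `T` is the family `(Ind δₓ (f))ₓ` of the regular representations of `f ∈ C_c(𝒢)`:
`(Ind δₓ (f) ξ)(γ) = ∫ f(γ⁻¹ η) ξ(η) dλˣ(η)` for `ξ ∈ L²(𝒢ˣ, λˣ)`. For a Haar system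
there is exactly one such `T` for every `f`. -/
def IsRegularRep (f : C_c(Arrows C, ℂ)) (T : OperatorFamilies (FibreL2 haarSys)) : Prop :=
  ∀ (x : C) (ξ : FibreL2 haarSys x),
    (T.coord x ξ).fn =ᵐ[haarSys x] fun γ => ∫ η, f (γ.invMul η) * ξ.fn η ∂haarSys x

/-- The reduced C*-algebra of a topological groupoid with respect to a left Haar system `λ`: the
completion of `C_c(𝒢)` for the norm `‖f‖ = supₓ ‖Ind δₓ (f)‖`, that is, the closure of (the
*-algebra generated by) the image of `C_c(𝒢)` in `∏ₓ B(L²(𝒢ˣ, λˣ))`. -/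
def reducedCStarAlgebra : NonUnitalStarSubalgebra ℂ (OperatorFamilies (FibreL2 haarSys)) :=
  (NonUnitalStarAlgebra.adjoin ℂ
    {T | ∃ f : C_c(Arrows C, ℂ), IsRegularRep haarSys f T}).topologicalClosure

end Groupoids

/-! ## The semidirect product groupoid -/

noncomputable section Semidirect

variable {G : Type*} [Group G] {X : Type*} (P : Submonoid G) [MulAction Pᵐᵒᵖ X]

/-- For a right action of `P` on `X`: `g` can be written as `a b⁻¹` with `a, b ∈ P` and
`x a = y b`. -/
def IsArrow (x : X) (g : G) (y : X) : Prop :=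
  ∃ a b : P, g = (a : G) * (b : G)⁻¹ ∧ x <• a = y <• b

/-- `Q_x`, the set of all `g = a b⁻¹` with `a, b ∈ P` and `x a ∈ X b`. -/
def fractionSet (x : X) : Set G := {g | ∃ y : X, IsArrow P x g y}

variable (X) in
/-- The unit space `X` of the semidirect product groupoid `X ⋊ P`. -/
def UnitSpace (_P : Submonoid G) : Type _ := X

theorem IsArrow.one (x : X) : IsArrow P x 1 x := ⟨1, 1, by simp, rfl⟩

variable {P} in
theorem IsArrow.inv {x y : X} {g : G} (hg : IsArrow P x g y) : IsArrow P y g⁻¹ x := by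
  obtain ⟨a, b, rfl, h⟩ := hg
  exact ⟨b, a, by group, h.symm⟩

variable {P} in
theorem IsArrow.mul [TopologicalSpace G] [IsContinuousOre P] {x y z : X} {g h : G}
    (hg : IsArrow P x g y) (hh : IsArrow P y h z) : IsArrow P x (g * h) z := by
  obtain ⟨a, b, rfl, h1⟩ := hg
  obtain ⟨c, d, rfl, h2⟩ := hh
  obtain ⟨α, β, h3⟩ := IsContinuousOre.exists_eq_mul_inv (P := P) ((b : G)⁻¹ * c)
  have h4 : b * α = c * β := by
    ext
    rw [Submonoid.coe_mul, Submonoid.coe_mul]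
    rw [inv_mul_eq_iff_eq_mul, ← mul_assoc, eq_mul_inv_iff_mul_eq] at h3
    exact h3.symm
  refine ⟨a * α, d * β, ?_, ?_⟩
  · have h5 : (α : G) = (b : G)⁻¹ * c * β := by rw [h3]; group
    rw [Submonoid.coe_mul, Submonoid.coe_mul, h5]
    group
  · rw [MulOpposite.op_mul, MulOpposite.op_mul, mul_smul, mul_smul, h1, ← h2, ← mul_smul,
      ← mul_smul, ← MulOpposite.op_mul, ← MulOpposite.op_mul, h4]

/-- The groupoid `X ⋊ P`. Its arrows with range `x` and source `y` are the pairs `(x, g)` such that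
`g = a b⁻¹` with `a, b ∈ P` and `x a = y b`; the product is `(x, g)(y, h) = (x, g h)` and the
inverse of `(x, g)` is `(y, g⁻¹)`. (If the action is injective, `y` is determined by `(x, g)`.) -/
instance semidirectGroupoid [TopologicalSpace G] [IsContinuousOre P] :
    Groupoid (UnitSpace X P) where
  Hom x y := {g : G // IsArrow P (X := X) x g y}
  id x := ⟨1, IsArrow.one (X := X) P x⟩
  comp g h := ⟨g.1 * h.1, IsArrow.mul (X := X) g.2 h.2⟩
  id_comp _ := Subtype.ext (one_mul _)
  comp_id _ := Subtype.ext (mul_one _)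
  assoc _ _ _ := Subtype.ext (mul_assoc _ _ _)
  inv g := ⟨g.1⁻¹, IsArrow.inv (X := X) g.2⟩
  inv_comp _ := Subtype.ext (inv_mul_cancel _)
  comp_inv _ := Subtype.ext (mul_inv_cancel _)

variable [TopologicalSpace G] [IsContinuousOre P] [TopologicalSpace X]

/-- The arrow `γ = (x, g)` as an element of `X × G`. -/
def Arrows.toProd (γ : Arrows (UnitSpace X P)) : X × G := (γ.rng, γ.hom.1)

/-- `X ⋊ P` carries the subspace topology of `X × G`. -/
instance semidirectTopology : TopologicalSpace (Arrows (UnitSpace X P)) :=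
  TopologicalSpace.induced (Arrows.toProd P) inferInstance

/-- The Haar system `(λˣ)ₓ` of `X ⋊ P`: the measure `λˣ` is the left Haar measure of `G` on
`𝒢ˣ = {x} × Q_x`. -/
def semidirectHaar [MeasurableSpace G] (μ : Measure G) (x : UnitSpace X P) :
    Measure (RangeFibre x) :=
  μ.comap fun γ => γ.hom.1

end Semidirect

/-!
The isomorphism is the regular representation of `X ⋊ P` over the point `x₀`. By (A1) the fibre over
`x₀` is `{x₀} × P`, so this representation acts on `L²(P)`; write `π` for it (`orbitRep`).

*`π` is isometric on `C*_red(X ⋊ P)`.* Extended by zero to `L²(G)`, the representation `Ind δₓ (F)`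
is the integral operator with kernel `F(s(x, g), g⁻¹ h)` on `Q_x × Q_x`. For almost every `g`,
whether `g ∈ Q_x` is locally constant in `x`: by a Steinhaus argument `Q_x` differs by a null set
from the open set `Q_x · Int P` (`ae_eventually_mem_fractionSet_iff`). As the kernels are dominated
by a Schur kernel that does not depend on `x`, the operators depend strongly continuously on `x`;
for `x = x₀ a` they are translates of the one at `x₀`. By (A2) the norm at `x₀` is therefore the
largest one (`norm_le_norm_coord_of_mem_reducedCStarAlgebra`). Strong continuity passes to the
*-algebra generated by `C_c(X ⋊ P)`.

*The image lies in `𝓦(P)`.* Substituting `h = g k` in the integral operator gives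
`π(F) = ∫ Δ(k)^{-1/2} M(F(·, k)) E U_k E dk`, where `M(φ)` is multiplication by `g ↦ φ(x₀ g)` on
`L²(P)` (`inner_orbitRep_of_isRegularRep`). So it suffices that `M(φ) 𝓦(P) ⊆ 𝓦(P)` for `φ ∈ C(X)`.
For `f ∈ L¹(G)` the function `φ_f(x) = ∫_{Q_x} f dμ` is continuous, and `M(φ_f)` is the average with
weight `f(h)` of the projections `E U_h E U_h* E`, which makes `M(φ_f) W_k` an average of the
operators `E U_h E W_{k(h ·)}` and hence an element of `𝓦(P)`
(`multOp_mul_mem_wienerHopfAlgebra`). By (A3) the functions `φ_f` separate the points of `X`, and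
the Stone-Weierstrass theorem gives all of `C(X)` (`multOp_mul_mem`). The averages are weak
integrals, since `k ↦ E U_k E` is only strongly continuous; `exists_mem_inner_eq_integral` puts them
into a closed subspace.

*The image is `𝓦(P)`.* For `F(x, g) = Δ(g)^{1/2} c(g)` with `c ∈ C_c(G)` the formula for `π(F)`
reads `π(F) = W_c`, and `C_c(G)` is dense in `L¹(G)`. The image of an isometric
representation is closed.
-/

/-! ### Integral operators with a Schur bound -/

section Schur

variable {α : Type*} [MeasurableSpace α] {μ : Measure α}

/-- A non-negative kernel `k` on `α × α` whose rows and columns have integral at most `C`. By the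
Schur test, such a kernel dominates bounded integral operators on `L²`. -/
structure IsSchurKernel (μ : Measure α) (k : α → α → ℝ≥0∞) (C : ℝ≥0) : Prop where
  measurable : Measurable (Function.uncurry k)
  lintegral_right_le : ∀ x, ∫⁻ y, k x y ∂μ ≤ C
  lintegral_left_le : ∀ y, ∫⁻ x, k x y ∂μ ≤ C

/-- The operator `T` on `L²` is given by the integral kernel `K`. -/
def HasKernel (μ : Measure α) (K : α → α → ℂ) (T : Lp ℂ 2 μ →L[ℂ] Lp ℂ 2 μ) : Prop :=
  ∀ ξ : Lp ℂ 2 μ, T ξ =ᵐ[μ] fun x => ∫ y, K x y * ξ y ∂μ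

theorem IsSchurKernel.swap {k : α → α → ℝ≥0∞} {C : ℝ≥0} (hk : IsSchurKernel μ k C) :
    IsSchurKernel μ (fun x y => k y x) C :=
  ⟨hk.measurable.comp measurable_swap, hk.lintegral_left_le, hk.lintegral_right_le⟩

theorem IsSchurKernel.lintegral_sq_le [SFinite μ] {k : α → α → ℝ≥0∞} {C : ℝ≥0}
    (hk : IsSchurKernel μ k C) {u : α → ℝ≥0∞} (hu : AEMeasurable u μ) :
    ∫⁻ x, (∫⁻ y, k x y * u y ∂μ) ^ 2 ∂μ ≤ C ^ 2 * ∫⁻ y, u y ^ 2 ∂μ := by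
  have hkx : ∀ x, Measurable fun y => k x y := fun x => hk.measurable.comp measurable_prodMk_left
  have hky : ∀ y, Measurable fun x => k x y := fun x => hk.measurable.comp measurable_prodMk_right
  have h1 : ∀ x, (∫⁻ y, k x y * u y ∂μ) ^ 2 ≤ C * ∫⁻ y, k x y * u y ^ 2 ∂μ := by
    intro x
    -- Cauchy-Schwarz for the factorization `k u = k^{1/2} (k^{1/2} u)`
    have h2 := ENNReal.lintegral_mul_le_Lp_mul_Lq μ (p := 2) (q := 2)
      (Real.HolderConjugate.two_two) (f := fun y => k x y ^ (1 / 2 : ℝ))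
      (g := fun y => k x y ^ (1 / 2 : ℝ) * u y)
      ((hkx x).pow_const _).aemeasurable (((hkx x).pow_const _).aemeasurable.mul hu)
    have h3 : ∀ a : ℝ≥0∞, a ^ (1 / 2 : ℝ) * a ^ (1 / 2 : ℝ) = a := fun a => by
      rw [← ENNReal.rpow_add_of_nonneg _ _ (by norm_num) (by norm_num)]
      norm_num
    have h4 : ∀ a : ℝ≥0∞, (a ^ (1 / 2 : ℝ)) ^ 2 = a := fun a => by rw [sq, h3]
    simp only [Pi.mul_apply, ← mul_assoc, h3, ENNReal.rpow_two, mul_pow, h4] at h2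
    calc _ ≤ _ := pow_le_pow_left' h2 2
      _ = (∫⁻ y, k x y ∂μ) * ∫⁻ y, k x y * u y ^ 2 ∂μ := by rw [mul_pow, h4, h4]
      _ ≤ _ := by gcongr; exact hk.lintegral_right_le x
  calc _ ≤ ∫⁻ x, C * ∫⁻ y, k x y * u y ^ 2 ∂μ ∂μ := lintegral_mono h1
    _ = C * ∫⁻ x, ∫⁻ y, k x y * u y ^ 2 ∂μ ∂μ := lintegral_const_mul' _ _ ENNReal.coe_ne_top
    _ = C * ∫⁻ y, ∫⁻ x, k x y * u y ^ 2 ∂μ ∂μ := by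
        rw [lintegral_lintegral_swap]
        exact hk.measurable.aemeasurable.mul ((hu.pow_const 2).comp_snd)
    _ = C * ∫⁻ y, (∫⁻ x, k x y ∂μ) * u y ^ 2 ∂μ := by
        congr 1
        exact lintegral_congr fun y => lintegral_mul_const _ (hky y)
    _ ≤ C * ∫⁻ y, C * u y ^ 2 ∂μ := by gcongr with y; exact hk.lintegral_left_le y
    _ = _ := by rw [lintegral_const_mul' _ _ ENNReal.coe_ne_top, ← mul_assoc, sq]

theorem lintegral_enorm_sq_lt_top (ξ : Lp ℂ 2 μ) : ∫⁻ x, ‖ξ x‖ₑ ^ 2 ∂μ < ∞ := by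
  have h := lintegral_rpow_enorm_lt_top_of_eLpNorm_lt_top (p := 2) (by simp) (by simp)
    (Lp.eLpNorm_lt_top ξ)
  simpa using h

theorem eLpNorm_two_eq (f : α → ℂ) : eLpNorm f 2 μ = (∫⁻ x, ‖f x‖ₑ ^ 2 ∂μ) ^ (1 / 2 : ℝ) := by
  rw [eLpNorm_eq_lintegral_rpow_enorm_toReal (by simp) (by simp)]
  simp

theorem norm_Lp_two_sq (ξ : Lp ℂ 2 μ) : ENNReal.ofReal (‖ξ‖ ^ 2) = ∫⁻ x, ‖ξ x‖ₑ ^ 2 ∂μ := by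
  have h : ENNReal.ofReal ‖ξ‖ = (∫⁻ x, ‖ξ x‖ₑ ^ 2 ∂μ) ^ (1 / 2 : ℝ) := by
    rw [← eLpNorm_two_eq, Lp.norm_def, ENNReal.ofReal_toReal (Lp.eLpNorm_ne_top ξ)]
  rw [ENNReal.ofReal_pow (norm_nonneg _), h, ← ENNReal.rpow_two, ← ENNReal.rpow_mul]
  norm_num

theorem IsSchurKernel.ae_lt_top [SFinite μ] {k : α → α → ℝ≥0∞} {C : ℝ≥0}
    (hk : IsSchurKernel μ k C) (ξ : Lp ℂ 2 μ) : ∀ᵐ x ∂μ, ∫⁻ y, k x y * ‖ξ y‖ₑ ∂μ < ∞ := by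
  have hm : Measurable fun y => ‖ξ y‖ₑ := (Lp.stronglyMeasurable ξ).measurable.enorm
  have h1 := (hk.lintegral_sq_le hm.aemeasurable).trans_lt
    (ENNReal.mul_lt_top (by simp) (lintegral_enorm_sq_lt_top ξ))
  have h2 : Measurable fun x => (∫⁻ y, k x y * ‖ξ y‖ₑ ∂μ) ^ 2 :=
    (Measurable.lintegral_prod_right' (f := fun p : α × α => k p.1 p.2 * ‖ξ p.2‖ₑ)
      (hk.measurable.mul (hm.comp measurable_snd))).pow_const 2
  filter_upwards [MeasureTheory.ae_lt_top h2 h1.ne] with x hx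
  exact (ENNReal.pow_lt_top_iff.1 hx).resolve_right (by norm_num)

variable {K : α → α → ℂ} {k : α → α → ℝ≥0∞} {C : ℝ≥0}

theorem ae_integrable_kernel_mul [SFinite μ] (hK : Measurable (Function.uncurry K))
    (hk : IsSchurKernel μ k C) (hKk : ∀ x y, ‖K x y‖ₑ ≤ k x y) (ξ : Lp ℂ 2 μ) :
    ∀ᵐ x ∂μ, Integrable (fun y => K x y * ξ y) μ := by
  filter_upwards [hk.ae_lt_top ξ] with x hx
  refine ⟨?_, ?_⟩
  · exact ((hK.comp measurable_prodMk_left).mul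
      (Lp.stronglyMeasurable ξ).measurable).aestronglyMeasurable
  · refine lt_of_le_of_lt (lintegral_mono fun y => ?_) hx
    rw [enorm_mul]
    gcongr
    exact hKk x y

theorem eLpNorm_kernel_mul_le [SFinite μ] (hk : IsSchurKernel μ k C)
    (hKk : ∀ x y, ‖K x y‖ₑ ≤ k x y) (ξ : Lp ℂ 2 μ) :
    eLpNorm (fun x => ∫ y, K x y * ξ y ∂μ) 2 μ ≤ C * eLpNorm ξ 2 μ := by
  have h1 : ∫⁻ x, ‖∫ y, K x y * ξ y ∂μ‖ₑ ^ 2 ∂μ ≤ C ^ 2 * ∫⁻ y, ‖ξ y‖ₑ ^ 2 ∂μ := by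
    refine le_trans (lintegral_mono fun x => ?_)
      (hk.lintegral_sq_le (Lp.stronglyMeasurable ξ).measurable.enorm.aemeasurable)
    refine pow_le_pow_left' ((enorm_integral_le_lintegral_enorm _).trans
      (lintegral_mono fun y => ?_)) 2
    rw [enorm_mul]
    gcongr
    exact hKk x y
  rw [eLpNorm_two_eq, eLpNorm_two_eq]
  refine (ENNReal.rpow_le_rpow h1 (by norm_num)).trans_eq ?_
  rw [ENNReal.mul_rpow_of_nonneg _ _ (by norm_num), ← ENNReal.rpow_two, ← ENNReal.rpow_mul]
  norm_num

/-- The Schur test. -/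
theorem exists_hasKernel [SFinite μ] (hK : Measurable (Function.uncurry K))
    (hk : IsSchurKernel μ k C) (hKk : ∀ x y, ‖K x y‖ₑ ≤ k x y) :
    ∃ T : Lp ℂ 2 μ →L[ℂ] Lp ℂ 2 μ, ‖T‖ ≤ C ∧ HasKernel μ K T := by
  have hm : ∀ ξ : Lp ℂ 2 μ, MemLp (fun x => ∫ y, K x y * ξ y ∂μ) 2 μ := fun ξ => by
    refine ⟨?_, (eLpNorm_kernel_mul_le hk hKk ξ).trans_lt
      (ENNReal.mul_lt_top (by simp) (Lp.eLpNorm_lt_top ξ))⟩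
    exact (StronglyMeasurable.integral_prod_right' (f := fun p : α × α => K p.1 p.2 * ξ p.2)
      (hK.mul ((Lp.stronglyMeasurable ξ).measurable.comp
        measurable_snd)).stronglyMeasurable).aestronglyMeasurable
  let T₀ : Lp ℂ 2 μ →ₗ[ℂ] Lp ℂ 2 μ :=
    { toFun := fun ξ => (hm ξ).toLp _
      map_add' := fun ξ η => by
        ext1
        filter_upwards [(hm (ξ + η)).coeFn_toLp, (hm ξ).coeFn_toLp, (hm η).coeFn_toLp,
          Lp.coeFn_add ((hm ξ).toLp _) ((hm η).toLp _), ae_integrable_kernel_mul hK hk hKk ξ,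
          ae_integrable_kernel_mul hK hk hKk η] with x h1 h2 h3 h4 h5 h6
        rw [h1, h4, Pi.add_apply, h2, h3, ← integral_add h5 h6]
        refine integral_congr_ae ?_
        filter_upwards [Lp.coeFn_add ξ η] with y hy
        rw [hy, Pi.add_apply, mul_add]
      map_smul' := fun c ξ => by
        ext1
        filter_upwards [(hm (c • ξ)).coeFn_toLp, (hm ξ).coeFn_toLp,
          Lp.coeFn_smul c ((hm ξ).toLp _)] with x h1 h2 h3
        rw [h1, RingHom.id_apply, h3, Pi.smul_apply, h2, smul_eq_mul, ← integral_const_mul]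
        refine integral_congr_ae ?_
        filter_upwards [Lp.coeFn_smul c ξ] with y hy
        rw [hy, Pi.smul_apply, smul_eq_mul]
        ring }
  refine ⟨T₀.mkContinuous C fun ξ => ?_, LinearMap.mkContinuous_norm_le _ C.2 _,
    fun ξ => (hm ξ).coeFn_toLp⟩
  change ‖(hm ξ).toLp _‖ ≤ _
  rw [Lp.norm_toLp, Lp.norm_def, ← ENNReal.coe_toReal, ← ENNReal.toReal_mul]
  exact ENNReal.toReal_mono (ENNReal.mul_ne_top (by simp) (Lp.eLpNorm_ne_top ξ))
    (eLpNorm_kernel_mul_le hk hKk ξ)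

theorem integrable_sesq_kernel [SFinite μ] (hK : Measurable (Function.uncurry K))
    (hk : IsSchurKernel μ k C) (hKk : ∀ x y, ‖K x y‖ₑ ≤ k x y) (η ξ : Lp ℂ 2 μ) :
    Integrable (fun p : α × α => starRingEnd ℂ (η p.1) * (K p.1 p.2 * ξ p.2)) (μ.prod μ) := by
  have hη := (Lp.stronglyMeasurable η).measurable
  have hξ := (Lp.stronglyMeasurable ξ).measurable
  have hm : Measurable fun p : α × α => starRingEnd ℂ (η p.1) * (K p.1 p.2 * ξ p.2) :=
    (Complex.continuous_conj.measurable.comp (hη.comp measurable_fst)).mul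
      (hK.mul (hξ.comp measurable_snd))
  refine ⟨hm.aestronglyMeasurable, ?_⟩
  have h0 : ∫⁻ x, ‖η x‖ₑ * ∫⁻ y, k x y * ‖ξ y‖ₑ ∂μ ∂μ < ∞ := by
    have h2 := ENNReal.lintegral_mul_le_Lp_mul_Lq μ (p := 2) (q := 2)
      (Real.HolderConjugate.two_two) (f := fun x => ‖η x‖ₑ)
      (g := fun x => ∫⁻ y, k x y * ‖ξ y‖ₑ ∂μ) hη.enorm.aemeasurable
      (Measurable.lintegral_prod_right' (f := fun p : α × α => k p.1 p.2 * ‖ξ p.2‖ₑ)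
        (hk.measurable.mul (hξ.enorm.comp measurable_snd))).aemeasurable
    simp only [Pi.mul_apply, ENNReal.rpow_two] at h2
    refine h2.trans_lt (ENNReal.mul_lt_top ?_ ?_)
    · exact ENNReal.rpow_lt_top_of_nonneg (by norm_num) (lintegral_enorm_sq_lt_top η).ne
    · refine ENNReal.rpow_lt_top_of_nonneg (by norm_num) ?_
      exact ((hk.lintegral_sq_le hξ.enorm.aemeasurable).trans_lt
        (ENNReal.mul_lt_top (by simp) (lintegral_enorm_sq_lt_top ξ))).ne
  refine lt_of_le_of_lt ?_ h0
  rw [lintegral_prod _ hm.enorm.aemeasurable]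
  refine lintegral_mono fun x => ?_
  rw [← lintegral_const_mul' _ _ enorm_ne_top]
  refine lintegral_mono fun y => ?_
  simp only [enorm_mul, RCLike.enorm_conj]
  gcongr
  exact hKk x y

theorem HasKernel.inner_eq {T : Lp ℂ 2 μ →L[ℂ] Lp ℂ 2 μ} (hT : HasKernel μ K T)
    (η ξ : Lp ℂ 2 μ) :
    inner ℂ η (T ξ) = ∫ x, ∫ y, starRingEnd ℂ (η x) * (K x y * ξ y) ∂μ ∂μ := by
  rw [L2.inner_def]
  refine integral_congr_ae ?_
  filter_upwards [hT ξ] with x hx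
  rw [hx, integral_const_mul, RCLike.inner_apply, mul_comm]

theorem HasKernel.adjoint [SFinite μ] {T : Lp ℂ 2 μ →L[ℂ] Lp ℂ 2 μ} (hT : HasKernel μ K T)
    (hK : Measurable (Function.uncurry K)) (hk : IsSchurKernel μ k C)
    (hKk : ∀ x y, ‖K x y‖ₑ ≤ k x y) :
    HasKernel μ (fun x y => starRingEnd ℂ (K y x)) (ContinuousLinearMap.adjoint T) := by
  have hK' : Measurable (Function.uncurry fun x y => starRingEnd ℂ (K y x)) :=
    Complex.continuous_conj.measurable.comp (hK.comp measurable_swap)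
  have hKk' : ∀ x y, ‖starRingEnd ℂ (K y x)‖ₑ ≤ k y x := fun x y => by
    rw [RCLike.enorm_conj]; exact hKk y x
  obtain ⟨S, -, hS⟩ := exists_hasKernel hK' hk.swap hKk'
  have h1 : S = ContinuousLinearMap.adjoint T := by
    refine (ContinuousLinearMap.eq_adjoint_iff _ _).2 fun η ξ => ?_
    rw [← inner_conj_symm, hS.inner_eq ξ η, hT.inner_eq η ξ,
      integral_integral_swap (integrable_sesq_kernel hK' hk.swap hKk' ξ η), ← integral_conj]
    refine integral_congr_ae (.of_forall fun x => ?_)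
    beta_reduce
    rw [← integral_conj]
    refine integral_congr_ae (.of_forall fun y => ?_)
    simp only [map_mul, Complex.conj_conj]
    ring
  rwa [← h1]

/-- Operators with uniformly dominated kernels depend strongly continuously on a parameter if their
kernels depend pointwise almost everywhere continuously on it. -/
theorem continuousAt_of_hasKernel [SFinite μ] {X : Type*} [TopologicalSpace X]
    [FirstCountableTopology X] {K : X → α → α → ℂ} (hK : ∀ x, Measurable (Function.uncurry (K x)))
    (hk : IsSchurKernel μ k C) (hKk : ∀ x g h, ‖K x g h‖ₑ ≤ k g h)
    {T : X → Lp ℂ 2 μ →L[ℂ] Lp ℂ 2 μ} (hT : ∀ x, HasKernel μ (K x) (T x)) {x₀ : X}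
    (hx₀ : ∀ᵐ g ∂μ, ∀ᵐ h ∂μ, ContinuousAt (fun x => K x g h) x₀) (ξ : Lp ℂ 2 μ) :
    ContinuousAt (fun x => T x ξ) x₀ := by
  have hξ := (Lp.stronglyMeasurable ξ).measurable
  set B : α → ℝ≥0∞ := fun g => ∫⁻ h, k g h * ‖ξ h‖ₑ ∂μ with hB
  have hle : ∀ x g, ‖∫ h, K x g h * ξ h ∂μ‖ₑ ≤ B g := fun x g => by
    refine (enorm_integral_le_lintegral_enorm _).trans (lintegral_mono fun h => ?_)
    rw [enorm_mul]
    gcongr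
    exact hKk x g h
  have hBfin : ∫⁻ g, (2 * B g) ^ 2 ∂μ ≠ ∞ := by
    simp only [mul_pow]
    rw [lintegral_const_mul' _ _ (by simp)]
    exact ENNReal.mul_ne_top (by simp) ((hk.lintegral_sq_le hξ.enorm.aemeasurable).trans_lt
        (ENNReal.mul_lt_top (by simp) (lintegral_enorm_sq_lt_top ξ))).ne
  have hsm : ∀ x, Measurable fun g => ∫ h, K x g h * ξ h ∂μ := fun x =>
    (StronglyMeasurable.integral_prod_right' (f := fun p : α × α => K x p.1 p.2 * ξ p.2)
      ((hK x).mul (hξ.comp measurable_snd)).stronglyMeasurable).measurable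
  have h1 : Filter.Tendsto
      (fun x => ∫⁻ g, ‖(∫ h, K x g h * ξ h ∂μ) - ∫ h, K x₀ g h * ξ h ∂μ‖ₑ ^ 2 ∂μ)
      (nhds x₀) (nhds (∫⁻ _, 0 ∂μ)) := by
    refine tendsto_lintegral_filter_of_dominated_convergence (fun g => (2 * B g) ^ 2)
      (.of_forall fun x => ((hsm x).sub (hsm x₀)).enorm.pow_const 2)
      (.of_forall fun x => .of_forall fun g => ?_) hBfin ?_
    · refine pow_le_pow_left' ((enorm_sub_le).trans ?_) 2
      rw [two_mul]
      exact add_le_add (hle x g) (hle x₀ g)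
    · filter_upwards [hx₀, hk.ae_lt_top ξ] with g hg hg'
      have h2 : Filter.Tendsto (fun x => ∫ h, K x g h * ξ h ∂μ) (nhds x₀)
          (nhds (∫ h, K x₀ g h * ξ h ∂μ)) := by
        refine tendsto_integral_filter_of_dominated_convergence
          (fun h => (k g h * ‖ξ h‖ₑ).toReal) (.of_forall fun x => ?_) (.of_forall fun x => ?_) ?_ ?_
        · exact (((hK x).comp measurable_prodMk_left).mul hξ).aestronglyMeasurable
        · have hm : Measurable fun h => k g h * ‖ξ h‖ₑ :=
            (hk.measurable.comp measurable_prodMk_left).mul hξ.enorm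
          filter_upwards [ae_lt_top hm hg'.ne] with h hh
          rw [← toReal_enorm]
          refine ENNReal.toReal_mono hh.ne ?_
          rw [enorm_mul]
          gcongr
          exact hKk x g h
        · exact integrable_toReal_of_lintegral_ne_top
            ((hk.measurable.comp measurable_prodMk_left).mul hξ.enorm).aemeasurable hg'.ne
        · filter_upwards [hg] with h hh
          exact hh.mul continuousAt_const
      have h3 := (ENNReal.continuous_pow 2).continuousAt.tendsto.comp
        (h2.sub_const (∫ h, K x₀ g h * ξ h ∂μ)).enorm
      simpa [Function.comp_def] using h3
  rw [ContinuousAt, tendsto_iff_norm_sub_tendsto_zero]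
  have h4 : ∀ x, ENNReal.ofReal (‖T x ξ - T x₀ ξ‖ ^ 2)
      = ∫⁻ g, ‖(∫ h, K x g h * ξ h ∂μ) - ∫ h, K x₀ g h * ξ h ∂μ‖ₑ ^ 2 ∂μ := fun x => by
    rw [norm_Lp_two_sq]
    refine lintegral_congr_ae ?_
    filter_upwards [Lp.coeFn_sub (T x ξ) (T x₀ ξ), hT x ξ, hT x₀ ξ] with g h5 h6 h7
    rw [h5, Pi.sub_apply, h6, h7]
  simp only [← h4, lintegral_zero] at h1
  have h5 := (ENNReal.tendsto_toReal ENNReal.zero_ne_top).comp h1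
  have h6 : Filter.Tendsto (fun x => ‖T x ξ - T x₀ ξ‖ ^ 2) (nhds x₀) (nhds 0) := by
    refine h5.congr fun x => ?_
    simp
  have h7 := h6.sqrt
  simpa using h7

end Schur

/-! ### Weak integrals of operators -/

section WeakIntegral

variable {H : Type*} [NormedAddCommGroup H] [InnerProductSpace ℂ H]

theorem opNorm_le_of_norm_inner_le {T : H →L[ℂ] H} {M : ℝ} (hM : 0 ≤ M)
    (h : ∀ η ξ, ‖inner ℂ η (T ξ)‖ ≤ M * ‖η‖ * ‖ξ‖) : ‖T‖ ≤ M := by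
  refine ContinuousLinearMap.opNorm_le_bound _ hM fun ξ => ?_
  have h1 := h (T ξ) ξ
  rw [inner_self_eq_norm_sq_to_K, norm_pow, RCLike.norm_ofReal, abs_norm] at h1
  by_contra! h2
  nlinarith [norm_nonneg (T ξ), mul_nonneg hM (norm_nonneg ξ)]

variable {β : Type*} {E : Type*} [NormedAddCommGroup E] [NormedSpace ℂ E]

theorem norm_inner_apply_le {Θ : β → E →L[ℂ] (H →L[ℂ] H)} {C : ℝ}
    (hΘ : ∀ b e, ‖Θ b e‖ ≤ C * ‖e‖) (b : β) (e : E) (η ξ : H) :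
    ‖inner ℂ η (Θ b e ξ)‖ ≤ C * ‖e‖ * (‖η‖ * ‖ξ‖) := by
  refine (norm_inner_le_norm _ _).trans ?_
  have := (Θ b e).le_of_opNorm_le (hΘ b e) ξ
  nlinarith [norm_nonneg η]

variable [MeasurableSpace β] {ν : Measure β}

theorem aestronglyMeasurable_inner_apply (Θ : β → E →L[ℂ] (H →L[ℂ] H)) {η ξ : H}
    (hm : ∀ e, AEStronglyMeasurable (fun b => inner ℂ η (Θ b e ξ)) ν) {F : β → E}
    (hF : AEStronglyMeasurable F ν) :
    AEStronglyMeasurable (fun b => inner ℂ η (Θ b (F b) ξ)) ν := by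
  have hs : ∀ f : SimpleFunc β E,
      AEStronglyMeasurable (fun b => inner ℂ η (Θ b (f b) ξ)) ν := by
    intro f
    induction f using SimpleFunc.induction with
    | @const c s hs =>
      refine ((hm c).indicator hs).congr (.of_forall fun b => ?_)
      by_cases hb : b ∈ s <;> simp [hb]
    | @add f g _ hf hg =>
      refine (hf.add hg).congr (.of_forall fun b => ?_)
      simp
  refine AEStronglyMeasurable.congr (f := fun b => inner ℂ η (Θ b (hF.mk F b) ξ)) ?_ ?_
  · refine aestronglyMeasurable_of_tendsto_ae Filter.atTop
      (fun n => hs (hF.stronglyMeasurable_mk.approx n)) (.of_forall fun b => ?_)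
    have h1 : Continuous fun e => inner ℂ η (Θ b e ξ) :=
      continuous_const.inner ((Θ b).continuous.clm_apply continuous_const)
    exact h1.continuousAt.tendsto.comp (hF.stronglyMeasurable_mk.tendsto_approx b)
  · filter_upwards [hF.ae_eq_mk] with b hb
    rw [hb]

theorem integrable_inner_apply {Θ : β → E →L[ℂ] (H →L[ℂ] H)} {C : ℝ}
    (hΘ : ∀ b e, ‖Θ b e‖ ≤ C * ‖e‖) {η ξ : H}
    (hm : ∀ e, AEStronglyMeasurable (fun b => inner ℂ η (Θ b e ξ)) ν) {F : β → E}
    (hF : Integrable F ν) : Integrable (fun b => inner ℂ η (Θ b (F b) ξ)) ν :=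
  ((hF.norm.const_mul C).mul_const (‖η‖ * ‖ξ‖)).mono'
    (aestronglyMeasurable_inner_apply Θ hm hF.1)
    (.of_forall fun b => norm_inner_apply_le hΘ b (F b) η ξ)

theorem norm_integral_inner_apply_le {Θ : β → E →L[ℂ] (H →L[ℂ] H)} {C : ℝ}
    (hΘ : ∀ b e, ‖Θ b e‖ ≤ C * ‖e‖) {F : β → E} (hF : Integrable F ν) (η ξ : H) :
    ‖∫ b, inner ℂ η (Θ b (F b) ξ) ∂ν‖ ≤ C * (∫ b, ‖F b‖ ∂ν) * ‖η‖ * ‖ξ‖ := by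
  refine (norm_integral_le_of_norm_le ((hF.norm.const_mul C).mul_const (‖η‖ * ‖ξ‖))
    (.of_forall fun b => norm_inner_apply_le hΘ b (F b) η ξ)).trans_eq ?_
  rw [integral_mul_const, integral_const_mul]
  ring

/-- A weak integral `∫ Θ(b, F b) dν(b)` of operators, for `F` Bochner integrable, exists and lies in
the closed subspace `S` as soon as this is so for the functions `F = 1_A e`: the simple functions
are dense in `L¹(ν; E)`. -/
theorem exists_mem_inner_eq_integral [CompleteSpace H] (S : Submodule ℂ (H →L[ℂ] H))
    (hS : IsClosed (S : Set (H →L[ℂ] H))) {Θ : β → E →L[ℂ] (H →L[ℂ] H)} {C : ℝ} (hC : 0 ≤ C)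
    (hΘ : ∀ b e, ‖Θ b e‖ ≤ C * ‖e‖)
    (hm : ∀ η ξ e, AEStronglyMeasurable (fun b => inner ℂ η (Θ b e ξ)) ν)
    (hind : ∀ (e : E) (A : Set β), MeasurableSet A → ν A < ∞ →
      ∃ T ∈ S, ∀ η ξ, inner ℂ η (T ξ) = ∫ b in A, inner ℂ η (Θ b e ξ) ∂ν)
    {F : β → E} (hF : Integrable F ν) :
    ∃ T ∈ S, ∀ η ξ, inner ℂ η (T ξ) = ∫ b, inner ℂ η (Θ b (F b) ξ) ∂ν := by
  refine Integrable.induction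
    (fun F : β → E => ∃ T ∈ S, ∀ η ξ, inner ℂ η (T ξ) = ∫ b, inner ℂ η (Θ b (F b) ξ) ∂ν)
    ?_ ?_ ?_ ?_ hF
  · intro e A hA hνA
    obtain ⟨T, hT, h⟩ := hind e A hA hνA
    refine ⟨T, hT, fun η ξ => ?_⟩
    rw [h, ← integral_indicator hA]
    congr 1
    funext b
    by_cases hb : b ∈ A <;> simp [hb]
  · rintro f g - hf hg ⟨T, hT, h⟩ ⟨T', hT', h'⟩
    refine ⟨T + T', S.add_mem hT hT', fun η ξ => ?_⟩
    rw [_root_.add_apply, inner_add_right, h, h', ← integral_add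
      (integrable_inner_apply hΘ (hm η ξ) hf) (integrable_inner_apply hΘ (hm η ξ) hg)]
    simp
  · refine IsSeqClosed.isClosed fun f F hf hfF => ?_
    choose T hT h using hf
    have hsub : ∀ (f g : β →₁[ν] E) (η ξ : H), ‖(∫ b, inner ℂ η (Θ b (f b) ξ) ∂ν)
        - ∫ b, inner ℂ η (Θ b (g b) ξ) ∂ν‖ ≤ C * dist f g * ‖η‖ * ‖ξ‖ := by
      intro f g η ξ
      rw [← integral_sub (integrable_inner_apply hΘ (hm η ξ) (L1.integrable_coeFn f))
        (integrable_inner_apply hΘ (hm η ξ) (L1.integrable_coeFn g)), dist_eq_norm,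
        L1.norm_eq_integral_norm]
      refine le_of_eq_of_le ?_ (norm_integral_inner_apply_le hΘ (L1.integrable_coeFn (f - g)) η ξ)
      congr 1
      refine integral_congr_ae ?_
      filter_upwards [Lp.coeFn_sub f g] with b hb
      rw [hb, Pi.sub_apply, map_sub, _root_.sub_apply, inner_sub_right]
    have hdist : ∀ n m, dist (T n) (T m) ≤ C * dist (f n) (f m) := fun n m => by
      rw [dist_eq_norm]
      refine opNorm_le_of_norm_inner_le (by positivity) fun η ξ => ?_
      rw [_root_.sub_apply, inner_sub_right, h, h]
      exact hsub _ _ η ξ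
    have hcau : CauchySeq T := by
      rw [cauchySeq_iff_tendsto_dist_atTop_0]
      refine squeeze_zero (fun _ => dist_nonneg) (fun p => hdist p.1 p.2) ?_
      simpa using (cauchySeq_iff_tendsto_dist_atTop_0.1 hfF.cauchySeq).const_mul C
    obtain ⟨T', hT'⟩ := cauchySeq_tendsto_of_complete hcau
    refine ⟨T', hS.mem_of_tendsto hT' (.of_forall hT), fun η ξ => ?_⟩
    have h1 : Filter.Tendsto (fun n => inner ℂ η (T n ξ)) Filter.atTop
        (nhds (inner ℂ η (T' ξ))) := by
      have h2 : Continuous fun T : H →L[ℂ] H => inner ℂ η (T ξ) :=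
        continuous_const.inner (continuous_id.clm_apply continuous_const)
      exact h2.continuousAt.tendsto.comp hT'
    refine tendsto_nhds_unique h1 ?_
    simp only [h]
    rw [tendsto_iff_norm_sub_tendsto_zero]
    refine squeeze_zero (fun _ => norm_nonneg _) (fun n => hsub (f n) F η ξ) ?_
    have h3 := (((tendsto_iff_dist_tendsto_zero.1 hfF).const_mul C).mul_const ‖η‖).mul_const ‖ξ‖
    simpa using h3
  · rintro f g hfg - ⟨T, hT, h⟩
    refine ⟨T, hT, fun η ξ => (h η ξ).trans (integral_congr_ae ?_)⟩
    filter_upwards [hfg] with b hb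
    rw [hb]

end WeakIntegral

/-! ### The sets `Q_x` and the source map -/

section Interior

variable {G : Type*} [Group G] [TopologicalSpace G] [IsTopologicalGroup G] {P : Submonoid G}

theorem mul_mem_interior_submonoid {a s : G} (ha : a ∈ P) (hs : s ∈ interior (P : Set G)) :
    a * s ∈ interior (P : Set G) := by
  have h1 : (fun g : G => a * g) '' interior (P : Set G) ⊆ interior (P : Set G) := by
    refine interior_maximal ?_ ((Homeomorph.mulLeft a).isOpenMap _ isOpen_interior)
    rintro _ ⟨g, hg, rfl⟩
    exact P.mul_mem ha (interior_subset hg)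
  exact h1 ⟨s, hs, rfl⟩

omit [IsTopologicalGroup G] in
theorem one_mem_closure_interior (P : Submonoid G) [IsContinuousOre P] :
    (1 : G) ∈ closure (interior (P : Set G)) :=
  IsContinuousOre.subset_closure_interior P.one_mem

/-- In `g = a b⁻¹` both `a` and `b` may be taken from `Int P`. -/
theorem exists_mem_interior_mul_mem_interior (P : Submonoid G) [IsContinuousOre P] (g : G) :
    ∃ b ∈ interior (P : Set G), g * b ∈ interior (P : Set G) := by
  obtain ⟨a, b, rfl⟩ := IsContinuousOre.exists_eq_mul_inv (P := P) g
  obtain ⟨s, hs⟩ := closure_nonempty_iff.1 ⟨1, one_mem_closure_interior P⟩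
  refine ⟨b * s, mul_mem_interior_submonoid b.2 hs, ?_⟩
  have h : (a : G) * (b : G)⁻¹ * (b * s) = a * s := by group
  rw [h]
  exact mul_mem_interior_submonoid a.2 hs

end Interior

section Source

open scoped Pointwise

variable {G : Type*} [Group G] (P : Submonoid G) {X : Type*} [MulAction Pᵐᵒᵖ X]

open Classical in
/-- The right action of `P` on `X`, extended to `G` by the junk value `x · g = x` for `g ∉ P`. -/
noncomputable def act (x : X) (g : G) : X := if h : g ∈ P then x <• (⟨g, h⟩ : P) else x

open Classical in
/-- The source `s(x, g)` of the arrow `(x, g)`, with the junk value `x` if `g ∉ Q_x`. -/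
noncomputable def arrowSource (x : X) (g : G) : X :=
  if h : g ∈ fractionSet P x then h.choose else x

variable {P}

theorem act_of_mem (x : X) {g : G} (h : g ∈ P) : act P x g = x <• (⟨g, h⟩ : P) := dif_pos h

@[simp]
theorem act_coe (x : X) (a : P) : act P x (a : G) = x <• a := act_of_mem x a.2

theorem act_mul (x : X) {g h : G} (hg : g ∈ P) (hh : h ∈ P) :
    act P x (g * h) = act P (act P x g) h := by
  rw [act_of_mem x hg, act_of_mem _ hh, act_of_mem x (P.mul_mem hg hh), ← mul_smul,
    ← MulOpposite.op_mul]
  rfl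

theorem isArrow_arrowSource {x : X} {g : G} (h : g ∈ fractionSet P x) :
    IsArrow P x g (arrowSource P x g) := by
  rw [arrowSource, dif_pos h]
  exact h.choose_spec

theorem isArrow_act (x : X) {g : G} (hg : g ∈ P) : IsArrow P x g (act P x g) :=
  ⟨⟨g, hg⟩, 1, by simp, by simp [act_of_mem x hg]⟩

variable [TopologicalSpace G] [IsContinuousOre P]

/-- Whether `(x, g)` is an arrow to `y` may be tested on any way of writing `g` as a fraction. -/
theorem isArrow_iff (inj : ∀ a : P, Function.Injective fun x : X => x <• a) {x y : X} {g b : G}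
    (hb : b ∈ P) (hgb : g * b ∈ P) : IsArrow P x g y ↔ act P x (g * b) = act P y b := by
  constructor
  · rintro ⟨c, d, rfl, h⟩
    obtain ⟨α, β, h3⟩ := IsContinuousOre.exists_eq_mul_inv (P := P) ((d : G)⁻¹ * b)
    have h4 : (d : G) * α = b * β := by
      rw [inv_mul_eq_iff_eq_mul, ← mul_assoc, eq_mul_inv_iff_mul_eq] at h3
      exact h3.symm
    have h5 : act P (act P x (c * (d : G)⁻¹ * b)) β = act P (act P y b) β := by
      rw [← act_mul _ hgb β.2, ← act_mul _ hb β.2, mul_assoc, ← h4,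
        show (c : G) * (d : G)⁻¹ * (d * α) = c * α by group, act_mul _ c.2 α.2,
        act_mul _ d.2 α.2, act_coe _ c,
        act_coe _ d, h]
    rw [act_coe, act_coe] at h5
    exact inj β h5
  · intro h
    refine ⟨⟨_, hgb⟩, ⟨_, hb⟩, by simp, ?_⟩
    rwa [act_of_mem _ hgb, act_of_mem _ hb] at h

theorem IsArrow.unique (inj : ∀ a : P, Function.Injective fun x : X => x <• a) {x y z : X} {g : G}
    (hy : IsArrow P x g y) (hz : IsArrow P x g z) : y = z := by
  obtain ⟨a, b, rfl⟩ := IsContinuousOre.exists_eq_mul_inv (P := P) g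
  have h : (a : G) * (b : G)⁻¹ * b ∈ P := by simp
  have h1 := ((isArrow_iff inj b.2 h).1 hy).symm.trans ((isArrow_iff inj b.2 h).1 hz)
  rw [act_coe, act_coe] at h1
  exact inj b h1

theorem IsArrow.arrowSource_eq (inj : ∀ a : P, Function.Injective fun x : X => x <• a) {x y : X}
    {g : G} (h : IsArrow P x g y) : arrowSource P x g = y :=
  (isArrow_arrowSource ⟨y, h⟩).unique inj h

theorem IsArrow.mul_mem_fractionSet_iff {x y : X} {u : G} (hu : IsArrow P x u y) (g : G) :
    u * g ∈ fractionSet P x ↔ g ∈ fractionSet P y := by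
  constructor
  · rintro ⟨z, hz⟩
    exact ⟨z, by simpa using hu.inv.mul hz⟩
  · rintro ⟨z, hz⟩
    exact ⟨z, hu.mul hz⟩

theorem mul_mem_fractionSet {x : X} {g p : G} (hg : g ∈ fractionSet P x) (hp : p ∈ P) :
    g * p ∈ fractionSet P x := by
  obtain ⟨y, hy⟩ := hg
  exact ⟨_, hy.mul (isArrow_act y hp)⟩

theorem fractionSet_subset_closure [IsTopologicalGroup G] (x : X) :
    fractionSet P x ⊆ closure (fractionSet P x * interior (P : Set G)) := by
  intro g hg
  have h1 : g * 1 ∈ closure ((fun s => g * s) '' interior (P : Set G)) := by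
    refine image_closure_subset_closure_image (continuous_const_mul g) ?_
    exact ⟨1, one_mem_closure_interior P, rfl⟩
  rw [mul_one] at h1
  refine closure_mono ?_ h1
  rintro _ ⟨s, hs, rfl⟩
  exact Set.mul_mem_mul hg hs

theorem fractionSet_mul_interior_subset (x : X) :
    fractionSet P x * interior (P : Set G) ⊆ fractionSet P x := by
  rintro _ ⟨g, hg, s, hs, rfl⟩
  exact mul_mem_fractionSet hg (interior_subset hs)

variable [IsTopologicalGroup G] [TopologicalSpace X] [ContinuousSMul Pᵐᵒᵖ X]

omit [IsContinuousOre P] [IsTopologicalGroup G] in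
theorem continuousOn_act : ContinuousOn (fun p : X × G => act P p.1 p.2) {p | p.2 ∈ P} := by
  rw [continuousOn_iff_continuous_domRestrict]
  have h : Set.domRestrict {p : X × G | p.2 ∈ P} (fun p => act P p.1 p.2)
      = fun p => p.1.1 <• (⟨p.1.2, p.2⟩ : P) := funext fun p => act_of_mem _ p.2
  rw [h]
  fun_prop

omit [IsContinuousOre P] [IsTopologicalGroup G] in
theorem continuous_smul_right (a : P) : Continuous fun x : X => x <• a := by fun_prop

omit [IsContinuousOre P] in
theorem continuousAt_act_mul {x : X} {g b : G} (hgb : g * b ∈ interior (P : Set G)) :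
    ContinuousAt (fun p : X × G => act P p.1 (p.2 * b)) (x, g) := by
  have h1 : ContinuousAt (fun p : X × G => act P p.1 p.2) (x, g * b) :=
    continuousOn_act.continuousAt (Filter.mem_of_superset
      ((continuous_snd.isOpen_preimage (Y := G) _ isOpen_interior).mem_nhds hgb)
      fun p hp => interior_subset (s := (P : Set G)) hp)
  have h2 : Continuous fun p : X × G => (p.1, p.2 * b) := by fun_prop
  exact ContinuousAt.comp (x := ((x, g) : X × G)) h1 h2.continuousAt

omit [MulAction Pᵐᵒᵖ X] [IsContinuousOre P] [ContinuousSMul Pᵐᵒᵖ X] in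
theorem eventually_mul_mem {x : X} {g b : G} (hgb : g * b ∈ interior (P : Set G)) :
    ∀ᶠ p : X × G in nhds (x, g), p.2 * b ∈ P := by
  have h : Continuous fun p : X × G => p.2 * b := by fun_prop
  filter_upwards [(h.isOpen_preimage _ isOpen_interior).mem_nhds hgb] with p hp
  exact interior_subset (s := (P : Set G)) hp

variable [CompactSpace X] [T2Space X]

/-- The groupoid `X ⋊ P` is closed in `X × G`. -/
theorem isClosed_arrows (inj : ∀ a : P, Function.Injective fun x : X => x <• a) :
    IsClosed {p : X × G | p.2 ∈ fractionSet P p.1} := by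
  rw [isClosed_iff_frequently]
  rintro ⟨x, g⟩ hfreq
  obtain ⟨b, hb, hgb⟩ := exists_mem_interior_mul_mem_interior P g
  replace hb := interior_subset hb
  have hcl : IsClosed (Set.range fun y : X => y <• (⟨b, hb⟩ : P)) :=
    (isCompact_range (continuous_smul_right _)).isClosed
  have h2 : act P x (g * b) ∈ Set.range fun y : X => y <• (⟨b, hb⟩ : P) := by
    refine hcl.mem_of_frequently_of_tendsto ?_ (continuousAt_act_mul hgb).tendsto
    refine (hfreq.and_eventually (eventually_mul_mem hgb)).mono ?_
    rintro ⟨x', g'⟩ ⟨⟨y, hy⟩, hg'⟩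
    exact ⟨y, by rw [(isArrow_iff inj hb hg').1 hy, act_of_mem _ hb]⟩
  obtain ⟨y, hy⟩ := h2
  exact ⟨y, (isArrow_iff inj hb (interior_subset hgb)).2 (by rw [← hy, act_of_mem _ hb])⟩

theorem isClosed_fractionSet (inj : ∀ a : P, Function.Injective fun x : X => x <• a) (x : X) :
    IsClosed (fractionSet P x) :=
  (isClosed_arrows inj).preimage (Continuous.prodMk_right x)

/-- Near `(x, g)` the source is `s(x', g') = x' (g' b)` followed by the inverse of the embedding
`y ↦ y b`, for any `b ∈ P` with `g b ∈ Int P`. -/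
theorem continuousOn_arrowSource (inj : ∀ a : P, Function.Injective fun x : X => x <• a) :
    ContinuousOn (fun p : X × G => arrowSource P p.1 p.2) {p | p.2 ∈ fractionSet P p.1} := by
  rintro ⟨x, g⟩ hxg
  obtain ⟨b, hb, hgb⟩ := exists_mem_interior_mul_mem_interior P g
  replace hb := interior_subset hb
  have hemb : Topology.IsEmbedding fun y : X => y <• (⟨b, hb⟩ : P) :=
    ((continuous_smul_right _).isClosedEmbedding (inj _)).isEmbedding
  rw [ContinuousWithinAt, hemb.tendsto_nhds_iff]
  have key : ∀ (x' : X) (g' : G), g' ∈ fractionSet P x' → g' * b ∈ P →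
      act P x' (g' * b) = arrowSource P x' g' <• (⟨b, hb⟩ : P) := fun x' g' h h' => by
    rw [(isArrow_iff inj hb h').1 (isArrow_arrowSource h), act_of_mem _ hb]
  have h1 := (continuousAt_act_mul (x := x) hgb).tendsto
  rw [key x g hxg (interior_subset hgb)] at h1
  refine (h1.mono_left nhdsWithin_le_nhds).congr' ?_
  filter_upwards [self_mem_nhdsWithin, nhdsWithin_le_nhds (eventually_mul_mem hgb)] with p hp hp'
  exact key p.1 p.2 hp hp'

omit [CompactSpace X] [T2Space X] in
/-- If `g ∈ Q_x` and `p ∈ Int P`, then `g p ∈ Q_{x'}` for all `x'` near `x`. This is where the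
openness of `X × Int P → X` enters. -/
theorem eventually_mul_mem_fractionSet
    (inj : ∀ a : P, Function.Injective fun x : X => x <• a)
    (hopen : IsOpenMap fun p : X × {a : P // (a : G) ∈ interior (P : Set G)} => p.1 <• p.2.1)
    {x : X} {g p : G} (hg : g ∈ fractionSet P x) (hp : p ∈ interior (P : Set G)) :
    ∀ᶠ x' in nhds x, g * p ∈ fractionSet P x' := by
  obtain ⟨d, hd, hgpd⟩ := exists_mem_interior_mul_mem_interior P (g * p)
  have hdP := interior_subset hd
  have hgpdP := interior_subset hgpd
  have hpP := interior_subset hp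
  have hpd : p * d ∈ interior (P : Set G) := mul_mem_interior_submonoid hpP hd
  -- `V = X × (Int P) d` is open in `X × Int P`, so that `X (Int P) d` is open; it contains
  -- `x (g p d) = s(x, g) (p d)` and is contained in `X d`.
  let V : Set (X × {a : P // (a : G) ∈ interior (P : Set G)}) :=
    {q | (q.2.1 : G) * d⁻¹ ∈ interior (P : Set G)}
  have hV : IsOpen V := isOpen_interior.preimage (by fun_prop)
  have hVo := hopen _ hV
  have hx : act P x (g * p * d) ∈ (fun p : X × {a : P // (a : G) ∈ interior (P : Set G)} =>
      p.1 <• p.2.1) '' V := by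
    refine ⟨(arrowSource P x g, ⟨⟨p * d, interior_subset hpd⟩, hpd⟩), ?_, ?_⟩
    · simpa [V] using hp
    · have h1 := (isArrow_iff inj (interior_subset hpd) (by rw [← mul_assoc]; exact hgpdP)).1
        (isArrow_arrowSource hg)
      rw [mul_assoc, h1, act_of_mem _ (interior_subset hpd)]
  have hc : ContinuousAt (fun x' => act P x' (g * p * d)) x :=
    (continuousAt_act_mul hgpd).comp (f := fun x' => (x', g * p))
      (Continuous.prodMk_left _).continuousAt
  filter_upwards [hc (hVo.mem_nhds hx)] with x' hx'
  obtain ⟨⟨y, q⟩, hq, hy⟩ := hx'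
  have hqd : (q.1 : G) * d⁻¹ ∈ P := interior_subset hq
  refine ⟨act P y (q.1 * d⁻¹), (isArrow_iff inj hdP hgpdP).2 ?_⟩
  refine hy.symm.trans ?_
  rw [← act_mul _ hqd hdP, inv_mul_cancel_right, act_coe]

variable [LocallyCompactSpace G] [T2Space G] [SecondCountableTopology G] [MeasurableSpace G]
  [BorelSpace G] (μ : Measure G) [μ.IsHaarMeasure]

/-- By the Steinhaus theorem, the part of `Q_x` outside the open subset `Q_x · Int P` is a null
set: if `g` and `g s` lie in this part, then `s ∉ Int P`, and `Int P` accumulates at `1`. -/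
theorem measure_fractionSet_diff (inj : ∀ a : P, Function.Injective fun x : X => x <• a) (x : X) :
    μ (fractionSet P x \ (fractionSet P x * interior (P : Set G))) = 0 := by
  set N := fractionSet P x \ (fractionSet P x * interior (P : Set G)) with hN
  have hNm : MeasurableSet N :=
    (isClosed_fractionSet inj x).measurableSet.diff isOpen_interior.mul_left.measurableSet
  by_contra h0
  have h1 : μ N⁻¹ ≠ 0 := fun h => h0 ((measure_inv_null μ).1 h)
  have h2 := div_mem_nhds_one_of_haar_pos μ N⁻¹ hNm.inv (pos_iff_ne_zero.2 h1)
  obtain ⟨s, hs, hs'⟩ := mem_closure_iff_nhds.1 (one_mem_closure_interior P) _ h2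
  obtain ⟨a, ha, b, hb, rfl⟩ := hs
  have h3 : b⁻¹ = a⁻¹ * (a / b) := by simp [div_eq_mul_inv]
  refine (Set.mem_inv.1 hb).2 ?_
  rw [h3]
  exact Set.mul_mem_mul (Set.mem_inv.1 ha).1 hs'

/-- For almost every `g`, whether `g ∈ Q_{x'}` does not depend on `x'` near `x`. -/
theorem ae_eventually_mem_fractionSet_iff
    (inj : ∀ a : P, Function.Injective fun x : X => x <• a)
    (hopen : IsOpenMap fun p : X × {a : P // (a : G) ∈ interior (P : Set G)} => p.1 <• p.2.1)
    (x : X) : ∀ᵐ g ∂μ, ∀ᶠ x' in nhds x, g ∈ fractionSet P x' ↔ g ∈ fractionSet P x := by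
  have h := measure_fractionSet_diff μ inj x
  rw [measure_eq_zero_iff_ae_notMem] at h
  filter_upwards [h] with g hg
  by_cases hgx : g ∈ fractionSet P x
  · have h1 : g ∈ fractionSet P x * interior (P : Set G) := by
      by_contra h2
      exact hg ⟨hgx, h2⟩
    obtain ⟨a, ha, s, hs, rfl⟩ := h1
    filter_upwards [eventually_mul_mem_fractionSet inj hopen ha hs] with x' hx'
    exact ⟨fun _ => hgx, fun _ => hx'⟩
  · have h1 : IsClosed {x' : X | g ∈ fractionSet P x'} :=
      (isClosed_arrows inj).preimage (Continuous.prodMk_left g)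
    filter_upwards [h1.isOpen_compl.mem_nhds hgx] with x' hx'
    exact ⟨fun h => (hx' h).elim, fun h => (hgx h).elim⟩

omit [LocallyCompactSpace G] [T2Space G] [SecondCountableTopology G] [BorelSpace G] in
/-- The set `Q_x` is determined by its class modulo null sets, being the closure of the open set
`Q_x · Int P`. -/
theorem fractionSet_subset_of_ae (inj : ∀ a : P, Function.Injective fun x : X => x <• a)
    {x y : X}
    (h : ∀ᵐ g ∂μ, g ∈ fractionSet P x → g ∈ fractionSet P y) :
    fractionSet P x ⊆ fractionSet P y := by
  have hcl := isClosed_fractionSet inj y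
  refine (fractionSet_subset_closure x).trans (hcl.closure_subset_iff.2 ?_)
  have ho : IsOpen ((fractionSet P x * interior (P : Set G)) \ fractionSet P y) :=
    isOpen_interior.mul_left.sdiff hcl
  have h0 : μ ((fractionSet P x * interior (P : Set G)) \ fractionSet P y) = 0 := by
    rw [measure_eq_zero_iff_ae_notMem]
    filter_upwards [h] with g hg hg'
    exact hg'.2 (hg (fractionSet_mul_interior_subset x hg'.1))
  exact Set.sdiff_eq_empty.1 ((ho.measure_eq_zero_iff μ).1 h0)

end Source

/-! ### Pulling back `L²` along a measurable embedding -/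

section Pullback

variable {α β : Type*} [MeasurableSpace α] [MeasurableSpace β] {e : α → β} {ν : Measure β}

theorem MeasurableEmbedding.measurePreserving_comap (he : MeasurableEmbedding e) :
    MeasurePreserving e (ν.comap e) (ν.restrict (Set.range e)) :=
  ⟨he.measurable, he.map_comap ν⟩

theorem MeasurableEmbedding.extend_ae_eq (he : MeasurableEmbedding e) {u v : α → ℂ}
    (h : u =ᵐ[ν.comap e] v) : Function.extend e u 0 =ᵐ[ν] Function.extend e v 0 := by
  have h1 : ∀ᵐ b ∂(ν.comap e).map e, Function.extend e u 0 b = Function.extend e v 0 b := by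
    rw [he.ae_map_iff]
    filter_upwards [h] with a ha
    rw [he.injective.extend_apply, he.injective.extend_apply, ha]
  rw [he.map_comap, ae_restrict_iff' he.measurableSet_range] at h1
  filter_upwards [h1] with b hb
  by_cases hb' : b ∈ Set.range e
  · exact hb hb'
  · rw [Function.extend_apply' _ _ _ hb', Function.extend_apply' _ _ _ hb']

theorem MeasurableEmbedding.integral_comap_comp (he : MeasurableEmbedding e) (u : β → ℂ) :
    ∫ a, u (e a) ∂ν.comap e = ∫ b in Set.range e, u b ∂ν := by
  rw [← he.map_comap, he.integral_map]

theorem MeasurableEmbedding.ae_comap_of_ae (he : MeasurableEmbedding e) {p : β → Prop}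
    (h : ∀ᵐ b ∂ν, p b) : ∀ᵐ a ∂ν.comap e, p (e a) :=
  he.measurePreserving_comap.quasiMeasurePreserving.ae (ae_restrict_of_ae h)

theorem MeasurableEmbedding.integral_mul_extend (he : MeasurableEmbedding e) (u : β → ℂ)
    (v : α → ℂ) :
    ∫ b, u b * Function.extend e v 0 b ∂ν = ∫ a, u (e a) * v a ∂ν.comap e := by
  have h1 := he.integral_comap_comp (ν := ν) fun b => u b * Function.extend e v 0 b
  simp only [he.injective.extend_apply] at h1
  rw [h1, ← integral_indicator he.measurableSet_range]
  refine integral_congr_ae (.of_forall fun b => ?_)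
  by_cases hb : b ∈ Set.range e
  · rw [Set.indicator_of_mem hb]
  · rw [Set.indicator_of_notMem hb]
    simp only [Function.extend_apply' _ _ _ hb, Pi.zero_apply, mul_zero]

/-- The restriction operator `ξ ↦ ξ ∘ e` from `L²(ν)` to the `L²` space of the induced measure. -/
noncomputable def pullL2 (he : MeasurableEmbedding e) (ν : Measure β) :
    Lp ℂ 2 ν →L[ℂ] Lp ℂ 2 (ν.comap e) :=
  (Lp.compMeasurePreservingₗᵢ ℂ e he.measurePreserving_comap).toContinuousLinearMap ∘L
    LpToLpRestrictCLM β ℂ ℂ ν 2 (Set.range e)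

theorem pullL2_coeFn (he : MeasurableEmbedding e) (ξ : Lp ℂ 2 ν) :
    pullL2 he ν ξ =ᵐ[ν.comap e] fun a => ξ (e a) := by
  refine (Lp.coeFn_compMeasurePreserving _ he.measurePreserving_comap).trans ?_
  have h := LpToLpRestrictCLM_coeFn (p := 2) ℂ (Set.range e) ξ
  exact he.measurePreserving_comap.quasiMeasurePreserving.ae h

theorem norm_pullL2_le (he : MeasurableEmbedding e) (ν : Measure β) : ‖pullL2 he ν‖ ≤ 1 := by
  refine ContinuousLinearMap.opNorm_le_bound _ zero_le_one fun η => ?_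
  rw [one_mul]
  change ‖Lp.compMeasurePreservingₗᵢ ℂ e he.measurePreserving_comap _‖ ≤ _
  rw [LinearIsometry.norm_map]
  exact norm_Lp_toLp_restrict_le _ η

/-- Extension by zero, the adjoint of the restriction operator. -/
theorem adjoint_pullL2_coeFn (he : MeasurableEmbedding e) (η : Lp ℂ 2 (ν.comap e)) :
    ContinuousLinearMap.adjoint (pullL2 he ν) η =ᵐ[ν] Function.extend e η 0 := by
  have hm : Measurable (Function.extend e η 0) :=
    he.measurable_extend (Lp.stronglyMeasurable η).measurable measurable_const
  have hr : ∀ b, Function.extend e η 0 b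
      = (Set.range e).indicator (Function.extend e η 0) b := fun b => by
    by_cases hb : b ∈ Set.range e
    · rw [Set.indicator_of_mem hb]
    · rw [Set.indicator_of_notMem hb, Function.extend_apply' _ _ _ hb, Pi.zero_apply]
  have h0 : MemLp (Function.extend e η 0) 2 ν := by
    rw [show Function.extend e η 0 = _ from funext hr, memLp_indicator_iff_restrict
      he.measurableSet_range, ← he.map_comap, he.memLp_map_measure_iff,
      Function.extend_comp he.injective]
    exact Lp.memLp η
  have h1 : ContinuousLinearMap.adjoint (pullL2 he ν) η = h0.toLp _ := by
    refine ext_inner_right ℂ fun ζ => ?_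
    rw [ContinuousLinearMap.adjoint_inner_left, L2.inner_def, L2.inner_def]
    have h2 : ∫ b, inner ℂ (h0.toLp _ b) (ζ b) ∂ν
        = ∫ b in Set.range e, inner ℂ (Function.extend e η 0 b) (ζ b) ∂ν := by
      rw [← integral_indicator he.measurableSet_range]
      refine integral_congr_ae ?_
      filter_upwards [h0.coeFn_toLp] with b hb
      rw [hb]
      by_cases hb' : b ∈ Set.range e
      · rw [Set.indicator_of_mem hb']
      · rw [Set.indicator_of_notMem hb', Function.extend_apply' _ _ _ hb', Pi.zero_apply,
          inner_zero_left]
    rw [h2, ← he.integral_comap_comp]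
    refine integral_congr_ae ?_
    filter_upwards [pullL2_coeFn he ζ] with a ha
    rw [ha, he.injective.extend_apply]
  rw [h1]
  exact h0.coeFn_toLp

theorem pullL2_adjoint (he : MeasurableEmbedding e) (η : Lp ℂ 2 (ν.comap e)) :
    pullL2 he ν (ContinuousLinearMap.adjoint (pullL2 he ν) η) = η := by
  ext1
  have h := adjoint_pullL2_coeFn he η
  have h1 : ∀ᵐ b ∂(ν.comap e).map e,
      ContinuousLinearMap.adjoint (pullL2 he ν) η b = Function.extend e η 0 b := by
    rw [he.map_comap]
    exact ae_restrict_of_ae h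
  filter_upwards [pullL2_coeFn he (ContinuousLinearMap.adjoint (pullL2 he ν) η),
    (he.ae_map_iff).1 h1] with a ha ha'
  rw [ha, ha', he.injective.extend_apply]

end Pullback

/-! ### Regular representations as integral operators on `L²(G)` -/

section Fibres

variable {G : Type*} [Group G] [TopologicalSpace G] [IsTopologicalGroup G] {P : Submonoid G}
  [IsContinuousOre P] {X : Type*} [MulAction Pᵐᵒᵖ X] [TopologicalSpace X]

variable (P) in
/-- A point of `X` as a unit of `X ⋊ P`. -/
abbrev unitOf (x : X) : UnitSpace X P := x

/-- The coordinate `(x, g) ↦ g`, which identifies the fibre over `x` with `Q_x ⊆ G`. -/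
def fibreCoord (x : UnitSpace X P) (γ : RangeFibre x) : G := γ.hom.1

omit [TopologicalSpace X] [IsTopologicalGroup G] in
theorem range_fibreCoord (x : UnitSpace X P) :
    Set.range (fibreCoord x) = fractionSet P (X := X) x := by
  ext g
  constructor
  · rintro ⟨γ, rfl⟩
    exact ⟨γ.src, γ.hom.2⟩
  · rintro ⟨y, hy⟩
    exact ⟨⟨(⟨g, hy⟩ : x ⟶ (y : UnitSpace X P))⟩, rfl⟩

omit [TopologicalSpace X] [IsTopologicalGroup G] in
theorem fibreCoord_injective (inj : ∀ a : P, Function.Injective fun x : X => x <• a)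
    (x : UnitSpace X P) : Function.Injective (fibreCoord x) := by
  rintro ⟨⟨g, hg⟩⟩ ⟨⟨h, hh⟩⟩ (rfl : g = h)
  obtain rfl := IsArrow.unique inj hg hh
  rfl

omit [IsTopologicalGroup G] in
theorem isInducing_fibreCoord (x : UnitSpace X P) : Topology.IsInducing (fibreCoord x) := by
  have h1 : Topology.IsInducing fun γ : RangeFibre x => Arrows.toProd P γ.toArrows :=
    (Topology.IsInducing.mk rfl : Topology.IsInducing (Arrows.toProd (X := X) P)).comp
      (Topology.IsInducing.mk rfl)
  have h2 : Topology.IsInducing fun g : G => ((show X from x), g) :=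
    (isEmbedding_prodMkRight (show X from x)).isInducing
  exact (h2.of_comp_iff (f := fibreCoord x)).1 h1

variable [ContinuousSMul Pᵐᵒᵖ X] [CompactSpace X] [T2Space X]

theorem isClosedEmbedding_fibreCoord (inj : ∀ a : P, Function.Injective fun x : X => x <• a)
    (x : UnitSpace X P) : Topology.IsClosedEmbedding (fibreCoord x) :=
  ⟨⟨isInducing_fibreCoord x, fibreCoord_injective inj x⟩, by
    rw [range_fibreCoord]; exact isClosed_fractionSet inj _⟩

variable [MeasurableSpace G] [BorelSpace G]

theorem measurableEmbedding_fibreCoord (inj : ∀ a : P, Function.Injective fun x : X => x <• a)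
    (x : UnitSpace X P) : MeasurableEmbedding (fibreCoord x) :=
  (isClosedEmbedding_fibreCoord inj x).measurableEmbedding

variable (μ : Measure G)

/-- The sealed space `L²(𝒢ˣ, λˣ)` unfolded. -/
noncomputable def fibreL2Equiv (x : UnitSpace X P) :
    FibreL2 (semidirectHaar (X := X) P μ) x ≃ₗᵢ[ℂ] Lp ℂ 2 (μ.comap (fibreCoord (X := X) x)) :=
  LinearIsometryEquiv.refl ℂ (Lp ℂ 2 (μ.comap (fibreCoord (X := X) x)))

/-- The restriction map `L²(G) → L²(𝒢ˣ, λˣ)`, where `𝒢ˣ` is identified with `Q_x ⊆ G`. Its adjoint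
is the extension by zero. -/
noncomputable def fibreRestrict (inj : ∀ a : P, Function.Injective fun x : X => x <• a)
    (x : UnitSpace X P) : Lp ℂ 2 μ →L[ℂ] FibreL2 (semidirectHaar (X := X) P μ) x :=
  ((fibreL2Equiv μ x).symm.toContinuousLinearEquiv : _ →L[ℂ] _) ∘L
    pullL2 (measurableEmbedding_fibreCoord inj x) μ

variable {μ} (inj : ∀ a : P, Function.Injective fun x : X => x <• a)

theorem fibreRestrict_fn (x : UnitSpace X P) (ξ : Lp ℂ 2 μ) :
    (fibreRestrict μ inj x ξ).fn =ᵐ[semidirectHaar (X := X) P μ x] fun γ => ξ (fibreCoord x γ) :=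
  pullL2_coeFn (measurableEmbedding_fibreCoord inj x) ξ

theorem adjoint_fibreRestrict (x : UnitSpace X P) (η : FibreL2 (semidirectHaar (X := X) P μ) x) :
    ContinuousLinearMap.adjoint (fibreRestrict μ inj x) η = ContinuousLinearMap.adjoint
      (pullL2 (measurableEmbedding_fibreCoord inj x) μ) (fibreL2Equiv μ x η) := by
  refine ext_inner_right ℂ fun ζ => ?_
  rw [ContinuousLinearMap.adjoint_inner_left, ContinuousLinearMap.adjoint_inner_left,
    ← (fibreL2Equiv μ x).inner_map_map]
  congr 1

theorem adjoint_fibreRestrict_coeFn (x : UnitSpace X P)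
    (η : FibreL2 (semidirectHaar (X := X) P μ) x) :
    ContinuousLinearMap.adjoint (fibreRestrict μ inj x) η
      =ᵐ[μ] Function.extend (fibreCoord x) η.fn 0 := by
  rw [adjoint_fibreRestrict]
  exact adjoint_pullL2_coeFn (measurableEmbedding_fibreCoord inj x) (fibreL2Equiv μ x η)

theorem fibreRestrict_adjoint (x : UnitSpace X P)
    (η : FibreL2 (semidirectHaar (X := X) P μ) x) :
    fibreRestrict μ inj x (ContinuousLinearMap.adjoint (fibreRestrict μ inj x) η) = η := by
  rw [adjoint_fibreRestrict]
  exact (congrArg (fibreL2Equiv μ x).symm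
    (pullL2_adjoint (measurableEmbedding_fibreCoord inj x) (fibreL2Equiv μ x η))).trans
    ((fibreL2Equiv μ x).symm_apply_apply η)

theorem norm_fibreRestrict_le (x : UnitSpace X P) : ‖fibreRestrict μ inj x‖ ≤ 1 := by
  refine ContinuousLinearMap.opNorm_le_bound _ zero_le_one fun η => ?_
  refine le_of_eq_of_le ((fibreL2Equiv μ x).symm.norm_map _) ?_
  exact (pullL2 (measurableEmbedding_fibreCoord inj x) μ).le_of_opNorm_le (norm_pullL2_le _ _) η

open Classical in
/-- The integral kernel on `G × G` of `Ind δₓ (F)`, for `F` defined on `X × G`: with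
`γ = (x, g)` and `η = (x, h)` one has `γ⁻¹ η = (s(x, g), g⁻¹ h)`. -/
noncomputable def fibreKernel (F : X × G → ℂ) (x : X) (g h : G) : ℂ :=
  if g ∈ fractionSet P x ∧ h ∈ fractionSet P x then F (arrowSource P x g, g⁻¹ * h) else 0

theorem hasKernel_adjoint_fibreRestrict_comp {f : C_c(Arrows (UnitSpace X P), ℂ)}
    {T : OperatorFamilies (FibreL2 (semidirectHaar (X := X) P μ))}
    (hT : IsRegularRep (semidirectHaar (X := X) P μ) f T) {F : X × G → ℂ}
    (hF : ∀ γ, f γ = F (Arrows.toProd P γ)) (x : UnitSpace X P) :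
    HasKernel μ (fibreKernel (P := P) F x)
      (ContinuousLinearMap.adjoint (fibreRestrict μ inj x) ∘L T.coord x ∘L
        fibreRestrict μ inj x) := by
  intro ξ
  have he := measurableEmbedding_fibreCoord inj x
  refine (adjoint_fibreRestrict_coeFn inj x _).trans ?_
  refine (he.extend_ae_eq (hT x (fibreRestrict μ inj x ξ))).trans (.of_forall fun g => ?_)
  by_cases hg : g ∈ fractionSet P (X := X) x
  · rw [← range_fibreCoord] at hg
    obtain ⟨γ, rfl⟩ := hg
    have hγ : IsArrow P (X := X) x (fibreCoord x γ) γ.src := γ.hom.2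
    let u : G → ℂ := fun h =>
      F (arrowSource P (X := X) x (fibreCoord x γ), (fibreCoord x γ)⁻¹ * h) * ξ h
    have h1 : ∫ η, f (γ.invMul η) * (fibreRestrict μ inj x ξ).fn η ∂semidirectHaar (X := X) P μ x
        = ∫ η, u (fibreCoord x η) ∂μ.comap (fibreCoord (X := X) x) := by
      refine integral_congr_ae ?_
      filter_upwards [fibreRestrict_fn inj x ξ] with η hη
      change _ = F (arrowSource P (X := X) x (fibreCoord x γ), _) * _
      rw [hη, hF, hγ.arrowSource_eq inj]
      rfl
    rw [he.injective.extend_apply]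
    refine h1.trans ((he.integral_comap_comp u).trans ?_)
    rw [← integral_indicator he.measurableSet_range]
    refine integral_congr_ae (.of_forall fun h => ?_)
    have hγ' : fibreCoord x γ ∈ fractionSet P (X := X) x := ⟨_, hγ⟩
    by_cases hh : h ∈ fractionSet P (X := X) x
    · rw [Set.indicator_of_mem (by rwa [range_fibreCoord])]
      simp only [fibreKernel, hγ', hh, and_self, if_true, u]
    · rw [Set.indicator_of_notMem (by rwa [range_fibreCoord])]
      simp only [fibreKernel, hh, and_false, if_false, zero_mul]
  · rw [Function.extend_apply' _ _ _ (by rwa [← range_fibreCoord] at hg)]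
    simp only [fibreKernel, hg, false_and, if_false, zero_mul, integral_zero, Pi.zero_apply]

end Fibres

/-! ### The kernels of functions in `C_c(X ⋊ P)` -/

section Kernel

variable {G : Type*} [Group G] [TopologicalSpace G] [IsTopologicalGroup G]

section Convolution

variable [MeasurableSpace G] [BorelSpace G] [SecondCountableTopology G] (μ : Measure G)
  [μ.IsHaarMeasure] {E : Type*} [NormedAddCommGroup E]

/-- Kernels of the form `φ(g⁻¹ h)` with `φ` continuous and compactly supported satisfy the
hypothesis of the Schur test. -/
theorem exists_isSchurKernel {φ : G → E} (hφ : Continuous φ) (hφ' : HasCompactSupport φ) :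
    ∃ C, IsSchurKernel μ (fun g h => ‖φ (g⁻¹ * h)‖ₑ) C := by
  have hφi : HasCompactSupport fun g => φ g⁻¹ := hφ'.comp_homeomorph (Homeomorph.inv G)
  have hφc : Continuous fun g => φ g⁻¹ := hφ.comp continuous_inv
  have h1 : ∫⁻ g, ‖φ g‖ₑ ∂μ < ∞ := (hφ.integrable_of_hasCompactSupport hφ').2
  have h2 : ∫⁻ g, ‖φ g⁻¹‖ₑ ∂μ < ∞ := (hφc.integrable_of_hasCompactSupport hφi).2
  lift ∫⁻ g, ‖φ g‖ₑ ∂μ to ℝ≥0 using h1.ne with A hA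
  lift ∫⁻ g, ‖φ g⁻¹‖ₑ ∂μ to ℝ≥0 using h2.ne with B hB
  refine ⟨A + B, ?_, fun g => ?_, fun h => ?_⟩
  · have h3 : Continuous fun p : G × G => ‖φ (p.1⁻¹ * p.2)‖ₑ := by fun_prop
    exact h3.measurable
  · rw [lintegral_mul_left_eq_self (fun h => ‖φ h‖ₑ) g⁻¹, ← hA]
    exact_mod_cast le_self_add
  · have h3 : ∀ g, ‖φ (g⁻¹ * h)‖ₑ = ‖φ (h⁻¹ * g)⁻¹‖ₑ := fun g => by simp
    simp only [h3]
    rw [lintegral_mul_left_eq_self (fun g => ‖φ g⁻¹‖ₑ) h⁻¹, ← hB]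
    exact_mod_cast le_add_self

/-- Left translation `(L_u ξ)(g) = ξ(u g)` on `L²(G)`. -/
noncomputable def leftTranslation (u : G) : Lp ℂ 2 μ →ₗᵢ[ℂ] Lp ℂ 2 μ :=
  Lp.compMeasurePreservingₗᵢ ℂ (u * ·) (measurePreserving_mul_left μ u)

variable {μ}

omit [SecondCountableTopology G] in
theorem leftTranslation_coeFn (u : G) (ξ : Lp ℂ 2 μ) :
    leftTranslation μ u ξ =ᵐ[μ] fun g => ξ (u * g) :=
  Lp.coeFn_compMeasurePreserving _ (measurePreserving_mul_left μ u)

omit [SecondCountableTopology G] in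
theorem leftTranslation_inv (u : G) (ξ : Lp ℂ 2 μ) :
    leftTranslation μ u (leftTranslation μ u⁻¹ ξ) = ξ := by
  ext1
  filter_upwards [leftTranslation_coeFn u (leftTranslation μ u⁻¹ ξ),
    (measurePreserving_mul_left μ u).quasiMeasurePreserving.ae (leftTranslation_coeFn u⁻¹ ξ)]
    with g h1 h2
  rw [h1, h2, inv_mul_cancel_left]

omit [SecondCountableTopology G] in
theorem HasKernel.comp_leftTranslation {K K' : G → G → ℂ} {S T : Lp ℂ 2 μ →L[ℂ] Lp ℂ 2 μ} {u : G}
    (hS : HasKernel μ K' S) (hT : HasKernel μ K T) (h : ∀ g h, K' g h = K (u * g) (u * h))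
    (ξ : Lp ℂ 2 μ) : S (leftTranslation μ u ξ) = leftTranslation μ u (T ξ) := by
  ext1
  filter_upwards [hS (leftTranslation μ u ξ), leftTranslation_coeFn u (T ξ),
    (measurePreserving_mul_left μ u).quasiMeasurePreserving.ae (hT ξ)] with g h1 h2 h3
  rw [h1, h2, h3, ← integral_mul_left_eq_self (fun h => K (u * g) h * ξ h) u]
  refine integral_congr_ae ?_
  filter_upwards [leftTranslation_coeFn u ξ] with k hk
  rw [hk, h]

end Convolution

variable {P : Submonoid G} [IsContinuousOre P] {X : Type*} [MulAction Pᵐᵒᵖ X] [TopologicalSpace X]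
  [ContinuousSMul Pᵐᵒᵖ X] [CompactSpace X] [T2Space X]
  (inj : ∀ a : P, Function.Injective fun x : X => x <• a)

omit [IsTopologicalGroup G] [TopologicalSpace X] [ContinuousSMul Pᵐᵒᵖ X] [CompactSpace X]
  [T2Space X] in
theorem range_toProd : Set.range (Arrows.toProd (X := X) P) = {p | p.2 ∈ fractionSet P p.1} := by
  ext ⟨x, g⟩
  constructor
  · rintro ⟨γ, h⟩
    obtain ⟨rfl, rfl⟩ := Prod.mk.inj h
    exact ⟨γ.src, γ.hom.2⟩
  · rintro ⟨y, hy⟩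
    exact ⟨Arrows.mk (C := UnitSpace X P) (rng := x) (src := y) ⟨g, hy⟩, rfl⟩

include inj in
theorem isClosedEmbedding_toProd :
    Topology.IsClosedEmbedding (Arrows.toProd (X := X) P) := by
  refine ⟨⟨⟨rfl⟩, ?_⟩, ?_⟩
  · rintro ⟨⟨g, hg⟩⟩ ⟨⟨h, hh⟩⟩ h'
    obtain ⟨rfl, rfl⟩ := Prod.mk.inj h'
    obtain rfl := IsArrow.unique inj hg hh
    rfl
  · rw [range_toProd]
    exact isClosed_arrows inj

include inj in
/-- By the Tietze extension theorem, functions in `C_c(X ⋊ P)` extend to `C_c(X × G)`. -/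
theorem exists_extension_arrows [LocallyCompactSpace G] [T2Space G] [SecondCountableTopology G]
    [SecondCountableTopology X] (f : C_c(Arrows (UnitSpace X P), ℂ)) :
    ∃ F : C(X × G, ℂ), HasCompactSupport F ∧ ∀ γ, f γ = F (Arrows.toProd P γ) := by
  have he := isClosedEmbedding_toProd inj
  obtain ⟨F₀, hF₀⟩ := f.toContinuousMap.exists_extension' he
  have hK : IsCompact ((fun γ => (Arrows.toProd P γ).2) '' tsupport f) :=
    f.hasCompactSupport.isCompact.image (continuous_snd.comp he.continuous)
  obtain ⟨χ, hχ1, -, hχ, -⟩ :=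
    exists_continuous_one_zero_of_isCompact hK isClosed_empty (Set.disjoint_empty _)
  refine ⟨F₀ * ⟨fun p => (χ p.2 : ℂ), by fun_prop⟩, ?_, fun γ => ?_⟩
  · refine HasCompactSupport.intro (isCompact_univ.prod hχ.isCompact) fun p hp => ?_
    have h1 : p.2 ∉ tsupport χ := fun h => hp ⟨Set.mem_univ _, h⟩
    simp [image_eq_zero_of_notMem_tsupport h1]
  · have h1 : F₀ (Arrows.toProd P γ) = f γ := congrFun hF₀ γ
    by_cases hγ : γ ∈ tsupport f
    · have h2 : χ (Arrows.toProd P γ).2 = 1 := hχ1 ⟨γ, hγ, rfl⟩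
      simp [h1, h2]
    · simp [h1, image_eq_zero_of_notMem_tsupport hγ]

/-- A continuous function on `X × G` as a continuous function `G → C(X)`. -/
noncomputable def sliceMap (F : C(X × G, ℂ)) : C(G, C(X, ℂ)) :=
  (F.comp ContinuousMap.prodSwap).curry

omit [Group G] [IsTopologicalGroup G] [CompactSpace X] [T2Space X] in
@[simp]
theorem sliceMap_apply (F : C(X × G, ℂ)) (g : G) (x : X) : sliceMap F g x = F (x, g) := rfl

omit [Group G] [IsTopologicalGroup G] [CompactSpace X] [T2Space X] in
theorem hasCompactSupport_sliceMap [R1Space G] {F : C(X × G, ℂ)} (hF : HasCompactSupport F) :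
    HasCompactSupport (sliceMap F) := by
  refine HasCompactSupport.intro (hF.isCompact.image continuous_snd) fun g hg => ?_
  ext x
  change F (x, g) = 0
  exact image_eq_zero_of_notMem_tsupport fun h => hg ⟨(x, g), h, rfl⟩

omit [IsTopologicalGroup G] [ContinuousSMul Pᵐᵒᵖ X] [T2Space X] [IsContinuousOre P] in
theorem enorm_fibreKernel_le (F : C(X × G, ℂ)) (x : X) (g h : G) :
    ‖fibreKernel (P := P) F x g h‖ₑ ≤ ‖sliceMap F (g⁻¹ * h)‖ₑ := by
  rw [fibreKernel]
  split_ifs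
  · rw [enorm_le_iff_norm_le]
    exact (sliceMap F (g⁻¹ * h)).norm_coe_le_norm _
  · simp

include inj in
theorem measurable_fibreKernel [SecondCountableTopology G] [MeasurableSpace G] [BorelSpace G]
    (F : C(X × G, ℂ)) (x : X) : Measurable (Function.uncurry (fibreKernel (P := P) F x)) := by
  classical
  have h1 : Function.uncurry (fibreKernel (P := P) F x)
      = (fractionSet P x ×ˢ fractionSet P x).piecewise
        (fun p => F (arrowSource P x p.1, p.1⁻¹ * p.2)) (fun _ => 0) := by
    ext p
    simp only [Function.uncurry, fibreKernel, Set.piecewise, Set.mem_prod]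
  have hc := isClosed_fractionSet inj x
  rw [h1]
  refine ContinuousOn.measurable_piecewise ?_ continuousOn_const (hc.prod hc).measurableSet
  refine F.continuous.comp_continuousOn (ContinuousOn.prodMk ?_ (by fun_prop))
  exact (continuousOn_arrowSource inj).comp (f := fun p : G × G => (x, p.1)) (by fun_prop)
    fun p hp => hp.1

include inj in
/-- The kernel at `(g, h)` is continuous in `x` unless `g` or `h` lies on the moving boundary of
`Q_x`, which happens only on a null set by `ae_eventually_mem_fractionSet_iff`. -/
theorem continuousAt_fibreKernel (F : C(X × G, ℂ)) {x : X} {g h : G}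
    (hg : ∀ᶠ x' in nhds x, g ∈ fractionSet P x' ↔ g ∈ fractionSet P x)
    (hh : ∀ᶠ x' in nhds x, h ∈ fractionSet P x' ↔ h ∈ fractionSet P x) :
    ContinuousAt (fun x' => fibreKernel (P := P) F x' g h) x := by
  by_cases hgh : g ∈ fractionSet P x ∧ h ∈ fractionSet P x
  · have h1 : Filter.Tendsto (fun x' => arrowSource P x' g) (nhds x)
        (nhds (arrowSource P x g)) := by
      have h2 := continuousOn_arrowSource inj (x, g) hgh.1
      refine h2.tendsto.comp (tendsto_nhdsWithin_iff.2
        ⟨(Continuous.prodMk_left g).continuousAt.tendsto, ?_⟩)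
      filter_upwards [hg] with x' hx'
      exact hx'.2 hgh.1
    have h3 : Filter.Tendsto (fun x' => F (arrowSource P x' g, g⁻¹ * h)) (nhds x)
        (nhds (F (arrowSource P x g, g⁻¹ * h))) :=
      F.continuous.continuousAt.tendsto.comp (h1.prodMk_nhds tendsto_const_nhds)
    have h4 : fibreKernel (P := P) F x g h = F (arrowSource P x g, g⁻¹ * h) := if_pos hgh
    rw [ContinuousAt, h4]
    refine h3.congr' ?_
    filter_upwards [hg, hh] with x' hx' hx''
    exact (if_pos ⟨hx'.2 hgh.1, hx''.2 hgh.2⟩).symm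
  · have h4 : fibreKernel (P := P) F x g h = 0 := if_neg hgh
    rw [ContinuousAt, h4]
    refine tendsto_const_nhds.congr' ?_
    filter_upwards [hg, hh] with x' hx' hx''
    rw [← hx', ← hx''] at hgh
    exact (if_neg hgh).symm

omit [IsTopologicalGroup G] [TopologicalSpace X] [ContinuousSMul Pᵐᵒᵖ X] [CompactSpace X]
  [T2Space X] in
include inj in
/-- Left invariance of the Haar system, on the level of kernels. -/
theorem fibreKernel_mul_left (F : X × G → ℂ) {x y : X} {u : G} (hu : IsArrow P x u y) (g h : G) :
    fibreKernel (P := P) F y g h = fibreKernel (P := P) F x (u * g) (u * h) := by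
  by_cases hgh : g ∈ fractionSet P y ∧ h ∈ fractionSet P y
  · have hgh' : u * g ∈ fractionSet P x ∧ u * h ∈ fractionSet P x := by
      rwa [hu.mul_mem_fractionSet_iff, hu.mul_mem_fractionSet_iff]
    have h1 := (hu.mul (isArrow_arrowSource hgh.1)).arrowSource_eq inj
    rw [fibreKernel, if_pos hgh, fibreKernel, if_pos hgh', h1, mul_inv_rev, mul_assoc,
      inv_mul_cancel_left]
  · have hgh' : ¬(u * g ∈ fractionSet P x ∧ u * h ∈ fractionSet P x) := by
      rwa [hu.mul_mem_fractionSet_iff, hu.mul_mem_fractionSet_iff]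
    rw [fibreKernel, if_neg hgh, fibreKernel, if_neg hgh']

end Kernel

/-! ### The norm of the reduced C*-algebra is the norm of one regular representation -/

section Families

variable {ι : Type*} {H : ι → Type*} [∀ i, NormedAddCommGroup (H i)]
  [∀ i, InnerProductSpace ℂ (H i)] [∀ i, CompleteSpace (H i)]

namespace OperatorFamilies

theorem coord_add (S T : OperatorFamilies H) (i : ι) : (S + T).coord i = S.coord i + T.coord i :=
  rfl

theorem coord_mul (S T : OperatorFamilies H) (i : ι) : (S * T).coord i = S.coord i * T.coord i :=
  rfl

theorem coord_smul (c : ℂ) (T : OperatorFamilies H) (i : ι) : (c • T).coord i = c • T.coord i :=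
  rfl

theorem coord_zero (i : ι) : (0 : OperatorFamilies H).coord i = 0 :=
  rfl

theorem coord_star (T : OperatorFamilies H) (i : ι) : (star T).coord i = star (T.coord i) :=
  rfl

theorem norm_coord_le (T : OperatorFamilies H) (i : ι) : ‖T.coord i‖ ≤ ‖T‖ :=
  lp.norm_apply_le_norm (E := fun i => H i →L[ℂ] H i) ENNReal.top_ne_zero T i

theorem norm_le_of_forall_coord_le (T : OperatorFamilies H) {C : ℝ} (hC : 0 ≤ C)
    (h : ∀ i, ‖T.coord i‖ ≤ C) : ‖T‖ ≤ C :=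
  lp.norm_le_of_forall_le (E := fun i => H i →L[ℂ] H i) hC h

theorem exists_coord_eq (T : ∀ i, H i →L[ℂ] H i) {C : ℝ} (h : ∀ i, ‖T i‖ ≤ C) :
    ∃ S : OperatorFamilies H, ∀ i, S.coord i = T i :=
  ⟨(⟨T, memℓp_infty ⟨C, by rintro _ ⟨i, rfl⟩; exact h i⟩⟩ : lp (fun i => H i →L[ℂ] H i) ∞),
    fun _ => rfl⟩

/-- The representation `T ↦ R* T_i R` on `K` of families of operators, for a coisometry
`R : K → H i`. -/
noncomputable def conjCoord {K : Type*} [NormedAddCommGroup K] [InnerProductSpace ℂ K]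
    [CompleteSpace K] {i : ι} (R : K →L[ℂ] H i)
    (hR : ∀ η, R (ContinuousLinearMap.adjoint R η) = η) :
    OperatorFamilies H →⋆ₙₐ[ℂ] (K →L[ℂ] K) where
  toFun T := ContinuousLinearMap.adjoint R ∘L T.coord i ∘L R
  map_smul' c T := by
    rw [coord_smul, ContinuousLinearMap.smul_comp, ContinuousLinearMap.comp_smul]
    rfl
  map_zero' := by
    rw [coord_zero, ContinuousLinearMap.zero_comp, ContinuousLinearMap.comp_zero]
  map_add' S T := by
    rw [coord_add, ContinuousLinearMap.add_comp, ContinuousLinearMap.comp_add]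
  map_mul' S T := by
    ext ξ
    simp [coord_mul, hR]
  map_star' T := by
    rw [coord_star, ContinuousLinearMap.star_eq_adjoint, ContinuousLinearMap.star_eq_adjoint,
      ContinuousLinearMap.adjoint_comp, ContinuousLinearMap.adjoint_comp,
      ContinuousLinearMap.adjoint_adjoint, ContinuousLinearMap.comp_assoc]

variable {K : Type*} [NormedAddCommGroup K] [InnerProductSpace ℂ K] [CompleteSpace K] {i : ι}
  {R : K →L[ℂ] H i} (hR : ∀ η, R (ContinuousLinearMap.adjoint R η) = η)

theorem conjCoord_apply (T : OperatorFamilies H) (ξ : K) :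
    conjCoord R hR T ξ = ContinuousLinearMap.adjoint R (T.coord i (R ξ)) := rfl

theorem norm_coord_le_norm_conjCoord (hR1 : ‖R‖ ≤ 1) (T : OperatorFamilies H) :
    ‖T.coord i‖ ≤ ‖conjCoord R hR T‖ := by
  refine ContinuousLinearMap.opNorm_le_bound _ (norm_nonneg _) fun η => ?_
  have hR2 : ‖ContinuousLinearMap.adjoint R‖ ≤ 1 := by rwa [LinearIsometryEquiv.norm_map]
  have h1 : T.coord i η = R (conjCoord R hR T (ContinuousLinearMap.adjoint R η)) := by
    rw [conjCoord_apply, hR, hR]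
  rw [h1]
  calc _ ≤ 1 * ‖conjCoord R hR T (ContinuousLinearMap.adjoint R η)‖ := R.le_of_opNorm_le hR1 _
    _ ≤ 1 * (‖conjCoord R hR T‖ * ‖ContinuousLinearMap.adjoint R η‖) := by
        gcongr; exact ContinuousLinearMap.le_opNorm _ _
    _ ≤ 1 * (‖conjCoord R hR T‖ * (1 * ‖η‖)) := by
        gcongr; exact ContinuousLinearMap.le_of_opNorm_le _ hR2 _
    _ = _ := by ring

theorem norm_conjCoord_le (hR1 : ‖R‖ ≤ 1) (T : OperatorFamilies H) :
    ‖conjCoord R hR T‖ ≤ ‖T.coord i‖ := by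
  refine ContinuousLinearMap.opNorm_le_bound _ (norm_nonneg _) fun η => ?_
  have hR2 : ‖ContinuousLinearMap.adjoint R‖ ≤ 1 := by rwa [LinearIsometryEquiv.norm_map]
  rw [conjCoord_apply]
  calc _ ≤ 1 * ‖T.coord i (R η)‖ := ContinuousLinearMap.le_of_opNorm_le _ hR2 _
    _ ≤ 1 * (‖T.coord i‖ * (1 * ‖η‖)) := by
        gcongr
        exact (ContinuousLinearMap.le_opNorm _ _).trans
          (by gcongr; exact ContinuousLinearMap.le_of_opNorm_le _ hR1 _)
    _ = _ := by ring

end OperatorFamilies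

end Families

section Isometry

variable {G : Type*} [Group G] [TopologicalSpace G] [IsTopologicalGroup G] [LocallyCompactSpace G]
  [T2Space G] [SecondCountableTopology G] [MeasurableSpace G] [BorelSpace G]
  {μ : Measure G} [μ.IsHaarMeasure] {P : Submonoid G} [IsContinuousOre P]
  {X : Type*} [TopologicalSpace X] [CompactSpace X] [T2Space X] [SecondCountableTopology X]
  [MulAction Pᵐᵒᵖ X] [ContinuousSMul Pᵐᵒᵖ X]
  (inj : ∀ a : P, Function.Injective fun x : X => x <• a)

variable (μ) in
/-- The representation `T ↦ T_x ⊕ 0` of families of operators on `L²(G)`. -/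
noncomputable def extendHom (x : UnitSpace X P) :
    OperatorFamilies (FibreL2 (semidirectHaar (X := X) P μ)) →⋆ₙₐ[ℂ]
      (Lp ℂ 2 μ →L[ℂ] Lp ℂ 2 μ) :=
  OperatorFamilies.conjCoord (fibreRestrict μ inj x) (fibreRestrict_adjoint inj x)

omit [LocallyCompactSpace G] [T2Space G] [SecondCountableTopology G] [μ.IsHaarMeasure]
  [SecondCountableTopology X] in
theorem hasKernel_extendHom {f : C_c(Arrows (UnitSpace X P), ℂ)}
    {T : OperatorFamilies (FibreL2 (semidirectHaar (X := X) P μ))}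
    (hT : IsRegularRep (semidirectHaar (X := X) P μ) f T) {F : X × G → ℂ}
    (hF : ∀ γ, f γ = F (Arrows.toProd P γ)) (x : UnitSpace X P) :
    HasKernel μ (fibreKernel (P := P) F x) (extendHom μ inj x T) :=
  hasKernel_adjoint_fibreRestrict_comp inj hT hF x

omit [LocallyCompactSpace G] [T2Space G] [SecondCountableTopology G] [μ.IsHaarMeasure]
  [SecondCountableTopology X] in
theorem norm_extendHom_le (x : UnitSpace X P)
    (T : OperatorFamilies (FibreL2 (semidirectHaar (X := X) P μ))) :
    ‖extendHom μ inj x T‖ ≤ ‖T‖ :=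
  (OperatorFamilies.norm_conjCoord_le _ (norm_fibreRestrict_le inj x) T).trans
    (T.norm_coord_le x)

omit [LocallyCompactSpace G] [T2Space G] [SecondCountableTopology G] [μ.IsHaarMeasure]
  [SecondCountableTopology X] in
theorem norm_coord_le_norm_extendHom (x : UnitSpace X P)
    (T : OperatorFamilies (FibreL2 (semidirectHaar (X := X) P μ))) :
    ‖T.coord x‖ ≤ ‖extendHom μ inj x T‖ :=
  OperatorFamilies.norm_coord_le_norm_conjCoord _ (norm_fibreRestrict_le inj x) T

/-- The properties of the families `(Ind δₓ (f))ₓ` that survive in the *-algebra generated by them: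
the extensions to `L²(G)` and their adjoints depend strongly continuously on `x`, and those over the
points of the orbit of `x₀` are conjugate by translations. -/
structure IsContinuousInvariant (x₀ : X)
    (T : OperatorFamilies (FibreL2 (semidirectHaar (X := X) P μ))) : Prop where
  continuous : ∀ ξ, Continuous fun x : X => extendHom μ inj x T ξ
  comp_left : ∀ (a : P) (ξ : Lp ℂ 2 μ), extendHom μ inj (x₀ <• a : X) T
    (leftTranslation μ (a : G) ξ) = leftTranslation μ (a : G) (extendHom μ inj x₀ T ξ)

variable {inj} {x₀ : X}

omit [LocallyCompactSpace G] [T2Space G] [SecondCountableTopology G] [SecondCountableTopology X] in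
theorem IsContinuousInvariant.add
    {S T : OperatorFamilies (FibreL2 (semidirectHaar (X := X) P μ))}
    (hS : IsContinuousInvariant inj x₀ S) (hT : IsContinuousInvariant inj x₀ T) :
    IsContinuousInvariant inj x₀ (S + T) where
  continuous ξ := by
    simp only [map_add, _root_.add_apply]
    exact (hS.continuous ξ).add (hT.continuous ξ)
  comp_left a ξ := by
    simp only [map_add, _root_.add_apply, hS.comp_left, hT.comp_left]

omit [LocallyCompactSpace G] [T2Space G] [SecondCountableTopology G] [SecondCountableTopology X] in
theorem IsContinuousInvariant.smul {T : OperatorFamilies (FibreL2 (semidirectHaar (X := X) P μ))}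
    (hT : IsContinuousInvariant inj x₀ T) (c : ℂ) : IsContinuousInvariant inj x₀ (c • T) where
  continuous ξ := by
    simp only [map_smul, _root_.smul_apply]
    exact (hT.continuous ξ).const_smul c
  comp_left a ξ := by
    simp only [map_smul, _root_.smul_apply, hT.comp_left]

omit [LocallyCompactSpace G] [T2Space G] [SecondCountableTopology G] [SecondCountableTopology X] in
theorem IsContinuousInvariant.zero : IsContinuousInvariant (μ := μ) inj x₀ 0 where
  continuous ξ := by
    simp only [map_zero, _root_.zero_apply]
    exact continuous_const
  comp_left a ξ := by
    simp only [map_zero, _root_.zero_apply]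

omit [LocallyCompactSpace G] [T2Space G] [SecondCountableTopology G] [SecondCountableTopology X] in
theorem IsContinuousInvariant.mul
    {S T : OperatorFamilies (FibreL2 (semidirectHaar (X := X) P μ))}
    (hS : IsContinuousInvariant inj x₀ S) (hT : IsContinuousInvariant inj x₀ T) :
    IsContinuousInvariant inj x₀ (S * T) where
  continuous ξ := by
    refine continuous_iff_continuousAt.2 fun y => ?_
    simp only [map_mul, mul_apply_eq_comp]
    rw [ContinuousAt, tendsto_iff_norm_sub_tendsto_zero]
    have h1 := tendsto_iff_norm_sub_tendsto_zero.1 ((hT.continuous ξ).tendsto y)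
    have h2 := tendsto_iff_norm_sub_tendsto_zero.1
      ((hS.continuous (extendHom μ inj y T ξ)).tendsto y)
    refine squeeze_zero (fun _ => norm_nonneg _) (fun x => ?_)
      (by simpa using (h1.const_mul ‖S‖).add h2)
    have h3 := (extendHom μ inj x S).le_of_opNorm_le
      (norm_extendHom_le inj x S)
      (extendHom μ inj x T ξ - extendHom μ inj y T ξ)
    rw [map_sub] at h3
    refine le_trans ?_ (add_le_add_left h3 _)
    exact norm_sub_le_norm_sub_add_norm_sub _ _ _
  comp_left a ξ := by
    simp only [map_mul, mul_apply_eq_comp, hS.comp_left, hT.comp_left]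

theorem isContinuousInvariant_of_isRegularRep
    (hopen : IsOpenMap fun p : X × {a : P // (a : G) ∈ interior (P : Set G)} => p.1 <• p.2.1)
    {f : C_c(Arrows (UnitSpace X P), ℂ)}
    {T : OperatorFamilies (FibreL2 (semidirectHaar (X := X) P μ))}
    (hT : IsRegularRep (semidirectHaar (X := X) P μ) f T) :
    IsContinuousInvariant inj x₀ T ∧ IsContinuousInvariant inj x₀ (star T) := by
  obtain ⟨F, hFc, hF⟩ := exists_extension_arrows inj f
  obtain ⟨C, hC⟩ := exists_isSchurKernel μ (sliceMap F).continuous (hasCompactSupport_sliceMap hFc)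
  have hm : ∀ x : X, Measurable (Function.uncurry (fibreKernel (P := P) F x)) := fun x =>
    measurable_fibreKernel inj F x
  have hle : ∀ (x : X) (g h : G), ‖fibreKernel (P := P) F x g h‖ₑ ≤ ‖sliceMap F (g⁻¹ * h)‖ₑ :=
    fun x => enorm_fibreKernel_le F x
  have hk : ∀ x : X, HasKernel μ (fibreKernel (P := P) F x) (extendHom μ inj x T) := fun x =>
    hasKernel_extendHom inj hT hF x
  have hk' : ∀ x : X, HasKernel μ (fun g h => starRingEnd ℂ (fibreKernel (P := P) F x h g))
      (extendHom μ inj x (star T)) := fun x => by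
    rw [map_star]
    exact (hk x).adjoint (hm x) hC (hle x)
  have hinv : ∀ (a : P) (g h : G), fibreKernel (P := P) F (x₀ <• a) g h
      = fibreKernel (P := P) F x₀ (a * g) (a * h) := fun a g h =>
    fibreKernel_mul_left inj F (by simpa using isArrow_act x₀ a.2) g h
  have hae := ae_eventually_mem_fractionSet_iff μ inj hopen
  refine ⟨⟨fun ξ => continuous_iff_continuousAt.2 fun x => ?_, fun a ξ => ?_⟩,
    ⟨fun ξ => continuous_iff_continuousAt.2 fun x => ?_, fun a ξ => ?_⟩⟩
  · exact continuousAt_of_hasKernel hm hC hle hk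
      (by filter_upwards [hae x] with g hg
          filter_upwards [hae x] with h hh
          exact continuousAt_fibreKernel inj F hg hh) ξ
  · exact (hk _).comp_leftTranslation (hk _) (hinv a) ξ
  · have hm' : ∀ x : X, Measurable (Function.uncurry fun g h =>
        starRingEnd ℂ (fibreKernel (P := P) F x h g)) := fun x =>
      Complex.continuous_conj.measurable.comp ((hm x).comp measurable_swap)
    refine continuousAt_of_hasKernel hm' hC.swap (fun x g h => ?_) hk' ?_ ξ
    · rw [RCLike.enorm_conj]
      exact hle x h g
    · filter_upwards [hae x] with g hg
      filter_upwards [hae x] with h hh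
      exact Complex.continuous_conj.continuousAt.comp (continuousAt_fibreKernel inj F hh hg)
  · exact (hk' _).comp_leftTranslation (hk' _) (fun g h => by rw [hinv]) ξ

omit [LocallyCompactSpace G] [T2Space G] [SecondCountableTopology G] [SecondCountableTopology X] in
theorem IsContinuousInvariant.norm_extendHom_le (hd : Dense {x : X | ∃ a : P, x = x₀ <• a})
    {T : OperatorFamilies (FibreL2 (semidirectHaar (X := X) P μ))}
    (hT : IsContinuousInvariant inj x₀ T) (x : UnitSpace X P) :
    ‖extendHom μ inj x T‖ ≤ ‖extendHom μ inj x₀ T‖ := by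
  refine ContinuousLinearMap.opNorm_le_bound _ (norm_nonneg _) fun ξ => ?_
  have hcl : IsClosed {x : X | ‖extendHom μ inj x T ξ‖ ≤ ‖extendHom μ inj x₀ T‖ * ‖ξ‖} :=
    isClosed_le (hT.continuous ξ).norm continuous_const
  refine hcl.closure_subset_iff.2 ?_ (hd x)
  rintro _ ⟨a, rfl⟩
  have h1 := hT.comp_left a (leftTranslation μ (a : G)⁻¹ ξ)
  rw [leftTranslation_inv] at h1
  refine (congrArg norm h1).trans_le ?_
  rw [LinearIsometry.norm_map]
  refine (ContinuousLinearMap.le_opNorm _ _).trans_eq ?_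
  rw [LinearIsometry.norm_map]

variable (inj) in
include inj in
/-- The regular representation over a point with dense orbit is isometric. -/
theorem norm_le_norm_coord_of_mem_reducedCStarAlgebra
    (hopen : IsOpenMap fun p : X × {a : P // (a : G) ∈ interior (P : Set G)} => p.1 <• p.2.1)
    (hd : Dense {x : X | ∃ a : P, x = x₀ <• a})
    {T : OperatorFamilies (FibreL2 (semidirectHaar (X := X) P μ))}
    (hT : T ∈ reducedCStarAlgebra (semidirectHaar (X := X) P μ)) :
    ‖T‖ ≤ ‖T.coord (unitOf P x₀)‖ := by
  refine le_trans ?_ (OperatorFamilies.norm_conjCoord_le (fibreRestrict_adjoint inj (unitOf P x₀))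
    (norm_fibreRestrict_le inj _) T)
  change ‖T‖ ≤ ‖extendHom μ inj x₀ T‖
  have hcont : ∀ x : UnitSpace X P, Continuous fun T => ‖extendHom μ inj x T‖ := fun x =>
    (AddMonoidHomClass.continuous_of_bound (extendHom μ inj x) 1 fun T => by
      rw [one_mul]; exact norm_extendHom_le inj x T).norm
  have hcl : IsClosed {T : OperatorFamilies (FibreL2 (semidirectHaar (X := X) P μ)) |
      ‖T‖ ≤ ‖extendHom μ inj x₀ T‖} := isClosed_le continuous_norm (hcont x₀)
  refine hcl.closure_subset_iff.2 (fun T hT => ?_) hT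
  have hT' : IsContinuousInvariant inj x₀ T ∧ IsContinuousInvariant inj x₀ (star T) := by
    refine NonUnitalStarAlgebra.adjoin_induction (R := ℂ)
      (p := fun T _ => IsContinuousInvariant inj x₀ T ∧ IsContinuousInvariant inj x₀ (star T))
      ?_ ?_ ?_ ?_ ?_ ?_ hT
    · rintro T ⟨f, hf⟩
      exact isContinuousInvariant_of_isRegularRep hopen hf
    · rintro S T - - ⟨h1, h2⟩ ⟨h3, h4⟩
      exact ⟨h1.add h3, by rw [star_add]; exact h2.add h4⟩
    · exact ⟨.zero, by rw [star_zero]; exact .zero⟩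
    · rintro S T - - ⟨h1, h2⟩ ⟨h3, h4⟩
      exact ⟨h1.mul h3, by rw [star_mul]; exact h4.mul h2⟩
    · rintro c T - ⟨h1, h2⟩
      exact ⟨h1.smul c, by rw [star_smul]; exact h2.smul _⟩
    · rintro T - ⟨h1, h2⟩
      exact ⟨h2, by rwa [star_star]⟩
  exact T.norm_le_of_forall_coord_le (norm_nonneg _) fun x =>
    (norm_coord_le_norm_extendHom inj x T).trans (hT'.1.norm_extendHom_le hd x)

variable (inj) in
omit [T2Space G] [SecondCountableTopology X] in
include inj in
/-- Every function `φ ∈ C_c(G)`, as a function `(x, g) ↦ φ(g)` on `X ⋊ P`, is represented by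
bounded operators. -/
theorem exists_isRegularRep {φ : G → ℂ} (hφ : Continuous φ) (hφ' : HasCompactSupport φ)
    {f : C_c(Arrows (UnitSpace X P), ℂ)} (hf : ∀ γ, f γ = φ (Arrows.toProd P γ).2) :
    ∃ T, IsRegularRep (semidirectHaar (X := X) P μ) f T := by
  obtain ⟨C, hC⟩ := exists_isSchurKernel μ hφ hφ'
  obtain ⟨S, -, hS⟩ := exists_hasKernel (K := fun g h => φ (g⁻¹ * h))
    (by
      have h : Continuous fun p : G × G => φ (p.1⁻¹ * p.2) := by fun_prop
      exact h.measurable) hC fun _ _ => le_rfl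
  obtain ⟨T, hT⟩ := OperatorFamilies.exists_coord_eq
    (H := FibreL2 (semidirectHaar (X := X) P μ)) (C := ‖S‖)
    (fun x => fibreRestrict μ inj x ∘L S ∘L ContinuousLinearMap.adjoint (fibreRestrict μ inj x))
    (fun x => by
      have h1 := norm_fibreRestrict_le (μ := μ) inj x
      have h2 : ‖ContinuousLinearMap.adjoint (fibreRestrict μ inj x)‖ ≤ 1 := by
        rwa [LinearIsometryEquiv.norm_map]
      calc _ ≤ ‖fibreRestrict μ inj x‖ * (‖S‖
              * ‖ContinuousLinearMap.adjoint (fibreRestrict μ inj x)‖) :=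
            (ContinuousLinearMap.opNorm_comp_le _ _).trans
              (by gcongr; exact ContinuousLinearMap.opNorm_comp_le _ _)
        _ ≤ 1 * (‖S‖ * 1) := by gcongr
        _ = ‖S‖ := by ring)
  refine ⟨T, fun x ξ => ?_⟩
  rw [hT]
  have he := measurableEmbedding_fibreCoord inj x
  set ζ := ContinuousLinearMap.adjoint (fibreRestrict μ inj x) ξ with hζ
  filter_upwards [fibreRestrict_fn inj x (S ζ), he.ae_comap_of_ae (hS ζ)] with γ h2 h3
  refine h2.trans (h3.trans ?_)
  have h4 : ∫ h, φ ((fibreCoord x γ)⁻¹ * h) * ζ h ∂μ = ∫ h, φ ((fibreCoord x γ)⁻¹ * h)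
      * Function.extend (fibreCoord x) ξ.fn 0 h ∂μ := by
    refine integral_congr_ae ?_
    filter_upwards [adjoint_fibreRestrict_coeFn inj x ξ] with h hh
    rw [hζ, hh]
  rw [h4, he.integral_mul_extend]
  refine integral_congr_ae (.of_forall fun η => ?_)
  beta_reduce
  rw [hf]
  rfl

end Isometry

/-! ### Wiener-Hopf operators -/

section Modular

variable {G : Type*} [Group G] [TopologicalSpace G] [IsTopologicalGroup G] [LocallyCompactSpace G]
  [SecondCountableTopology G] [MeasurableSpace G] [BorelSpace G]

omit [SecondCountableTopology G] [MeasurableSpace G] [BorelSpace G] in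
theorem modularFun_mul (g h : G) : modularFun (g * h) = modularFun g * modularFun h := by
  rw [modularFun, modularFun, modularFun, mul_inv_rev, map_mul, mul_comm]

/-- `Δ(g)⁻¹ ∫ f = ∫ f(x g) dx`, and the right side is continuous in `g` if `f` is continuous
with compact support. -/
theorem continuous_modularFun : Continuous (modularFun : G → ℝ≥0) := by
  obtain ⟨f, hf, hf0, hf1⟩ : ∃ f : C(G, ℝ), HasCompactSupport f ∧ 0 ≤ f ∧ f 1 ≠ 0 :=
    exists_continuous_nonneg_pos 1
  let ν : Measure G := (haar : Measure G).inv
  have h1 : Continuous fun g => ∫ x, f (x⁻¹ * g) ∂ν := by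
    have : IsFiniteMeasureOnCompacts ν := ⟨fun K hK => by
      rw [Measure.inv_apply]; exact hK.inv.measure_lt_top⟩
    exact continuous_integral_apply_inv_mul f.continuous hf
  have h2 : ∀ g, ∫ x, f (x⁻¹ * g) ∂ν = ((modularFun g)⁻¹ : ℝ≥0) * ∫ x, f x ∂(haar : Measure G) := by
    intro g
    have h3 : ∫ x, f (x⁻¹ * g) ∂ν = ∫ x, f (x * g) ∂(haar : Measure G) := by
      refine ((MeasurableEquiv.inv G).measurableEmbedding.integral_map
        (μ := (haar : Measure G)) fun x => f (x⁻¹ * g)).trans ?_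
      simp
    rw [h3, ← (measurableEmbedding_mulRight g).integral_map (g := f), map_mul_right_haar,
      integral_smul_nnreal_measure]
    rfl
  have hpos : 0 < ∫ x, f x ∂(haar : Measure G) :=
    f.continuous.integral_pos_of_hasCompactSupport_nonneg_nonzero hf hf0 hf1
  have h4 : ∀ g : G, (modularFun g : ℝ)
      = ((∫ x, f (x⁻¹ * g) ∂ν) / ∫ x, f x ∂(haar : Measure G))⁻¹ := fun g => by
    rw [h2, mul_div_cancel_right₀ _ hpos.ne']
    simp
  refine NNReal.isEmbedding_coe.continuous_iff.2 ?_
  change Continuous fun g : G => (modularFun g : ℝ)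
  rw [show (fun g : G => (modularFun g : ℝ)) = _ from funext h4]
  refine (h1.div_const _).inv₀ fun g => ?_
  rw [h2, mul_div_cancel_right₀ _ hpos.ne']
  have := modularFun_pos g
  positivity

/-- The factor `Δ(g)^{1/2}` of the right regular representation. -/
noncomputable def sqrtModular (g : G) : ℂ := (((modularFun g : ℝ) ^ (1 / 2 : ℝ) : ℝ) : ℂ)

omit [SecondCountableTopology G] [MeasurableSpace G] [BorelSpace G] in
theorem sqrtModular_mul (g h : G) : sqrtModular (g * h) = sqrtModular g * sqrtModular h := by
  simp only [sqrtModular, modularFun_mul, NNReal.coe_mul]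
  rw [Real.mul_rpow (NNReal.coe_nonneg _) (NNReal.coe_nonneg _), Complex.ofReal_mul]

omit [SecondCountableTopology G] [MeasurableSpace G] [BorelSpace G] in
theorem sqrtModular_ne_zero (g : G) : sqrtModular g ≠ 0 := by
  have h : (0 : ℝ) < modularFun g := modularFun_pos g
  exact Complex.ofReal_ne_zero.2 (Real.rpow_pos_of_pos h _).ne'

omit [SecondCountableTopology G] [MeasurableSpace G] [BorelSpace G] in
theorem sqrtModular_one : sqrtModular (1 : G) = 1 := by
  have h := sqrtModular_mul (1 : G) 1
  rw [mul_one] at h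
  exact mul_left_cancel₀ (sqrtModular_ne_zero (1 : G)) (by rw [← h, mul_one])

theorem continuous_sqrtModular : Continuous (sqrtModular : G → ℂ) := by
  refine Complex.continuous_ofReal.comp ?_
  exact (NNReal.continuous_coe.comp continuous_modularFun).rpow_const fun g => Or.inr (by norm_num)

end Modular

section Compression

variable {G : Type*} [Group G] [TopologicalSpace G] [IsTopologicalGroup G] [LocallyCompactSpace G]
  [SecondCountableTopology G] [MeasurableSpace G] [BorelSpace G] {μ : Measure G} [μ.IsHaarMeasure]
  {P : Submonoid G}

omit [TopologicalSpace G] [IsTopologicalGroup G] [LocallyCompactSpace G]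
  [SecondCountableTopology G] [BorelSpace G] [μ.IsHaarMeasure] in
theorem restrictL2_coeFn (ξ : Lp ℂ 2 μ) : restrictL2 μ P ξ =ᵐ[μ.restrict (P : Set G)] ξ :=
  LpToLpRestrictCLM_coeFn ℂ (P : Set G) ξ

theorem compression_coeFn (g : G) (ξ : L2Sub μ P) :
    compression μ P g ξ =ᵐ[μ.restrict (P : Set G)]
      fun x => sqrtModular g * extendL2 μ P ξ (x * g) := by
  refine (restrictL2_coeFn _).trans (ae_restrict_of_ae ?_)
  exact rightTranslation_coeFn μ g (extendL2 μ P ξ)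

theorem norm_compression_le (g : G) : ‖compression μ P g‖ ≤ 1 :=
  opNorm_le_of_norm_inner_le zero_le_one fun η ξ => by
    rw [one_mul]; exact norm_inner_compression_le μ P g η ξ

theorem rightTranslation_inv (g : G) (ξ : Lp ℂ 2 μ) :
    rightTranslation μ g (rightTranslation μ g⁻¹ ξ) = ξ := by
  ext1
  filter_upwards [rightTranslation_coeFn μ g (rightTranslation μ g⁻¹ ξ),
    (quasiMeasurePreserving_mul_right_haar μ g).ae (rightTranslation_coeFn μ g⁻¹ ξ)] with x h1 h2
  rw [h1, h2]
  change sqrtModular g * (sqrtModular g⁻¹ * _) = _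
  rw [← mul_assoc, ← sqrtModular_mul, mul_inv_cancel, sqrtModular_one, one_mul,
    mul_inv_cancel_right]

theorem inner_compression_left (g : G) (η ξ : L2Sub μ P) :
    inner ℂ (compression μ P g η) ξ = inner ℂ η (compression μ P g⁻¹ ξ) := by
  rw [← inner_conj_symm, inner_compression, inner_conj_symm, inner_compression,
    ← (rightTranslation μ g).inner_map_map (extendL2 μ P η), rightTranslation_inv]

/-- The projection `E U_h E U_h* E` of `L²(P)` onto `L²(P ∩ P h⁻¹)`. -/
noncomputable def rangeProj (μ : Measure G) [μ.IsHaarMeasure] (P : Submonoid G) (h : G) :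
    L2Sub μ P →L[ℂ] L2Sub μ P :=
  compression μ P h ∘L compression μ P h⁻¹

theorem compression_compression_coeFn (hP : MeasurableSet (P : Set G)) (h l : G) (ξ : L2Sub μ P) :
    compression μ P h (compression μ P (h⁻¹ * l) ξ) =ᵐ[μ.restrict (P : Set G)]
      fun x => (P : Set G).indicator 1 (x * h) * compression μ P l ξ x := by
  have hq := quasiMeasurePreserving_mul_right_haar μ h
  have h1 := hq.ae (extendL2_coeFn μ P hP (compression μ P (h⁻¹ * l) ξ))
  have h2 := hq.ae ((ae_restrict_iff' hP).1 (compression_coeFn (h⁻¹ * l) ξ))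
  filter_upwards [compression_coeFn h (compression μ P (h⁻¹ * l) ξ), compression_coeFn l ξ,
    ae_restrict_of_ae h1, ae_restrict_of_ae h2] with x h3 h4 h5 h6
  rw [h3, h4, h5]
  by_cases hx : x * h ∈ (P : Set G)
  · rw [Set.indicator_of_mem hx, Set.indicator_of_mem hx, h6 hx, ← mul_assoc, ← sqrtModular_mul,
      mul_inv_cancel_left, mul_assoc, mul_inv_cancel_left, Pi.one_apply, one_mul]
  · rw [Set.indicator_of_notMem hx, Set.indicator_of_notMem hx, mul_zero, zero_mul]

theorem compression_one (hP : MeasurableSet (P : Set G)) (ξ : L2Sub μ P) :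
    compression μ P 1 ξ = ξ := by
  ext1
  filter_upwards [compression_coeFn 1 ξ, ae_restrict_of_ae (extendL2_coeFn μ P hP ξ),
    ae_restrict_mem hP] with x h1 h2 h3
  rw [h1, mul_one, h2, Set.indicator_of_mem h3, sqrtModular_one, one_mul]

theorem rangeProj_coeFn (hP : MeasurableSet (P : Set G)) (h : G) (ξ : L2Sub μ P) :
    rangeProj μ P h ξ =ᵐ[μ.restrict (P : Set G)]
      fun x => (P : Set G).indicator 1 (x * h) * ξ x := by
  have h1 := compression_compression_coeFn hP h 1 ξ
  rwa [mul_one, compression_one hP] at h1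

theorem compression_compression (hP : MeasurableSet (P : Set G)) (h l : G) (ξ : L2Sub μ P) :
    compression μ P h (compression μ P (h⁻¹ * l) ξ) = rangeProj μ P h (compression μ P l ξ) := by
  ext1
  exact (compression_compression_coeFn hP h l ξ).trans (rangeProj_coeFn hP h _).symm

theorem eq_wienerHopf {T : L2Sub μ P →L[ℂ] L2Sub μ P} {f : G → ℂ} (hf : Integrable f μ)
    (h : ∀ η ξ, inner ℂ η (T ξ) = ∫ g, f g * inner ℂ η (compression μ P g ξ) ∂μ) :
    T = wienerHopf μ P f hf := by
  refine ContinuousLinearMap.ext fun ξ => ext_inner_left ℂ fun η => ?_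
  rw [h, inner_wienerHopf]

variable (μ P) in
/-- The map `f ↦ W_f` on `L¹(G)`. -/
noncomputable def wienerHopfL1 : Lp ℂ 1 μ →L[ℂ] (L2Sub μ P →L[ℂ] L2Sub μ P) :=
  LinearMap.mkContinuous
    { toFun := fun f => wienerHopf μ P f (L1.integrable_coeFn f)
      map_add' := fun f g => by
        refine (eq_wienerHopf _ fun η ξ => ?_).symm
        rw [_root_.add_apply, inner_add_right, inner_wienerHopf, inner_wienerHopf,
          ← integral_add (integrable_mul_inner_compression μ P (L1.integrable_coeFn f) _ _)
            (integrable_mul_inner_compression μ P (L1.integrable_coeFn g) _ _)]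
        refine integral_congr_ae ?_
        filter_upwards [Lp.coeFn_add f g] with x hx
        rw [hx, Pi.add_apply, add_mul]
      map_smul' := fun c f => by
        refine (eq_wienerHopf _ fun η ξ => ?_).symm
        rw [_root_.smul_apply, inner_smul_right, inner_wienerHopf, RingHom.id_apply,
          ← integral_const_mul]
        refine integral_congr_ae ?_
        filter_upwards [Lp.coeFn_smul c f] with x hx
        rw [hx, Pi.smul_apply, smul_eq_mul, mul_assoc] } 1
    fun f => by
      refine opNorm_le_of_norm_inner_le (by positivity) fun η ξ => ?_
      change ‖inner ℂ η (wienerHopf μ P f (L1.integrable_coeFn f) ξ)‖ ≤ _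
      rw [inner_wienerHopf, one_mul, L1.norm_eq_integral_norm, mul_assoc, ← integral_mul_const]
      refine norm_integral_le_of_norm_le ((L1.integrable_coeFn f).norm.mul_const _)
        (.of_forall fun g => ?_)
      rw [norm_mul]
      gcongr
      exact norm_inner_compression_le μ P g η ξ

theorem inner_wienerHopfL1 (f : Lp ℂ 1 μ) (η ξ : L2Sub μ P) :
    inner ℂ η (wienerHopfL1 μ P f ξ) = ∫ g, f g * inner ℂ η (compression μ P g ξ) ∂μ :=
  inner_wienerHopf μ P f (L1.integrable_coeFn f) η ξ

theorem wienerHopfL1_toL1 {f : G → ℂ} (hf : Integrable f μ) :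
    wienerHopfL1 μ P (hf.toL1 f) = wienerHopf μ P f hf :=
  eq_wienerHopf hf fun η ξ => by
    rw [inner_wienerHopfL1]
    refine integral_congr_ae ?_
    filter_upwards [hf.coeFn_toL1] with g hg
    rw [hg]

theorem wienerHopf_mem {f : G → ℂ} (hf : Integrable f μ) :
    wienerHopf μ P f hf ∈ wienerHopfAlgebra μ P :=
  NonUnitalStarSubalgebra.le_topologicalClosure _
    (NonUnitalStarAlgebra.subset_adjoin ℂ _ ⟨f, hf, rfl⟩)

/-- `W_f* = W_{f*}`, where `f*(g) = Δ(g)⁻¹ conj f(g⁻¹)`; the factor `Δ⁻¹` enters as the density of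
the right Haar measure with respect to the left one. -/
theorem exists_star_wienerHopf_eq {f : G → ℂ} (hf : Integrable f μ) :
    ∃ (f' : G → ℂ) (hf' : Integrable f' μ),
      star (wienerHopf μ P f hf) = wienerHopf μ P f' hf' := by
  have hac : μ.inv ≪ μ := (quasiMeasurePreserving_inv μ).absolutelyContinuous
  have hσ : SigmaFinite μ.inv := inferInstance
  have hi : Integrable (fun g => starRingEnd ℂ (f g⁻¹)) μ.inv := by
    have h1 : Integrable (fun g => starRingEnd ℂ (f g)) μ :=
      (Complex.conjLIE.integrable_comp_iff).2 hf
    refine (MeasurableEquiv.inv G).measurableEmbedding.integrable_map_iff.2 ?_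
    simpa [Function.comp_def] using h1
  have hi' : Integrable (fun g => (μ.inv.rnDeriv μ g).toReal • starRingEnd ℂ (f g⁻¹)) μ :=
    (integrable_rnDeriv_smul_iff hac).2 hi
  refine ⟨_, hi', eq_wienerHopf hi' fun η ξ => ?_⟩
  have h2 : ∫ g, (μ.inv.rnDeriv μ g).toReal • (starRingEnd ℂ (f g⁻¹)
        * inner ℂ η (compression μ P g ξ)) ∂μ
      = ∫ g, starRingEnd ℂ (f g⁻¹) * inner ℂ η (compression μ P g ξ) ∂μ.inv :=
    integral_rnDeriv_smul hac
  simp only [smul_mul_assoc]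
  rw [h2]
  refine Eq.trans ?_ ((MeasurableEquiv.inv G).measurableEmbedding.integral_map (μ := μ)
    fun g => starRingEnd ℂ (f g⁻¹) * inner ℂ η (compression μ P g ξ)).symm
  rw [ContinuousLinearMap.star_eq_adjoint, ContinuousLinearMap.adjoint_inner_right,
    ← inner_conj_symm, inner_wienerHopf, ← integral_conj]
  refine integral_congr_ae (.of_forall fun g => ?_)
  simp [inner_compression_left, inner_conj_symm]

end Compression

/-! ### Multiplication operators -/

section Multiplication

variable {α : Type*} [MeasurableSpace α] {ν : Measure α} {X : Type*} [TopologicalSpace X]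
  [CompactSpace X] {σ : α → X}

theorem memLp_comp_mul (hσ : ∀ φ : C(X, ℂ), AEStronglyMeasurable (fun a => φ (σ a)) ν)
    (φ : C(X, ℂ)) (ξ : Lp ℂ 2 ν) : MemLp (fun a => φ (σ a) * ξ a) 2 ν :=
  (Lp.memLp ξ).of_le_mul (c := ‖φ‖) ((hσ φ).mul (Lp.aestronglyMeasurable ξ))
    (.of_forall fun a => by
      rw [norm_mul]; gcongr; exact φ.norm_coe_le_norm _)

/-- The multiplication operator by the function `φ ∘ σ` on `L²`, for `φ ∈ C(X)`. -/
noncomputable def multOp (hσ : ∀ φ : C(X, ℂ), AEStronglyMeasurable (fun a => φ (σ a)) ν) :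
    C(X, ℂ) →L[ℂ] (Lp ℂ 2 ν →L[ℂ] Lp ℂ 2 ν) :=
  LinearMap.mkContinuous₂
    (LinearMap.mk₂ ℂ (fun φ ξ => (memLp_comp_mul hσ φ ξ).toLp _)
      (fun φ ψ ξ => by
        ext1
        filter_upwards [(memLp_comp_mul hσ (φ + ψ) ξ).coeFn_toLp,
          (memLp_comp_mul hσ φ ξ).coeFn_toLp, (memLp_comp_mul hσ ψ ξ).coeFn_toLp,
          Lp.coeFn_add ((memLp_comp_mul hσ φ ξ).toLp _) ((memLp_comp_mul hσ ψ ξ).toLp _)]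
          with a h1 h2 h3 h4
        rw [h1, h4, Pi.add_apply, h2, h3, ContinuousMap.add_apply, add_mul])
      (fun c φ ξ => by
        ext1
        filter_upwards [(memLp_comp_mul hσ (c • φ) ξ).coeFn_toLp,
          (memLp_comp_mul hσ φ ξ).coeFn_toLp, Lp.coeFn_smul c ((memLp_comp_mul hσ φ ξ).toLp _)]
          with a h1 h2 h3
        rw [h1, h3, Pi.smul_apply, h2, ContinuousMap.smul_apply, smul_eq_mul, smul_eq_mul,
          mul_assoc])
      (fun φ ξ η => by
        ext1
        filter_upwards [(memLp_comp_mul hσ φ (ξ + η)).coeFn_toLp,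
          (memLp_comp_mul hσ φ ξ).coeFn_toLp, (memLp_comp_mul hσ φ η).coeFn_toLp,
          Lp.coeFn_add ((memLp_comp_mul hσ φ ξ).toLp _) ((memLp_comp_mul hσ φ η).toLp _),
          Lp.coeFn_add ξ η] with a h1 h2 h3 h4 h5
        rw [h1, h4, Pi.add_apply, h2, h3, h5, Pi.add_apply, mul_add])
      (fun c φ ξ => by
        ext1
        filter_upwards [(memLp_comp_mul hσ φ (c • ξ)).coeFn_toLp,
          (memLp_comp_mul hσ φ ξ).coeFn_toLp, Lp.coeFn_smul c ((memLp_comp_mul hσ φ ξ).toLp _),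
          Lp.coeFn_smul c ξ] with a h1 h2 h3 h4
        rw [h1, h3, Pi.smul_apply, h2, h4, Pi.smul_apply, smul_eq_mul, smul_eq_mul,
          mul_left_comm]))
    1 fun φ ξ => by
      rw [one_mul]
      refine Lp.norm_le_mul_norm_of_ae_le_mul ?_
      filter_upwards [(memLp_comp_mul hσ φ ξ).coeFn_toLp] with a ha
      rw [LinearMap.mk₂_apply, ha, norm_mul]
      gcongr
      exact φ.norm_coe_le_norm _

variable (hσ : ∀ φ : C(X, ℂ), AEStronglyMeasurable (fun a => φ (σ a)) ν)

theorem multOp_coeFn (φ : C(X, ℂ)) (ξ : Lp ℂ 2 ν) :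
    multOp hσ φ ξ =ᵐ[ν] fun a => φ (σ a) * ξ a :=
  (memLp_comp_mul hσ φ ξ).coeFn_toLp

theorem norm_multOp_le (φ : C(X, ℂ)) : ‖multOp hσ φ‖ ≤ ‖φ‖ := by
  refine ContinuousLinearMap.opNorm_le_bound _ (norm_nonneg _) fun ξ => ?_
  refine Lp.norm_le_mul_norm_of_ae_le_mul ?_
  filter_upwards [multOp_coeFn hσ φ ξ] with a ha
  rw [ha, norm_mul]
  gcongr
  exact φ.norm_coe_le_norm _

theorem multOp_mul (φ ψ : C(X, ℂ)) : multOp hσ (φ * ψ) = multOp hσ φ * multOp hσ ψ := by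
  ext1 ξ
  ext1
  rw [mul_apply_eq_comp]
  filter_upwards [multOp_coeFn hσ (φ * ψ) ξ, multOp_coeFn hσ φ (multOp hσ ψ ξ),
    multOp_coeFn hσ ψ ξ] with a h1 h2 h3
  rw [h1, h2, h3, ContinuousMap.mul_apply, mul_assoc]

theorem multOp_one : multOp hσ 1 = 1 := by
  ext1 ξ
  ext1
  filter_upwards [multOp_coeFn hσ 1 ξ] with a h1
  rw [h1, ContinuousMap.one_apply, one_mul, one_apply_eq_self]

/-- The functions `φ` for which multiplication by `φ ∘ σ` maps the C*-algebra `A` to itself form a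
closed algebra; so they are all of `C(X)`, by the Stone-Weierstrass theorem, as soon as they
include a self-adjoint family separating the points. -/
theorem multOp_mul_mem {A : NonUnitalStarSubalgebra ℂ (Lp ℂ 2 ν →L[ℂ] Lp ℂ 2 ν)}
    (hA : IsClosed (A : Set (Lp ℂ 2 ν →L[ℂ] Lp ℂ 2 ν))) {S : Set C(X, ℂ)}
    (hSstar : ∀ φ ∈ S, star φ ∈ S) (hSsep : ∀ x y, x ≠ y → ∃ φ ∈ S, φ x ≠ φ y)
    (hS : ∀ φ ∈ S, ∀ T ∈ A, multOp hσ φ * T ∈ A) (φ : C(X, ℂ)) {T : Lp ℂ 2 ν →L[ℂ] Lp ℂ 2 ν}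
    (hT : T ∈ A) : multOp hσ φ * T ∈ A := by
  let N : Subalgebra ℂ C(X, ℂ) :=
    { carrier := {φ | ∀ T ∈ A, multOp hσ φ * T ∈ A}
      mul_mem' := fun {φ ψ} hφ hψ T hT => by
        rw [multOp_mul, mul_assoc]
        exact hφ _ (hψ T hT)
      add_mem' := fun {φ ψ} hφ hψ T hT => by
        rw [map_add, add_mul]
        exact add_mem (hφ T hT) (hψ T hT)
      algebraMap_mem' := fun c T hT => by
        rw [Algebra.algebraMap_eq_smul_one, map_smul, multOp_one, smul_one_mul]
        exact SMulMemClass.smul_mem c hT }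
  have hN : IsClosed (N : Set C(X, ℂ)) := by
    have h1 : (N : Set C(X, ℂ)) = ⋂ T ∈ A, {φ | multOp hσ φ * T ∈ A} := by
      ext φ
      simp [N]
    rw [h1]
    refine isClosed_biInter fun T _ => ?_
    exact hA.preimage ((multOp hσ).continuous.mul continuous_const)
  have h1 : (StarAlgebra.adjoin ℂ S).toSubalgebra ≤ N := by
    rw [StarAlgebra.adjoin_toSubalgebra, Algebra.adjoin_le_iff]
    refine Set.union_subset hS fun φ hφ => ?_
    have h2 := hSstar _ hφ
    rw [star_star] at h2
    exact hS φ h2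
  have h2 := ContinuousMap.starSubalgebra_topologicalClosure_eq_top_of_separatesPoints
    (StarAlgebra.adjoin ℂ S) (fun x y hxy => by
      obtain ⟨φ, hφ, h⟩ := hSsep x y hxy
      exact ⟨φ, ⟨φ, StarAlgebra.subset_adjoin ℂ S hφ, rfl⟩, h⟩)
  have h3 : φ ∈ (StarAlgebra.adjoin ℂ S).topologicalClosure := by
    rw [h2]; exact StarSubalgebra.mem_top
  exact hN.closure_subset_iff.2 h1 h3 T hT

end Multiplication

/-! ### Multiplication by averages of translates of `1_P` -/

section Averages

variable {G : Type*} [Group G] [TopologicalSpace G] [IsTopologicalGroup G] [LocallyCompactSpace G]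
  [SecondCountableTopology G] [MeasurableSpace G] [BorelSpace G] {μ : Measure G} [μ.IsHaarMeasure]
  {P : Submonoid G} {X : Type*} [TopologicalSpace X] [CompactSpace X] {σ : G → X}
  (hσ : ∀ φ : C(X, ℂ), AEStronglyMeasurable (fun a => φ (σ a)) (μ.restrict (P : Set G)))

/-- `E U_h E W_{k(h ·)} = E U_h E U_h* E W_k`, because
`E U_h E U_{h⁻¹ l} E = (E U_h E U_h* E) U_l E`. -/
theorem compression_comp_wienerHopfL1 (hP : MeasurableSet (P : Set G)) (h : G) (k : Lp ℂ 1 μ)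
    (ξ : L2Sub μ P) :
    compression μ P h (wienerHopfL1 μ P (DomMulAct.mk h • k) ξ)
      = rangeProj μ P h (wienerHopfL1 μ P k ξ) := by
  refine ext_inner_left ℂ fun η => ?_
  have hadj : ∀ (S : L2Sub μ P →L[ℂ] L2Sub μ P) (ζ : L2Sub μ P),
      inner ℂ η (S ζ) = inner ℂ (ContinuousLinearMap.adjoint S η) ζ := fun S ζ =>
    (ContinuousLinearMap.adjoint_inner_left S ζ η).symm
  rw [hadj, inner_wienerHopfL1, hadj, inner_wienerHopfL1]
  simp only [← hadj]
  rw [← integral_mul_left_eq_self (fun l => k l * _) h]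
  refine integral_congr_ae ?_
  filter_upwards [DomMulAct.smul_Lp_ae_eq (DomMulAct.mk h) k] with l hl
  rw [hl, ← compression_compression hP h (h * l), inv_mul_cancel_left]
  rfl

/-- If `φ(σ(x)) = ∫ f(h) 1_P(x h) dh` on `P`, with `f ∈ L¹(G)`, then multiplication by `φ ∘ σ`
is the weak integral of the projections onto `L²(P ∩ P h⁻¹)` with weight `f(h)`. -/
theorem inner_multOp_eq_integral_rangeProj (hP : MeasurableSet (P : Set G)) {f : G → ℂ}
    (hf : Integrable f μ) {φ : C(X, ℂ)}
    (hφ : ∀ x ∈ P, φ (σ x) = ∫ h, f h * (P : Set G).indicator 1 (x * h) ∂μ) (η ζ : L2Sub μ P) :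
    inner ℂ η (multOp hσ φ ζ) = ∫ h, f h * inner ℂ η (rangeProj μ P h ζ) ∂μ := by
  set ν := μ.restrict (P : Set G) with hν
  have hi : Integrable (fun p : G × G => (f p.1 * (P : Set G).indicator 1 (p.2 * p.1))
      * inner ℂ (η p.2) (ζ p.2)) (μ.prod ν) := by
    have h1 : Integrable (fun p : G × G => f p.1 * inner ℂ (η p.2) (ζ p.2)) (μ.prod ν) :=
      hf.mul_prod (L2.integrable_inner η ζ)
    have hm : Measurable fun p : G × G => (P : Set G).indicator (1 : G → ℂ) (p.2 * p.1) :=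
      (measurable_one.indicator hP).comp (measurable_snd.mul measurable_fst)
    refine (h1.bdd_mul (c := 1) hm.aestronglyMeasurable (.of_forall fun p => ?_)).congr
      (.of_forall fun p => by simp only; ring)
    by_cases hp : p.2 * p.1 ∈ (P : Set G)
    · rw [Set.indicator_of_mem hp]; simp
    · rw [Set.indicator_of_notMem hp]; simp
  calc inner ℂ η (multOp hσ φ ζ)
      = ∫ x, ∫ h, (f h * (P : Set G).indicator 1 (x * h)) * inner ℂ (η x) (ζ x) ∂μ ∂ν := by
        rw [L2.inner_def]
        refine integral_congr_ae ?_
        filter_upwards [multOp_coeFn hσ φ ζ, ae_restrict_mem hP] with x hx hxP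
        rw [hx, hφ x hxP, integral_mul_const, RCLike.inner_apply, RCLike.inner_apply, mul_assoc]
    _ = ∫ h, ∫ x, (f h * (P : Set G).indicator 1 (x * h)) * inner ℂ (η x) (ζ x) ∂ν ∂μ :=
        (integral_integral_swap hi).symm
    _ = _ := by
        refine integral_congr_ae (.of_forall fun h => ?_)
        beta_reduce
        rw [L2.inner_def, ← integral_const_mul]
        refine integral_congr_ae ?_
        filter_upwards [rangeProj_coeFn hP h ζ] with x hx
        rw [hx, RCLike.inner_apply, RCLike.inner_apply]
        ring

theorem isClosed_wienerHopfAlgebra :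
    IsClosed (wienerHopfAlgebra μ P : Set (L2Sub μ P →L[ℂ] L2Sub μ P)) :=
  NonUnitalStarSubalgebra.isClosed_topologicalClosure _

/-- Weak integrals `∫ Θ(b, F b) db` over `G` lie in `𝓦(P)` for Bochner integrable `F` if they do so
for the functions `F = f e` with `f ∈ L¹(G)` and a constant vector `e`. -/
theorem exists_mem_wienerHopfAlgebra_weak_integral {E : Type*} [NormedAddCommGroup E]
    [NormedSpace ℂ E] {Θ : G → E →L[ℂ] (L2Sub μ P →L[ℂ] L2Sub μ P)}
    (hΘ : ∀ b e, ‖Θ b e‖ ≤ 1 * ‖e‖)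
    (hm : ∀ η ξ e, AEStronglyMeasurable (fun b => inner ℂ η (Θ b e ξ)) μ)
    (hind : ∀ (e : E) (f : G → ℂ), Integrable f μ → ∃ T ∈ wienerHopfAlgebra μ P,
      ∀ η ξ, inner ℂ η (T ξ) = ∫ b, f b * inner ℂ η (Θ b e ξ) ∂μ)
    {F : G → E} (hF : Integrable F μ) :
    ∃ T ∈ wienerHopfAlgebra μ P, ∀ η ξ, inner ℂ η (T ξ) = ∫ b, inner ℂ η (Θ b (F b) ξ) ∂μ := by
  refine exists_mem_inner_eq_integral (wienerHopfAlgebra μ P).toSubmodule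
    isClosed_wienerHopfAlgebra zero_le_one hΘ hm (fun e A hA hμA => ?_) hF
  obtain ⟨T, hT, h⟩ := hind e (A.indicator 1)
    ((integrable_indicator_iff hA).2 (integrableOn_const hμA.ne))
  refine ⟨T, hT, fun η ξ => ?_⟩
  rw [h, ← integral_indicator hA]
  congr 1
  funext b
  by_cases hb : b ∈ A <;> simp [hb]

/-- The product of the multiplication operator with `W_k` is the weak integral of the operators
`f(h) (E U_h E) W_{k(h ·)}`. Here `h ↦ f(h) k(h ·)` is Bochner integrable in `L¹(G)`, and with a
constant `k` in place of `k(h ·)` the integral is `W_f W_k`. -/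
theorem multOp_mul_wienerHopfL1_mem (hP : MeasurableSet (P : Set G)) {f : G → ℂ}
    (hf : Integrable f μ) {φ : C(X, ℂ)}
    (hφ : ∀ x ∈ P, φ (σ x) = ∫ h, f h * (P : Set G).indicator 1 (x * h) ∂μ) (k : Lp ℂ 1 μ) :
    multOp hσ φ * wienerHopfL1 μ P k ∈ wienerHopfAlgebra μ P := by
  have : Fact ((1 : ℝ≥0∞) ≠ ∞) := ⟨ENNReal.one_ne_top⟩
  have hcont : Continuous fun h : G => DomMulAct.mk h • k :=
    (DomMulAct.continuous_mk).smul continuous_const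
  have hF : Integrable (fun h => f h • (DomMulAct.mk h • k)) μ := by
    refine (hf.norm.mul_const ‖k‖).mono' (hf.1.smul hcont.aestronglyMeasurable)
      (.of_forall fun h => ?_)
    rw [norm_smul, DomMulAct.norm_smul_Lp]
  let Θ : G → Lp ℂ 1 μ →L[ℂ] (L2Sub μ P →L[ℂ] L2Sub μ P) := fun h =>
    (ContinuousLinearMap.compL ℂ _ _ _ (compression μ P h)) ∘L wienerHopfL1 μ P
  have hΘ : ∀ h k, ‖Θ h k‖ ≤ 1 * ‖k‖ := fun h k => by
    have h1 : ‖wienerHopfL1 μ P k‖ ≤ 1 * ‖k‖ :=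
      (wienerHopfL1 μ P).le_of_opNorm_le (LinearMap.mkContinuous_norm_le _ zero_le_one _) k
    refine (ContinuousLinearMap.opNorm_comp_le (compression μ P h) _).trans ?_
    exact (mul_le_mul (norm_compression_le h) h1 (norm_nonneg _) zero_le_one).trans_eq (one_mul _)
  obtain ⟨T, hT, h⟩ := exists_mem_wienerHopfAlgebra_weak_integral hΘ
    (fun η ξ k => aestronglyMeasurable_inner_compression μ P η _)
    (fun k f hf => ⟨wienerHopf μ P f hf * wienerHopfL1 μ P k, mul_mem (wienerHopf_mem hf)
      (wienerHopf_mem (L1.integrable_coeFn k)), fun η ξ => by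
        rw [mul_apply_eq_comp, inner_wienerHopf]
        rfl⟩) hF
  have h1 : multOp hσ φ * wienerHopfL1 μ P k = T := by
    refine ContinuousLinearMap.ext fun ξ => ext_inner_left ℂ fun η => ?_
    rw [h, mul_apply_eq_comp, inner_multOp_eq_integral_rangeProj hσ hP hf hφ]
    refine integral_congr_ae (.of_forall fun g => ?_)
    simp [Θ, compression_comp_wienerHopfL1 hP, inner_smul_right]
  rwa [h1]

/-- Multiplication by `φ ∘ σ` maps `𝓦(P)` to itself on the left. It is enough to see this for the
generators, the set of generators `W_f` being self-adjoint. -/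
theorem multOp_mul_mem_wienerHopfAlgebra (hP : MeasurableSet (P : Set G)) {f : G → ℂ}
    (hf : Integrable f μ) {φ : C(X, ℂ)}
    (hφ : ∀ x ∈ P, φ (σ x) = ∫ h, f h * (P : Set G).indicator 1 (x * h) ∂μ)
    {T : L2Sub μ P →L[ℂ] L2Sub μ P} (hT : T ∈ wienerHopfAlgebra μ P) :
    multOp hσ φ * T ∈ wienerHopfAlgebra μ P := by
  have hcl : IsClosed {T | multOp hσ φ * T ∈ wienerHopfAlgebra μ P} :=
    isClosed_wienerHopfAlgebra.preimage (continuous_const.mul continuous_id)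
  have hgen : ∀ (f : G → ℂ) (hf : Integrable f μ),
      multOp hσ φ * wienerHopf μ P f hf ∈ wienerHopfAlgebra μ P := fun k hk => by
    rw [← wienerHopfL1_toL1]
    exact multOp_mul_wienerHopfL1_mem hσ hP hf hφ _
  refine hcl.closure_subset_iff.2 (fun T hT => ?_) hT
  have hT' : T ∈ NonUnitalAlgebra.adjoin ℂ ({T | ∃ (f : G → ℂ) (hf : Integrable f μ),
      T = wienerHopf μ P f hf} ∪ star {T | ∃ (f : G → ℂ) (hf : Integrable f μ),
      T = wienerHopf μ P f hf}) := by
    rwa [← NonUnitalStarAlgebra.adjoin_toNonUnitalSubalgebra]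
  have hle := NonUnitalStarSubalgebra.le_topologicalClosure (NonUnitalStarAlgebra.adjoin ℂ
    {T | ∃ (f : G → ℂ) (hf : Integrable f μ), T = wienerHopf μ P f hf})
  refine NonUnitalAlgebra.adjoin_induction (R := ℂ)
    (p := fun T _ => multOp hσ φ * T ∈ wienerHopfAlgebra μ P) ?_ ?_ ?_ ?_ ?_ hT'
  · rintro T (⟨f, hf, rfl⟩ | ⟨f, hf, h⟩)
    · exact hgen f hf
    · obtain ⟨f', hf', h'⟩ := exists_star_wienerHopf_eq (P := P) hf
      rw [← star_star T, h, h']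
      exact hgen f' hf'
  · intro S T _ _ hS hT
    rw [mul_add]
    exact add_mem hS hT
  · rw [mul_zero]
    exact zero_mem _
  · intro S T _ hT' hS _
    rw [← mul_assoc]
    refine mul_mem hS (hle ?_)
    change T ∈ (NonUnitalStarAlgebra.adjoin ℂ _).toNonUnitalSubalgebra
    rwa [NonUnitalStarAlgebra.adjoin_toNonUnitalSubalgebra]
  · intro c T _ hT
    rw [mul_smul_comm]
    exact SMulMemClass.smul_mem c hT

end Averages

/-! ### Functions on the orbit of `x₀` multiply the Wiener-Hopf algebra -/

section OrbitFunctions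

variable {G : Type*} [Group G] [TopologicalSpace G] [IsTopologicalGroup G] [LocallyCompactSpace G]
  [T2Space G] [SecondCountableTopology G] [MeasurableSpace G] [BorelSpace G]
  {μ : Measure G} [μ.IsHaarMeasure] {P : Submonoid G} [IsContinuousOre P]
  {X : Type*} [TopologicalSpace X] [CompactSpace X] [T2Space X] [SecondCountableTopology X]
  [MulAction Pᵐᵒᵖ X] [ContinuousSMul Pᵐᵒᵖ X]

omit [IsTopologicalGroup G] [LocallyCompactSpace G] [T2Space G] [SecondCountableTopology G] in
theorem measurableSet_submonoid (P : Submonoid G) [IsContinuousOre P] :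
    MeasurableSet (P : Set G) :=
  (IsContinuousOre.isClosed (P := P)).measurableSet

variable (μ) in
omit [μ.IsHaarMeasure] [CompactSpace X] [T2Space X] [SecondCountableTopology X]
  [IsTopologicalGroup G] [LocallyCompactSpace G] [T2Space G] [SecondCountableTopology G] in
theorem aestronglyMeasurable_comp_act (x₀ : X) (φ : C(X, ℂ)) :
    AEStronglyMeasurable (fun g => φ (act P x₀ g)) (μ.restrict (P : Set G)) := by
  have h1 : ContinuousOn (fun g => act P x₀ g) (P : Set G) :=
    continuousOn_act.comp (f := fun g : G => (x₀, g)) (by fun_prop) fun g hg => hg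
  exact (φ.continuous.comp_continuousOn h1).aestronglyMeasurable (measurableSet_submonoid P)

variable (inj : ∀ a : P, Function.Injective fun x : X => x <• a)
  (hopen : IsOpenMap fun p : X × {a : P // (a : G) ∈ interior (P : Set G)} => p.1 <• p.2.1)

/-- The continuous function `x ↦ ∫_{Q_x} f dμ` on `X`, for `f ∈ L¹(G)`. -/
noncomputable def fractionIntegral {f : G → ℂ} (hf : Integrable f μ) : C(X, ℂ) where
  toFun x := ∫ g, (fractionSet P x).indicator f g ∂μ
  continuous_toFun := by
    refine continuous_iff_continuousAt.2 fun x => ?_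
    refine continuousAt_of_dominated (bound := fun g => ‖f g‖) (.of_forall fun x' => ?_)
      (.of_forall fun x' => .of_forall fun g => norm_indicator_le_norm_self _ _) hf.norm ?_
    · exact hf.1.indicator (isClosed_fractionSet inj x').measurableSet
    · filter_upwards [ae_eventually_mem_fractionSet_iff μ inj hopen x] with g hg
      refine tendsto_const_nhds.congr' ?_
      filter_upwards [hg] with x' hx'
      by_cases hgx : g ∈ fractionSet P x
      · rw [Set.indicator_of_mem hgx, Set.indicator_of_mem (hx'.2 hgx)]
      · rw [Set.indicator_of_notMem hgx, Set.indicator_of_notMem (mt hx'.1 hgx)]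

theorem fractionIntegral_apply {f : G → ℂ} (hf : Integrable f μ) (x : X) :
    fractionIntegral inj hopen hf x = ∫ g, (fractionSet P x).indicator f g ∂μ := rfl

variable (μ) in
/-- A set `B ⊆ Q_x \ Q_y` of finite positive measure gives the function `f = 1_B`. -/
theorem exists_fractionIntegral_ne {x y : X} (h : ¬fractionSet P x ⊆ fractionSet P y) :
    ∃ (f : G → ℂ) (hf : Integrable f μ),
      fractionIntegral inj hopen hf x ≠ fractionIntegral inj hopen hf y := by
  have h0 : μ (fractionSet P x \ fractionSet P y) ≠ 0 := fun h0 => by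
    refine h (fractionSet_subset_of_ae μ inj ?_)
    filter_upwards [measure_eq_zero_iff_ae_notMem.1 h0] with g hg hgx
    by_contra hgy
    exact hg ⟨hgx, hgy⟩
  obtain ⟨B, hBm, hB, hB0, hBfin⟩ := Measure.exists_subset_measure_lt_top
    ((isClosed_fractionSet inj x).measurableSet.diff (isClosed_fractionSet inj y).measurableSet)
    (pos_iff_ne_zero.2 h0)
  have hi : Integrable (B.indicator (1 : G → ℂ)) μ :=
    (integrable_indicator_iff hBm).2 (integrableOn_const hBfin.ne)
  refine ⟨_, hi, ?_⟩
  have h1 : (fractionSet P x).indicator (B.indicator (1 : G → ℂ)) = B.indicator 1 := by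
    rw [Set.indicator_indicator, Set.inter_eq_right.2 fun g hg => (hB hg).1]
  have h2 : (fractionSet P y).indicator (B.indicator (1 : G → ℂ)) = 0 := by
    rw [Set.indicator_indicator, (Set.disjoint_left.2 fun g hg hg' => (hB hg').2 hg).inter_eq,
      Set.indicator_empty']
  rw [fractionIntegral_apply, fractionIntegral_apply, h1, h2, integral_indicator hBm]
  simpa [measureReal_def, ENNReal.toReal_eq_zero_iff] using ⟨hB0.ne', hBfin.ne⟩

variable {x₀ : X} (A1 : fractionSet P x₀ = (P : Set G))

include A1 in
/-- For `g ∈ P` one has `Q_{x₀ g} = g⁻¹ Q_{x₀} = g⁻¹ P`. -/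
theorem fractionIntegral_act {f : G → ℂ} (hf : Integrable f μ) {g : G} (hg : g ∈ P) :
    fractionIntegral inj hopen hf (act P x₀ g)
      = ∫ h, f h * (P : Set G).indicator 1 (g * h) ∂μ := by
  rw [fractionIntegral_apply]
  congr 1
  funext h
  have h1 := (isArrow_act x₀ hg).mul_mem_fractionSet_iff h
  rw [A1] at h1
  by_cases hh : h ∈ fractionSet P (act P x₀ g)
  · rw [Set.indicator_of_mem hh, Set.indicator_of_mem (h1.2 hh), Pi.one_apply, mul_one]
  · rw [Set.indicator_of_notMem hh, Set.indicator_of_notMem (mt h1.1 hh), mul_zero]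

include inj hopen A1 in
/-- The functions `x ↦ ∫_{Q_x} f dμ` separate the points of `X` because the sets `Q_x` do, even
modulo null sets. -/
theorem multOp_act_mul_mem_wienerHopfAlgebra
    (A3 : ∀ x y : X, fractionSet P x = fractionSet P y → x = y) (φ : C(X, ℂ))
    {T : L2Sub μ P →L[ℂ] L2Sub μ P} (hT : T ∈ wienerHopfAlgebra μ P) :
    multOp (aestronglyMeasurable_comp_act μ x₀) φ * T ∈ wienerHopfAlgebra μ P := by
  refine multOp_mul_mem _ isClosed_wienerHopfAlgebra
    (S := {φ | ∃ (f : G → ℂ) (hf : Integrable f μ), φ = fractionIntegral inj hopen hf})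
    ?_ ?_ ?_ φ hT
  · rintro _ ⟨f, hf, rfl⟩
    have hf' : Integrable (fun g => starRingEnd ℂ (f g)) μ :=
      (Complex.conjLIE.integrable_comp_iff).2 hf
    refine ⟨_, hf', ?_⟩
    ext x
    rw [ContinuousMap.star_apply, fractionIntegral_apply, fractionIntegral_apply,
      ← starRingEnd_apply, ← integral_conj]
    congr 1
    funext g
    by_cases hg : g ∈ fractionSet P x <;> simp [hg]
  · intro x y hxy
    by_cases h : fractionSet P x ⊆ fractionSet P y
    · have h' : ¬fractionSet P y ⊆ fractionSet P x := fun h' => hxy (A3 x y (h.antisymm h'))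
      obtain ⟨f, hf, hne⟩ := exists_fractionIntegral_ne μ inj hopen h'
      exact ⟨_, ⟨f, hf, rfl⟩, hne.symm⟩
    · obtain ⟨f, hf, hne⟩ := exists_fractionIntegral_ne μ inj hopen h
      exact ⟨_, ⟨f, hf, rfl⟩, hne⟩
  · rintro _ ⟨f, hf, rfl⟩ T hT
    exact multOp_mul_mem_wienerHopfAlgebra _ (measurableSet_submonoid P) hf
      (fun g hg => fractionIntegral_act inj hopen A1 hf hg) hT

end OrbitFunctions

/-! ### The regular representation over `x₀` on `L²(P)` -/

section OrbitRepresentation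

variable {G : Type*} [Group G] [TopologicalSpace G] [IsTopologicalGroup G] [LocallyCompactSpace G]
  [T2Space G] [SecondCountableTopology G] [MeasurableSpace G] [BorelSpace G]
  {μ : Measure G} [μ.IsHaarMeasure] {P : Submonoid G} [IsContinuousOre P]
  {X : Type*} [TopologicalSpace X] [CompactSpace X] [T2Space X] [SecondCountableTopology X]
  [MulAction Pᵐᵒᵖ X] [ContinuousSMul Pᵐᵒᵖ X]
  (inj : ∀ a : P, Function.Injective fun x : X => x <• a)
  {x₀ : X} (A1 : fractionSet P x₀ = (P : Set G))

variable (μ x₀) in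
/-- The map `L²(P) → L²(𝒢ˣ, λˣ)` for `x = x₀`; it is unitary if `Q_x = P`. -/
noncomputable def orbitRestrict :
    L2Sub μ P →L[ℂ] FibreL2 (semidirectHaar (X := X) P μ) (unitOf P x₀) :=
  fibreRestrict μ inj (unitOf P x₀) ∘L extendL2 μ P

omit [LocallyCompactSpace G] [T2Space G] [SecondCountableTopology G] [μ.IsHaarMeasure]
  [SecondCountableTopology X] in
theorem norm_orbitRestrict_le : ‖orbitRestrict μ inj x₀‖ ≤ 1 := by
  refine ContinuousLinearMap.opNorm_le_bound _ zero_le_one fun ξ => ?_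
  refine (ContinuousLinearMap.le_of_opNorm_le _
    (norm_fibreRestrict_le inj (unitOf P x₀)) _).trans ?_
  gcongr
  exact norm_extendL2_le μ P ξ

omit [μ.IsHaarMeasure] [IsTopologicalGroup G] [LocallyCompactSpace G] [T2Space G]
  [SecondCountableTopology G] in
theorem extendL2_restrictL2 {ζ : Lp ℂ 2 μ} (hζ : ∀ᵐ g ∂μ, g ∉ P → ζ g = 0) :
    extendL2 μ P (restrictL2 μ P ζ) = ζ := by
  ext1
  filter_upwards [extendL2_coeFn μ P (measurableSet_submonoid P) (restrictL2 μ P ζ), hζ,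
    (ae_restrict_iff' (measurableSet_submonoid P)).1 (restrictL2_coeFn (P := P) ζ)] with g h1 h2 h3
  rw [h1]
  by_cases hg : g ∈ (P : Set G)
  · rw [Set.indicator_of_mem hg, h3 hg]
  · rw [Set.indicator_of_notMem hg, h2 hg]

omit [SecondCountableTopology X] [μ.IsHaarMeasure] [LocallyCompactSpace G] [T2Space G]
  [SecondCountableTopology G] in
include A1 in
theorem orbitRestrict_adjoint (η : FibreL2 (semidirectHaar (X := X) P μ) (unitOf P x₀)) :
    orbitRestrict μ inj x₀ (ContinuousLinearMap.adjoint (orbitRestrict μ inj x₀) η) = η := by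
  have h1 : ContinuousLinearMap.adjoint (orbitRestrict μ inj x₀) η
      = restrictL2 μ P (ContinuousLinearMap.adjoint (fibreRestrict μ inj (unitOf P x₀)) η) := by
    rw [orbitRestrict, ContinuousLinearMap.adjoint_comp, extendL2,
      ContinuousLinearMap.adjoint_adjoint]
    rfl
  rw [h1]
  change fibreRestrict μ inj (unitOf P x₀) (extendL2 μ P _) = η
  rw [extendL2_restrictL2, fibreRestrict_adjoint]
  filter_upwards [adjoint_fibreRestrict_coeFn inj (unitOf P x₀) η] with g hg hgP
  rw [hg, Function.extend_apply', Pi.zero_apply]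
  change g ∉ Set.range _
  rw [range_fibreCoord, A1]
  exact hgP

variable (μ) in
/-- The representation of `∏ₓ B(L²(𝒢ˣ, λˣ))` on `L²(P)` that is given by the component over
`x₀`. -/
noncomputable def orbitRep :
    OperatorFamilies (FibreL2 (semidirectHaar (X := X) P μ)) →⋆ₙₐ[ℂ]
      (L2Sub μ P →L[ℂ] L2Sub μ P) :=
  OperatorFamilies.conjCoord (orbitRestrict μ inj x₀) (orbitRestrict_adjoint inj A1)

omit [SecondCountableTopology X] [μ.IsHaarMeasure] [LocallyCompactSpace G] [T2Space G]
  [SecondCountableTopology G] in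
theorem inner_orbitRep (T : OperatorFamilies (FibreL2 (semidirectHaar (X := X) P μ)))
    (η ξ : L2Sub μ P) : inner ℂ η (orbitRep μ inj A1 T ξ)
      = inner ℂ (extendL2 μ P η) (extendHom μ inj x₀ T (extendL2 μ P ξ)) := by
  rw [orbitRep, OperatorFamilies.conjCoord_apply, ContinuousLinearMap.adjoint_inner_right]
  exact (ContinuousLinearMap.adjoint_inner_right (fibreRestrict μ inj (unitOf P x₀)) _ _).symm

omit [SecondCountableTopology X] [T2Space G] in
/-- After the substitution `h = g k`, the integral operator with kernel
`F(s(x₀, g), g⁻¹ h) = F(x₀ g, k)` is the integral over `k` of the products of the multiplication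
operator by `g ↦ F(x₀ g, k)` and the compressed translation `E U_k E`. -/
theorem inner_orbitRep_of_isRegularRep {f : C_c(Arrows (UnitSpace X P), ℂ)}
    {T : OperatorFamilies (FibreL2 (semidirectHaar (X := X) P μ))}
    (hT : IsRegularRep (semidirectHaar (X := X) P μ) f T) {F : C(X × G, ℂ)}
    (hFc : HasCompactSupport F) (hF : ∀ γ, f γ = F (Arrows.toProd P γ)) (η ξ : L2Sub μ P) :
    inner ℂ η (orbitRep μ inj A1 T ξ) = ∫ k, (sqrtModular k)⁻¹ * inner ℂ η
      (multOp (aestronglyMeasurable_comp_act μ x₀) (sliceMap F k) (compression μ P k ξ)) ∂μ := by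
  have hP := measurableSet_submonoid P
  obtain ⟨C, hC⟩ := exists_isSchurKernel μ (sliceMap F).continuous (hasCompactSupport_sliceMap hFc)
  set η' := extendL2 μ P η with hη'
  set ξ' := extendL2 μ P ξ with hξ'
  set J : G × G → ℂ := fun p =>
    starRingEnd ℂ (η' p.1) * (fibreKernel (P := P) F x₀ p.1 p.2 * ξ' p.2) with hJ
  have hJi : Integrable J (μ.prod μ) := integrable_sesq_kernel (measurable_fibreKernel inj F x₀) hC
    (enorm_fibreKernel_le F x₀) η' ξ'
  have hJi' : Integrable (Function.uncurry fun g k => J (g, g * k)) (μ.prod μ) :=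
    (measurePreserving_prod_mul μ μ).integrable_comp_of_integrable hJi
  have h1 : inner ℂ η' (extendHom μ inj x₀ T ξ') = ∫ g, ∫ h, J (g, h) ∂μ ∂μ :=
    (hasKernel_extendHom inj hT hF x₀).inner_eq η' ξ'
  have h2 : ∫ g, ∫ h, J (g, h) ∂μ ∂μ = ∫ g, ∫ k, J (g, g * k) ∂μ ∂μ := by
    congr 1
    funext g
    exact (integral_mul_left_eq_self (fun h => J (g, h)) g).symm
  rw [inner_orbitRep, h1, h2, integral_integral_swap hJi']
  refine integral_congr_ae (.of_forall fun k => ?_)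
  beta_reduce
  rw [L2.inner_def, ← integral_const_mul, ← integral_indicator hP]
  refine integral_congr_ae ?_
  filter_upwards [extendL2_coeFn μ P hP η,
    (quasiMeasurePreserving_mul_right_haar μ k).ae (extendL2_coeFn μ P hP ξ),
    (ae_restrict_iff' hP).1 (multOp_coeFn (aestronglyMeasurable_comp_act μ x₀) (sliceMap F k)
      (compression μ P k ξ)), (ae_restrict_iff' hP).1 (compression_coeFn k ξ)] with g h3 h4 h5 h6
  have hQ : ∀ l, l ∈ fractionSet P x₀ ↔ l ∈ (P : Set G) := fun l => by rw [A1]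
  simp only [hJ, fibreKernel]
  by_cases hg : g ∈ (P : Set G)
  · rw [Set.indicator_of_mem hg, h5 hg, h6 hg, hη', h3, Set.indicator_of_mem hg,
      RCLike.inner_apply, sliceMap_apply]
    by_cases hgk : g * k ∈ (P : Set G)
    · rw [if_pos ⟨(hQ _).2 hg, (hQ _).2 hgk⟩, (isArrow_act x₀ hg).arrowSource_eq inj,
        inv_mul_cancel_left, hξ']
      have := sqrtModular_ne_zero k
      field_simp
    · rw [hξ', h4, Set.indicator_of_notMem hgk]
      simp
  · rw [Set.indicator_of_notMem hg, if_neg fun h => hg ((hQ _).1 h.1), zero_mul, mul_zero]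

include inj A1 in
/-- The integrand in `inner_orbitRep_of_isRegularRep` is a Bochner integrable function of `k` with
values in `C(X)`, applied to `E U_k E`; for constant functions `φ` the integrals are products of a
multiplication operator and some `W_f`. -/
theorem orbitRep_mem_wienerHopfAlgebra_of_isRegularRep
    (hopen : IsOpenMap fun p : X × {a : P // (a : G) ∈ interior (P : Set G)} => p.1 <• p.2.1)
    (A3 : ∀ x y : X, fractionSet P x = fractionSet P y → x = y)
    {f : C_c(Arrows (UnitSpace X P), ℂ)}
    {T : OperatorFamilies (FibreL2 (semidirectHaar (X := X) P μ))}
    (hT : IsRegularRep (semidirectHaar (X := X) P μ) f T) :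
    orbitRep μ inj A1 T ∈ wienerHopfAlgebra μ P := by
  obtain ⟨F, hFc, hF⟩ := exists_extension_arrows inj f
  set M := multOp (aestronglyMeasurable_comp_act (P := P) μ x₀) with hM
  let Θ : G → C(X, ℂ) →L[ℂ] (L2Sub μ P →L[ℂ] L2Sub μ P) := fun k =>
    ((ContinuousLinearMap.compL ℂ (L2Sub μ P) (L2Sub μ P) (L2Sub μ P)).flip
      (compression μ P k)) ∘L M
  have hΘ' : ∀ k φ, Θ k φ = M φ ∘L compression μ P k := fun k φ => rfl
  have hΘi : ∀ k φ η ξ, inner ℂ η (Θ k φ ξ)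
      = inner ℂ (ContinuousLinearMap.adjoint (M φ) η) (compression μ P k ξ) := fun k φ η ξ =>
    (ContinuousLinearMap.adjoint_inner_left (M φ) (compression μ P k ξ) η).symm
  have hΘ : ∀ k φ, ‖Θ k φ‖ ≤ 1 * ‖φ‖ := fun k φ => by
    refine (ContinuousLinearMap.opNorm_comp_le (M φ) (compression μ P k)).trans ?_
    rw [one_mul]
    exact (mul_le_mul (norm_multOp_le _ φ) (norm_compression_le k) (norm_nonneg _)
      (norm_nonneg _)).trans_eq (mul_one _)
  have hFi : Integrable (fun k => (sqrtModular k)⁻¹ • sliceMap F k) μ := by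
    refine Continuous.integrable_of_hasCompactSupport ?_
      ((hasCompactSupport_sliceMap hFc).mono fun k hk h0 => hk ?_)
    swap
    · beta_reduce
      rw [h0, smul_zero]
    exact (continuous_sqrtModular.inv₀ sqrtModular_ne_zero).smul (sliceMap F).continuous
  have hm : ∀ η ξ φ, AEStronglyMeasurable (fun k => inner ℂ η (Θ k φ ξ)) μ := fun η ξ φ => by
    simp only [hΘi]
    exact aestronglyMeasurable_inner_compression μ P _ _
  have hind : ∀ (φ : C(X, ℂ)) (f : G → ℂ), Integrable f μ → ∃ T ∈ wienerHopfAlgebra μ P,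
      ∀ η ξ, inner ℂ η (T ξ) = ∫ k, f k * inner ℂ η (Θ k φ ξ) ∂μ := fun φ f hf => by
    refine ⟨M φ * wienerHopf μ P f hf,
      multOp_act_mul_mem_wienerHopfAlgebra inj hopen A1 A3 φ (wienerHopf_mem hf), fun η ξ => ?_⟩
    simp only [hΘi]
    rw [← inner_wienerHopf μ P f hf, ContinuousLinearMap.adjoint_inner_left]
    rfl
  obtain ⟨S, hS, h⟩ := exists_mem_wienerHopfAlgebra_weak_integral (P := P) hΘ hm hind hFi
  have h1 : orbitRep μ inj A1 T = S := by
    refine ContinuousLinearMap.ext fun ξ => ext_inner_left ℂ fun η => ?_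
    rw [h, inner_orbitRep_of_isRegularRep inj A1 hT hFc hF]
    refine integral_congr_ae (.of_forall fun k => ?_)
    beta_reduce
    rw [map_smul, _root_.smul_apply, inner_smul_right, hΘ']
    rfl
  rwa [h1]

omit [SecondCountableTopology X] [T2Space G] in
/-- For `c ∈ C_c(G)`, the Wiener-Hopf operator `W_c` represents the function
`(x, g) ↦ Δ(g)^{1/2} c(g)` on `X ⋊ P`. -/
theorem exists_orbitRep_eq_wienerHopf {c : G → ℂ} (hc : Continuous c) (hc' : HasCompactSupport c)
    (hci : Integrable c μ) : ∃ T ∈ reducedCStarAlgebra (semidirectHaar (X := X) P μ),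
      orbitRep μ inj A1 T = wienerHopf μ P c hci := by
  let F : C(X × G, ℂ) :=
    ⟨fun p => sqrtModular p.2 * c p.2, (continuous_sqrtModular.mul hc).comp continuous_snd⟩
  have hFc : HasCompactSupport F := by
    refine HasCompactSupport.intro (isCompact_univ.prod hc'.isCompact) fun p hp => ?_
    have h1 : p.2 ∉ tsupport c := fun h => hp ⟨Set.mem_univ _, h⟩
    change sqrtModular p.2 * c p.2 = 0
    rw [image_eq_zero_of_notMem_tsupport h1, mul_zero]
  have he := isClosedEmbedding_toProd (P := P) inj
  let f : C_c(Arrows (UnitSpace X P), ℂ) :=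
    ⟨⟨F ∘ Arrows.toProd P, F.continuous.comp he.continuous⟩, hFc.comp_isClosedEmbedding he⟩
  have hf : ∀ γ, f γ = F (Arrows.toProd P γ) := fun γ => rfl
  obtain ⟨T, hT⟩ := exists_isRegularRep (μ := μ) inj (continuous_sqrtModular.mul hc)
    hc'.mul_left (f := f) hf
  refine ⟨T, NonUnitalStarSubalgebra.le_topologicalClosure _
    (NonUnitalStarAlgebra.subset_adjoin ℂ _ ⟨f, hT⟩), eq_wienerHopf hci fun η ξ => ?_⟩
  rw [inner_orbitRep_of_isRegularRep inj A1 hT hFc hf]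
  refine integral_congr_ae (.of_forall fun k => ?_)
  have h1 : sliceMap F k = (sqrtModular k * c k) • (1 : C(X, ℂ)) := by
    ext x
    simp [F]
  have := sqrtModular_ne_zero k
  beta_reduce
  rw [h1, map_smul, multOp_one, _root_.smul_apply, one_apply_eq_self, inner_smul_right]
  field_simp

end OrbitRepresentation

/-! ### The isomorphism -/

section Isomorphism

variable {G : Type*} [Group G] [TopologicalSpace G] [IsTopologicalGroup G] [LocallyCompactSpace G]
  [T2Space G] [SecondCountableTopology G] [MeasurableSpace G] [BorelSpace G]
  {μ : Measure G} [μ.IsHaarMeasure] {P : Submonoid G} [IsContinuousOre P]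
  {X : Type*} [TopologicalSpace X] [CompactSpace X] [T2Space X] [SecondCountableTopology X]
  [MulAction Pᵐᵒᵖ X] [ContinuousSMul Pᵐᵒᵖ X]
  (inj : ∀ a : P, Function.Injective fun x : X => x <• a)
  {x₀ : X} (A1 : fractionSet P x₀ = (P : Set G))

variable (μ) in
/-- The restriction of the representation on `L²(P)` to `C*_red(X ⋊ P)`. -/
noncomputable def orbitRepReduced :
    reducedCStarAlgebra (semidirectHaar (X := X) P μ) →⋆ₙₐ[ℂ] (L2Sub μ P →L[ℂ] L2Sub μ P) :=
  (orbitRep μ inj A1).comp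
    (NonUnitalStarSubalgebraClass.subtype (reducedCStarAlgebra (semidirectHaar (X := X) P μ)))

omit [μ.IsHaarMeasure] [SecondCountableTopology X] [LocallyCompactSpace G] [T2Space G]
  [SecondCountableTopology G] in
theorem orbitRepReduced_apply (T : reducedCStarAlgebra (semidirectHaar (X := X) P μ)) :
    orbitRepReduced μ inj A1 T = orbitRep μ inj A1 T := rfl

omit [μ.IsHaarMeasure] [SecondCountableTopology X] [LocallyCompactSpace G] [T2Space G]
  [SecondCountableTopology G] in
theorem norm_orbitRep_le (T : OperatorFamilies (FibreL2 (semidirectHaar (X := X) P μ))) :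
    ‖orbitRep μ inj A1 T‖ ≤ ‖T‖ :=
  (OperatorFamilies.norm_conjCoord_le _ (norm_orbitRestrict_le inj) T).trans (T.norm_coord_le _)

variable (hopen : IsOpenMap fun p : X × {a : P // (a : G) ∈ interior (P : Set G)} => p.1 <• p.2.1)
  (A2 : Dense {x : X | ∃ a : P, x = x₀ <• a})
  (A3 : ∀ x y : X, fractionSet P x = fractionSet P y → x = y)

include hopen A2 in
/-- By (A2), the regular representation over `x₀` computes the reduced norm. -/
theorem isometry_orbitRepReduced : Isometry (orbitRepReduced μ inj A1) := by
  refine AddMonoidHomClass.isometry_of_norm _ fun T => le_antisymm (norm_orbitRep_le inj A1 _) ?_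
  exact (norm_le_norm_coord_of_mem_reducedCStarAlgebra inj hopen A2 T.2).trans
    (OperatorFamilies.norm_coord_le_norm_conjCoord (orbitRestrict_adjoint inj A1)
      (norm_orbitRestrict_le inj) _)

include hopen A3 in
theorem orbitRep_mem_wienerHopfAlgebra
    {T : OperatorFamilies (FibreL2 (semidirectHaar (X := X) P μ))}
    (hT : T ∈ reducedCStarAlgebra (semidirectHaar (X := X) P μ)) :
    orbitRep μ inj A1 T ∈ wienerHopfAlgebra μ P := by
  have hcont : Continuous (orbitRep μ inj A1) :=
    AddMonoidHomClass.continuous_of_bound (orbitRep μ inj A1) 1 fun T => by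
      rw [one_mul]; exact norm_orbitRep_le inj A1 T
  have hcl : IsClosed {T | orbitRep μ inj A1 T ∈ wienerHopfAlgebra μ P} :=
    isClosed_wienerHopfAlgebra.preimage hcont
  refine hcl.closure_subset_iff.2 (fun T hT => ?_) hT
  have h1 : NonUnitalStarAlgebra.adjoin ℂ
      {T | ∃ f : C_c(Arrows (UnitSpace X P), ℂ), IsRegularRep (semidirectHaar (X := X) P μ) f T}
      ≤ (wienerHopfAlgebra μ P).comap (orbitRep μ inj A1) := by
    refine NonUnitalStarAlgebra.adjoin_le ?_
    rintro T ⟨f, hf⟩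
    exact orbitRep_mem_wienerHopfAlgebra_of_isRegularRep inj A1 hopen A3 hf
  exact h1 hT

include hopen A2 in
theorem wienerHopfAlgebra_le_range :
    wienerHopfAlgebra μ P ≤ NonUnitalStarAlgHom.range (orbitRepReduced μ inj A1) := by
  have hA : IsClosed (reducedCStarAlgebra (semidirectHaar (X := X) P μ) :
      Set (OperatorFamilies (FibreL2 (semidirectHaar (X := X) P μ)))) :=
    NonUnitalStarSubalgebra.isClosed_topologicalClosure _
  have : CompleteSpace (reducedCStarAlgebra (semidirectHaar (X := X) P μ)) :=
    hA.completeSpace_coe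
  have hR : IsClosed (Set.range (orbitRepReduced μ inj A1)) :=
    (isometry_orbitRepReduced inj A1 hopen A2).isClosedEmbedding.isClosed_range
  refine NonUnitalStarSubalgebra.topologicalClosure_minimal _
    (NonUnitalStarAlgebra.adjoin_le ?_) hR
  rintro _ ⟨f, hf, rfl⟩
  change wienerHopf μ P f hf ∈ Set.range (orbitRepReduced μ inj A1)
  -- `W_f` is the limit of the operators `W_c` for `c ∈ C_c(G)` close to `f` in `L¹(G)`
  refine hR.closure_subset (Metric.mem_closure_iff.2 fun ε hε => ?_)
  obtain ⟨c, hc', hcε, hc, hci⟩ := hf.exists_hasCompactSupport_integral_sub_le (half_pos hε)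
  obtain ⟨T, hT, h⟩ := exists_orbitRep_eq_wienerHopf inj A1 hc hc' hci
  refine ⟨_, ⟨⟨T, hT⟩, rfl⟩, ?_⟩
  rw [orbitRepReduced_apply, h, ← wienerHopfL1_toL1 hf, ← wienerHopfL1_toL1 hci, dist_eq_norm,
    ← map_sub, ← Integrable.toL1_sub]
  have h1 := (wienerHopfL1 μ P).le_of_opNorm_le
    (LinearMap.mkContinuous_norm_le _ zero_le_one _) ((hf.sub hci).toL1 (f - c))
  refine (h1.trans_eq (one_mul _)).trans_lt ?_
  rw [L1.norm_of_fun_eq_integral_norm]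
  exact lt_of_le_of_lt hcε (half_lt_self hε)

end Isomorphism

/-- Let `P` be a closed subsemigroup with identity of a locally compact group `G` such that
`G = P P⁻¹` and `Int P` is dense in `P`, and let `P` act on the right, continuously and injectively,
on the compact space `X`. If `X × Int P → X` is open and (A1), (A2), (A3) hold, then the Wiener-Hopf
algebra of `P` is isomorphic to the reduced C*-algebra of the groupoid `X ⋊ P`. -/
theorem theorem5p5
    {G : Type*} [Group G] [TopologicalSpace G] [IsTopologicalGroup G] [LocallyCompactSpace G]
    [T2Space G] [SecondCountableTopology G] [MeasurableSpace G] [BorelSpace G]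
    (μ : MeasureTheory.Measure G) [μ.IsHaarMeasure]
    (P : Submonoid G) [IsContinuousOre P]
    {X : Type*} [TopologicalSpace X] [CompactSpace X] [T2Space X] [SecondCountableTopology X]
    [MulAction Pᵐᵒᵖ X] [ContinuousSMul Pᵐᵒᵖ X]
    (injective_action : ∀ a : P, Function.Injective fun x : X => x <• a)
    (isOpenMap_action :
      IsOpenMap fun p : X × {a : P // (a : G) ∈ interior (P : Set G)} => p.1 <• p.2.1)
    (x₀ : X)
    (A1 : fractionSet P x₀ = (P : Set G))
    (A2 : Dense {x : X | ∃ a : P, x = x₀ <• a})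
    (A3 : ∀ x y : X, fractionSet P x = fractionSet P y → x = y) :
    Nonempty (wienerHopfAlgebra μ P ≃⋆ₐ[ℂ] reducedCStarAlgebra (semidirectHaar (X := X) P μ)) := by
  let ρ := NonUnitalStarAlgHom.codRestrict (orbitRepReduced μ injective_action A1)
    (wienerHopfAlgebra μ P) fun T =>
      orbitRep_mem_wienerHopfAlgebra injective_action A1 isOpenMap_action A3 T.2
  have hρ : Function.Bijective ρ := by
    refine ⟨fun S T h => ?_, fun W => ?_⟩
    · exact (isometry_orbitRepReduced injective_action A1 isOpenMap_action A2).injective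
        (congrArg Subtype.val h)
    · obtain ⟨T, hT⟩ := wienerHopfAlgebra_le_range injective_action A1 isOpenMap_action A2 W.2
      exact ⟨T, Subtype.ext hT⟩
  exact ⟨(StarAlgEquiv.ofBijective ρ hρ).symm⟩
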